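/- Let $K\ge 1$ and let $P_{Y_1,\ldots,Y_K|X}$ be a discrete memoryless broadcast channel with finite input alphabet $\mathcal X$ and finite output alphabets $\mathcal Y_1,\ldots,\mathcal Y_K$. All logarithms are natural. Put $$B=\max_{x,x'\in\mathcal X}\ \min_{1\le j\le K} D\big(P_{Y_j|X}(\cdot|x)\,\|\,P_{Y_j|X}(\cdot|x')\big),\qquad B_j=\max_{x,x'\in\mathcal X} D\big(P_{Y_j|X}(\cdot|x)\,\|\,P_{Y_j|X}(\cdot|x')\big),\qquad B_{\max}=\max_{1\le j\le K}B_j,$$ $$C=\max_{P_X}\ \min_{1\le j\le K} I(X;Y_j),\qquad C_j=\max_{P_X} I(X;Y_j),\qquad \overline C=\min_{1\le j\le K} C_j .$$ An $(M,N)$-variable-length feedback code with termination (VLFT code) for a common message, with $M$ a positive integer and $N$ a positive real, consists of: a message $W$ uniform on $\mathcal W=\{1,\ldots,M\}$; encoders $f_n:\mathcal W\times\mathcal Y_1^{n-1}\times\cdots\times\mathcal Y_K^{n-1}\to\mathcal X$, $n\ge 1$, giving the channel inputs $X_n=f_n(W,Y_1^{n-1},\ldots,Y_K^{n-1})$; decoders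 $g^{(j)}_n:\mathcal Y_j^n\to\mathcal W$; and, for each $j$, a stopping time $\tau_j$ of the filtration $(\sigma(Y_j^n))_{n\ge 0}$, such that $\tau=\max_j\tau_j$ satisfies $\mathbb E(\tau)\le N$. Receiver $j$ decides $\hat W_j=g^{(j)}_{\tau_j}(Y_j^{\tau_j})$, and the error probability is $\mathsf P_{\mathrm e}=\mathbb P\big(\bigcup_{j=1}^K\{\hat W_j\ne W\}\big)$. A pair $(R,E)$ of non-negative reals is achievable if there are $(M_N,N)$-VLFT codes with $M_N\ge 2$, for $N\to\infty$, whose error probabilities $\mathsf P_{\mathrm e}(N)$ satisfy $$\liminf_{N\to\infty}\frac{\ln M_N}{N}\ge R,\qquad \lim_{N\to\infty}\mathsf P_{\mathrm e}(N)=0,\qquad \liminf_{N\to\infty}-\frac{\ln \mathsf P_{\mathrm e}(N)}{N}\ge E .$$ The reliability function is $E(R)=\sup\{E:(R,E)\text{ is achievable}\}$ (with $\sup\emptyset=-\infty$). Theorem. If $B_{\max}<\infty$, then $$E(R)\ \ge\ B\Big(1-\frac RC\Big)\qquad\text{for all } 0\le R<C,$$ and $$E(R)\ \le\ \min_{1\le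 j\le K} B_j\Big(1-\frac R{C_j}\Big)\qquad\text{for all } 0\le R<\overline C .$$ -/

import Mathlib

open MeasureTheory ProbabilityTheory Filter
open scoped ENNReal

universe u v

/-- A `K`-user discrete memoryless broadcast channel `P_{Y_1,…,Y_K|X}`: for every input symbol, a
probability mass function on the tuples of output symbols. -/
abbrev BroadcastChannel {K : ℕ} (𝒳 : Type u) (𝒴 : Fin K → Type v) : Type (max u v) :=
  𝒳 → PMF (∀ j, 𝒴 j)

namespace BroadcastChannel

section Information

variable {K : ℕ} {𝒳 : Type u} {𝒴 : Fin K → Type v}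

/-- The marginal channel `P_{Y_j|X}` to receiver `j`. -/
noncomputable def marginal (ch : BroadcastChannel 𝒳 𝒴) (j : Fin K) (x : 𝒳) : PMF (𝒴 j) :=
  (ch x).map (fun y => y j)

/-- The joint probability `P_{X,Y_j}(x, y)` when the input has distribution `p`. -/
noncomputable def jointProb (ch : BroadcastChannel 𝒳 𝒴) (p : PMF 𝒳) (j : Fin K)
    (x : 𝒳) (y : 𝒴 j) : ℝ :=
  (p x).toReal * (ch.marginal j x y).toReal

/-- The output distribution `P_{Y_j}` when the input has distribution `p`. -/
noncomputable def outputPMF (ch : BroadcastChannel 𝒳 𝒴) (p : PMF 𝒳) (j : Fin K) : PMF (𝒴 j) :=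
  p.bind (ch.marginal j)

/-- The mutual information `I(X; Y_j)` in nats, when the input `X` has distribution `p`.
(A term with `P_{X,Y_j}(x, y) = 0` vanishes, and a term with `P_{X,Y_j}(x, y) > 0` has a positive
denominator.) -/
noncomputable def mutualInfo [Fintype 𝒳] [∀ j, Fintype (𝒴 j)] (ch : BroadcastChannel 𝒳 𝒴)
    (p : PMF 𝒳) (j : Fin K) : ℝ :=
  ∑ x, ∑ y, ch.jointProb p j x y *
    Real.log (ch.jointProb p j x y / ((p x).toReal * (ch.outputPMF p j y).toReal))

/-- `C = max_{P_X} min_j I(X; Y_j)`. -/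
noncomputable def C [Fintype 𝒳] [∀ j, Fintype (𝒴 j)] (ch : BroadcastChannel 𝒳 𝒴) : ℝ :=
  ⨆ p : PMF 𝒳, ⨅ j, ch.mutualInfo p j

/-- `C_j = max_{P_X} I(X; Y_j)`. -/
noncomputable def Cuser [Fintype 𝒳] [∀ j, Fintype (𝒴 j)] (ch : BroadcastChannel 𝒳 𝒴)
    (j : Fin K) : ℝ :=
  ⨆ p : PMF 𝒳, ch.mutualInfo p j

/-- `C̄ = min_j C_j`. -/
noncomputable def Cbar [Fintype 𝒳] [∀ j, Fintype (𝒴 j)] (ch : BroadcastChannel 𝒳 𝒴) : ℝ :=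
  ⨅ j, ch.Cuser j

variable [∀ j, MeasurableSpace (𝒴 j)]

/-- The relative entropy `D(P_{Y_j|X}(·|x) ‖ P_{Y_j|X}(·|x'))` in nats; it may be infinite. -/
noncomputable def relEntropy (ch : BroadcastChannel 𝒳 𝒴) (j : Fin K) (x x' : 𝒳) : ℝ≥0∞ :=
  InformationTheory.klDiv (ch.marginal j x).toMeasure (ch.marginal j x').toMeasure

/-- `B = max_{x,x'} min_j D(P_{Y_j|X}(·|x) ‖ P_{Y_j|X}(·|x'))`. -/
noncomputable def B (ch : BroadcastChannel 𝒳 𝒴) : ℝ≥0∞ :=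
  ⨆ x, ⨆ x', ⨅ j, ch.relEntropy j x x'

/-- `B_j = max_{x,x'} D(P_{Y_j|X}(·|x) ‖ P_{Y_j|X}(·|x'))`. -/
noncomputable def Buser (ch : BroadcastChannel 𝒳 𝒴) (j : Fin K) : ℝ≥0∞ :=
  ⨆ x, ⨆ x', ch.relEntropy j x x'

/-- `B_max = max_j B_j`. -/
noncomputable def Bmax (ch : BroadcastChannel 𝒳 𝒴) : ℝ≥0∞ :=
  ⨆ j, ch.Buser j

end Information

end BroadcastChannel

/-- The sample space of a transmission: the message and the infinite sequence of output tuples.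
The component `ω.2 n j` is the output `Y_{j,n+1}` at receiver `j`. -/
abbrev Outcome {K : ℕ} (𝒴 : Fin K → Type v) (M : ℕ) : Type v :=
  Fin M × (ℕ → ∀ j, 𝒴 j)

namespace Outcome

variable {K : ℕ} {𝒴 : Fin K → Type v} {M : ℕ}

/-- The vector `Y_j^n` of the first `n` outputs at receiver `j`. -/
def pastAt (j : Fin K) (n : ℕ) (ω : Outcome 𝒴 M) : Fin n → 𝒴 j :=
  fun i => ω.2 i j

variable [∀ j, MeasurableSpace (𝒴 j)]

/-- The filtration `(σ(Y_j^n))_{n ≥ 0}` generated by the outputs at receiver `j`; at time `0` it is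
trivial. -/
def filtrationAt (𝒴 : Fin K → Type v) [∀ j, MeasurableSpace (𝒴 j)] (M : ℕ) (j : Fin K) :
    Filtration ℕ (inferInstance : MeasurableSpace (Outcome 𝒴 M)) where
  seq n := MeasurableSpace.comap (pastAt j n) inferInstance
  mono' m n hmn := by
    have h : pastAt (𝒴 := 𝒴) (M := M) j m =
        (fun (y : Fin n → 𝒴 j) (i : Fin m) => y (Fin.castLE hmn i)) ∘ pastAt j n := rfl
    simp only [h, ← MeasurableSpace.comap_comp]
    exact MeasurableSpace.comap_mono (Measurable.comap_le (by fun_prop))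
  le' n := by
    refine Measurable.comap_le ?_
    unfold pastAt
    fun_prop

end Outcome

/-- A variable-length feedback code with termination for `M` equiprobable messages over a `K`-user
broadcast channel with common message. -/
structure VLFTCode {K : ℕ} (𝒳 : Type u) (𝒴 : Fin K → Type v) [∀ j, MeasurableSpace (𝒴 j)]
    (M : ℕ) where
  /-- The encoders: `encoder n w y` is the input sent at time `n + 1` for the message `w`, after the
  `n` output tuples `y` have been observed. -/
  encoder : (n : ℕ) → Fin M → (Fin n → ∀ j, 𝒴 j) → 𝒳
  /-- The decoders: `decoder j n y` is the estimate by receiver `j` at time `n`. -/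
  decoder : (j : Fin K) → (n : ℕ) → (Fin n → 𝒴 j) → Fin M
  /-- The time `τ_j` at which receiver `j` stops. -/
  stopTime : Fin K → Outcome 𝒴 M → ℕ∞
  /-- `τ_j` is a stopping time of the filtration of the outputs at receiver `j`. -/
  isStoppingTime : ∀ j, IsStoppingTime (Outcome.filtrationAt 𝒴 M j) (stopTime j)

namespace VLFTCode

variable {K : ℕ} {𝒳 : Type u} {𝒴 : Fin K → Type v} [∀ j, MeasurableSpace (𝒴 j)] {M : ℕ}

section Law

variable [∀ j, Fintype (𝒴 j)] [∀ j, DiscreteMeasurableSpace (𝒴 j)]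

/-- The conditional law of the next output tuple, given the message `w` and the previous output
tuples `Y_1, …, Y_{n+1}` (stored at the indices `0, …, n`): it is that of the channel, with the
input that the encoder chooses. -/
noncomputable def outputKernel (c : VLFTCode 𝒳 𝒴 M) (ch : BroadcastChannel 𝒳 𝒴) (w : Fin M)
    (n : ℕ) : Kernel (Π _ : Finset.Iic n, ∀ j, 𝒴 j) (∀ j, 𝒴 j) :=
  Kernel.ofFunOfCountable fun y =>
    (ch (c.encoder (n + 1) w fun i =>
      y ⟨i, Finset.mem_Iic.2 (Nat.lt_succ_iff.1 i.isLt)⟩)).toMeasure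

instance (c : VLFTCode 𝒳 𝒴 M) (ch : BroadcastChannel 𝒳 𝒴) (w : Fin M) (n : ℕ) :
    IsMarkovKernel (c.outputKernel ch w n) :=
  ⟨fun _ => PMF.toMeasure.isProbabilityMeasure _⟩

/-- The law of the infinite sequence of output tuples when the message `w` is sent. -/
noncomputable def outputLaw (c : VLFTCode 𝒳 𝒴 M) (ch : BroadcastChannel 𝒳 𝒴) (w : Fin M) :
    Measure (ℕ → ∀ j, 𝒴 j) :=
  Kernel.trajMeasure (X := fun _ => ∀ j, 𝒴 j)
    (ch (c.encoder 0 w Fin.elim0)).toMeasure (c.outputKernel ch w)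

/-- The joint law of the message, uniform on the `M` messages, and the outputs. -/
noncomputable def law (c : VLFTCode 𝒳 𝒴 M) (ch : BroadcastChannel 𝒳 𝒴) :
    Measure (Outcome 𝒴 M) :=
  ∑ w : Fin M, (M : ℝ≥0∞)⁻¹ • (Measure.dirac w).prod (c.outputLaw ch w)

end Law

/-- The stopping variable `τ = max_j τ_j`. -/
noncomputable def stopMax (c : VLFTCode 𝒳 𝒴 M) (ω : Outcome 𝒴 M) : ℕ∞ :=
  ⨆ j, c.stopTime j ω

/-- The error event: some receiver `j` does not stop with the estimate `Ŵ_j` equal to the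
message. -/
def errorEvent (c : VLFTCode 𝒳 𝒴 M) : Set (Outcome 𝒴 M) :=
  {ω | ∃ j, ¬ ∃ n : ℕ, c.stopTime j ω = n ∧ c.decoder j n (ω.pastAt j n) = ω.1}

variable [∀ j, Fintype (𝒴 j)] [∀ j, DiscreteMeasurableSpace (𝒴 j)]

/-- The expectation `𝔼(τ)`. -/
noncomputable def expectedStop (c : VLFTCode 𝒳 𝒴 M) (ch : BroadcastChannel 𝒳 𝒴) : ℝ≥0∞ :=
  ∫⁻ ω, (c.stopMax ω : ℝ≥0∞) ∂(c.law ch)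

/-- The error probability `P_e`. -/
noncomputable def errorProb (c : VLFTCode 𝒳 𝒴 M) (ch : BroadcastChannel 𝒳 𝒴) : ℝ≥0∞ :=
  c.law ch c.errorEvent

end VLFTCode

namespace BroadcastChannel

variable {K : ℕ} {𝒳 : Type u} {𝒴 : Fin K → Type v} [∀ j, MeasurableSpace (𝒴 j)]
  [∀ j, Fintype (𝒴 j)] [∀ j, DiscreteMeasurableSpace (𝒴 j)]

/-- `(R, E)` is an achievable rate-exponent pair: there are codes with `M N ≥ 2` messages and
`𝔼(τ) ≤ N`, one for every real `N > 0`, with `liminf (ln M_N) / N ≥ R`, `P_e → 0` and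
`liminf -(ln P_e) / N ≥ E` as `N → ∞`. Here `-ln 0 = ∞`. -/
def IsAchievable (ch : BroadcastChannel 𝒳 𝒴) (R E : ℝ) : Prop :=
  0 ≤ R ∧ 0 ≤ E ∧
  ∃ (M : ℝ → ℕ) (c : ∀ N : ℝ, VLFTCode 𝒳 𝒴 (M N)),
    (∀ N : ℝ, 0 < N → 2 ≤ M N ∧ (c N).expectedStop ch ≤ ENNReal.ofReal N) ∧
    (R : EReal) ≤ liminf (fun N : ℝ => ((Real.log (M N) / N : ℝ) : EReal)) atTop ∧
    Tendsto (fun N : ℝ => (c N).errorProb ch) atTop (nhds 0) ∧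
    (E : EReal) ≤ liminf (fun N : ℝ => -ENNReal.log ((c N).errorProb ch) / (N : EReal)) atTop

/-- The reliability function `E(R)`, the supremum of the exponents achievable at rate `R`. -/
noncomputable def reliability (ch : BroadcastChannel 𝒳 𝒴) (R : ℝ) : EReal :=
  sSup {e : EReal | ∃ E : ℝ, e = E ∧ ch.IsAchievable R E}

end BroadcastChannel

/-! Upper bound. Fix a receiver `j` and follow the posterior of the message given its outputs. Two
functionals of the posterior move at bounded mean speed: per letter the entropy falls by at most
`C_j` (`IsFullChannel.sum_negEntropy_le`), and the log odds of the true message rise by at most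
`B_j` (`IsFullChannel.sum_meanLogOdds_le`). The encoder sees more than receiver `j`, so given the
message and the past of `j` the next input is random; both bounds are convexity statements that
allow such mixtures. A decision with error probability `e` needs mean log odds of about `-ln e`.
Roughly `ln M` nats of entropy have to be removed at speed `C_j` before one message dominates, and
then `-ln e` nats of log odds gathered at speed `B_j`, so the mean duration is at least about `ln M
/ C_j + (-ln e) / B_j`. `BoundedTest.duration_ge` proves this by induction on a finite decision
tree, and `VLFTCode.exists_boundedTest` reduces a receiver to such a tree by truncation. Masses stay
unnormalized, so that no conditioning is needed. Finiteness of `B_max` gives the letters a common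
support, hence bounded likelihood ratios, so that the log odds at the change of phase are bounded by
a constant.

Lower bound. Time is cut into rounds. In each round a block code good for all receivers at once
(`BroadcastChannel.exists_codebook`) is followed by a repeated input `x` or `x'` that tells whether
all of them decoded correctly, which the encoder knows by feedback. A receiver stops in the first
round in which its likelihood ratio test accepts `x` (`BroadcastChannel.exists_ackTest`). An error
requires a failed block code and a false acceptance of `x'`, and the latter has the exponent of the
divergence between the two inputs. Repetitions are rare, so the mean duration is about one round. If
the shares `a > R / C` and `b` of the time, with `a + b < 1`, go to the two phases, exponents up to
about `b * B` result. -/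

/-! ### Word probabilities under the law of a feedback code. -/

theorem measure_eq_sum_fiber {Ω β : Type*} [MeasurableSpace Ω] [MeasurableSpace β] [Fintype β]
    [MeasurableSingletonClass β] (μ : Measure Ω) {f : Ω → β} (hf : Measurable f) (s : Set Ω) :
    μ s = ∑ b, μ (s ∩ f ⁻¹' {b}) := by
  classical
  -- Additivity is applied to the measurable fibres under the restricted measure, so `s` itself may
  -- be arbitrary.
  have h := measure_biUnion_finset₀ (μ := μ.restrict s) (s := Finset.univ)
    (f := fun b : β => f ⁻¹' {b}) ?_ ?_
  · have hu : (⋃ b ∈ (Finset.univ : Finset β), f ⁻¹' {b}) = Set.univ := by ext; simp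
    rw [hu, Measure.restrict_apply_univ] at h
    rw [h]
    refine Finset.sum_congr rfl fun b _ => ?_
    rw [Measure.restrict_apply (hf (measurableSet_singleton b)), Set.inter_comm]
  · intro b _ b' _ hbb'
    refine Disjoint.aedisjoint ?_
    simp only [Set.disjoint_left]
    rintro ω rfl h
    exact hbb' h
  · exact fun b _ => (hf (measurableSet_singleton b)).nullMeasurableSet

namespace Outcome

variable {K : ℕ} {𝒴 : Fin K → Type v} 

/-- The first `n` output tuples. -/
def prefixAt (n : ℕ) (ω : ℕ → ∀ j, 𝒴 j) : Fin n → ∀ j, 𝒴 j := fun i => ω i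

/-- The `m` output tuples after the first `n`. -/
def blockAt (n m : ℕ) (ω : ℕ → ∀ j, 𝒴 j) : Fin m → ∀ j, 𝒴 j := fun i => ω (n + i)

variable [∀ j, MeasurableSpace (𝒴 j)]

@[fun_prop]
theorem measurable_prefixAt (n : ℕ) : Measurable (prefixAt (𝒴 := 𝒴) n) := by
  unfold prefixAt; fun_prop

@[fun_prop]
theorem measurable_blockAt (n m : ℕ) : Measurable (blockAt (𝒴 := 𝒴) n m) := by
  unfold blockAt; fun_prop

end Outcome

namespace VLFTCode

open Outcome

variable {K : ℕ} {𝒳 : Type u} {𝒴 : Fin K → Type v} [∀ j, MeasurableSpace (𝒴 j)] {M : ℕ}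
  [∀ j, Fintype (𝒴 j)] [∀ j, DiscreteMeasurableSpace (𝒴 j)]

instance (c : VLFTCode 𝒳 𝒴 M) (ch : BroadcastChannel 𝒳 𝒴) (w : Fin M) :
    IsProbabilityMeasure (c.outputLaw ch w) := by
  have : IsProbabilityMeasure (ch (c.encoder 0 w Fin.elim0)).toMeasure :=
    PMF.toMeasure.isProbabilityMeasure _
  unfold outputLaw; infer_instance

/-- The Markov property of `Kernel.trajMeasure` in elementary form. The first letter comes from the
initial law and letter `n + 2` from the kernel with index `n`, hence the two cases. -/
theorem outputLaw_prefixAt_singleton (c : VLFTCode 𝒳 𝒴 M) (ch : BroadcastChannel 𝒳 𝒴) (w : Fin M)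
    (n : ℕ) (z : Fin n → ∀ j, 𝒴 j) (S : Set (∀ j, 𝒴 j)) :
    c.outputLaw ch w {ω | prefixAt n ω = z ∧ ω n ∈ S} =
      c.outputLaw ch w {ω | prefixAt n ω = z} * (ch (c.encoder n w z)).toMeasure S := by
  have : IsProbabilityMeasure (ch (c.encoder 0 w Fin.elim0)).toMeasure :=
    PMF.toMeasure.isProbabilityMeasure _
  cases n with
  | zero =>
    have hz : z = Fin.elim0 := Subsingleton.elim _ _
    subst hz
    have h1 : {ω : ℕ → ∀ j, 𝒴 j | prefixAt 0 ω = Fin.elim0} = Set.univ := by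
      ext ω; simp [eq_iff_true_of_subsingleton]
    have h2 : {ω : ℕ → ∀ j, 𝒴 j | prefixAt 0 ω = Fin.elim0 ∧ ω 0 ∈ S} =
      Preorder.frestrictLe (π := fun _ : ℕ => ∀ j, 𝒴 j) 0 ⁻¹'
        ((MeasurableEquiv.piUnique (fun _ : Finset.Iic 0 => ∀ j, 𝒴 j)) ⁻¹' S) := by
      ext ω; simp [eq_iff_true_of_subsingleton, MeasurableEquiv.piUnique]; rfl
    have hS : MeasurableSet S := MeasurableSet.of_discrete
    rw [h1, measure_univ, one_mul, h2, ← Measure.map_apply (by fun_prop)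
      (MeasurableEquiv.measurable _ hS), outputLaw, Kernel.trajMeasure, Measure.map_comp _ _ (by fun_prop),
      Kernel.traj_map_frestrictLe, Kernel.partialTraj_self, Measure.id_comp,
      Measure.map_apply (MeasurableEquiv.measurable _) (MeasurableEquiv.measurable _ hS),
      ← Set.preimage_comp]
    rfl
  | succ n =>
    have key := Kernel.map_frestrictLe_trajMeasure_compProd_eq_map_trajMeasure
      (X := fun _ => ∀ j, 𝒴 j) (μ₀ := (ch (c.encoder 0 w Fin.elim0)).toMeasure)
      (κ := c.outputKernel ch w) (a := n)
    let z' : Π _ : Finset.Iic n, ∀ j, 𝒴 j := fun i => z ⟨i, Nat.lt_succ_iff.2 (Finset.mem_Iic.1 i.2)⟩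
    have hz : ∀ ω : ℕ → ∀ j, 𝒴 j, prefixAt (n + 1) ω = z ↔ Preorder.frestrictLe n ω = z' := by
      intro ω
      constructor
      · intro h; funext i
        exact congrFun h ⟨i, Nat.lt_succ_iff.2 (Finset.mem_Iic.1 i.2)⟩
      · intro h; funext i
        exact congrFun h ⟨i, Finset.mem_Iic.2 (Nat.lt_succ_iff.1 i.2)⟩
    have hS : MeasurableSet S := MeasurableSet.of_discrete
    have hm : MeasurableSet ({z'} ×ˢ S : Set ((Π _ : Finset.Iic n, ∀ j, 𝒴 j) × (∀ j, 𝒴 j))) :=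
      (measurableSet_singleton _).prod hS
    have h := congrArg (fun ν => ν ({z'} ×ˢ S)) key
    beta_reduce at h
    rw [Measure.compProd_apply_prod (measurableSet_singleton _) hS, lintegral_singleton,
      Measure.map_apply (by fun_prop) (measurableSet_singleton _),
      Measure.map_apply (by fun_prop) hm] at h
    have e1 : {ω : ℕ → ∀ j, 𝒴 j | prefixAt (n + 1) ω = z} = Preorder.frestrictLe (π := fun _ : ℕ => ∀ j, 𝒴 j) n ⁻¹' {z'} := by
      ext ω; exact hz ω
    have e2 : {ω : ℕ → ∀ j, 𝒴 j | prefixAt (n + 1) ω = z ∧ ω (n + 1) ∈ S} =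
        (fun x => (Preorder.frestrictLe n x, x (n + 1))) ⁻¹' ({z'} ×ˢ S) := by
      ext ω
      simp only [Set.mem_ofPred_eq, Set.mem_preimage, Set.mem_prod, Set.mem_singleton_iff, hz ω]
    rw [e1, e2, outputLaw]
    rw [← h, mul_comm]
    rfl

/-- The probability of the output word `y` when the input word is `x`. -/
noncomputable def _root_.BroadcastChannel.wordProb (ch : BroadcastChannel 𝒳 𝒴) {m : ℕ}
    (x : Fin m → 𝒳) (y : Fin m → ∀ j, 𝒴 j) : ℝ :=
  ∏ i, (ch (x i) (y i)).toReal

/-- By `hx` the inputs inside the block do not react to the outputs inside it, so the block sees a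
memoryless channel; the last letter is split off by induction. -/
theorem outputLaw_blockAt_singleton (c : VLFTCode 𝒳 𝒴 M) (ch : BroadcastChannel 𝒳 𝒴) (w : Fin M)
    {n m : ℕ} (z : Fin n → ∀ j, 𝒴 j) (v : Fin m → ∀ j, 𝒴 j) (x : Fin m → 𝒳)
    (hx : ∀ ω, prefixAt n ω = z → ∀ i : Fin m, c.encoder (n + i) w (prefixAt (n + i) ω) = x i) :
    (c.outputLaw ch w).real {ω | prefixAt n ω = z ∧ blockAt n m ω = v} =
      (c.outputLaw ch w).real {ω | prefixAt n ω = z} * ch.wordProb x v := by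
  induction m with
  | zero =>
    have : ∀ ω, blockAt n 0 ω = v := fun ω => Subsingleton.elim _ _
    simp [this, BroadcastChannel.wordProb]
  | succ m ih =>
    have ih' := ih (fun i => v i.castSucc) (fun i => x i.castSucc)
      (fun ω h i => hx ω h i.castSucc)
    rw [BroadcastChannel.wordProb, Fin.prod_univ_castSucc, ← mul_assoc]
    rw [BroadcastChannel.wordProb] at ih'
    rw [← ih']
    have hsplit : {ω : ℕ → ∀ j, 𝒴 j | prefixAt n ω = z ∧ blockAt n (m + 1) ω = v} =
        {ω | (prefixAt n ω = z ∧ blockAt n m ω = fun i => v i.castSucc) ∧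
          ω (n + m) ∈ ({v (Fin.last m)} : Set (∀ j, 𝒴 j))} := by
      ext ω
      simp only [Set.mem_ofPred_eq, Set.mem_singleton_iff, and_assoc]
      refine and_congr_right fun _ => ⟨?_, ?_⟩
      · rintro rfl; exact ⟨rfl, rfl⟩
      · rintro ⟨h1, h2⟩
        funext i
        refine Fin.lastCases ?_ (fun i => ?_) i
        · exact h2
        · exact congrFun h1 i
    -- If the event is non-empty, any member `ω₀` fixes the whole prefix of length `n + m`, to which
    -- the one-letter law applies.
    rcases Set.eq_empty_or_nonempty
      {ω : ℕ → ∀ j, 𝒴 j | prefixAt n ω = z ∧ blockAt n m ω = fun i => v i.castSucc} with he | ⟨ω₀, h₀⟩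
    · have he' : {ω : ℕ → ∀ j, 𝒴 j | prefixAt n ω = z ∧ blockAt n (m + 1) ω = v} = ∅ := by
        rw [hsplit]
        refine Set.eq_empty_of_forall_notMem fun ω hω => ?_
        have : ω ∈ (∅ : Set (ℕ → ∀ j, 𝒴 j)) := he ▸ hω.1
        exact this
      rw [he, he']; simp
    · have hpre : ∀ ω : ℕ → ∀ j, 𝒴 j,
          (prefixAt n ω = z ∧ blockAt n m ω = fun i => v i.castSucc) ↔
            prefixAt (n + m) ω = prefixAt (n + m) ω₀ := by
        intro ω
        rw [← h₀.1, ← h₀.2]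
        constructor
        · rintro ⟨h1, h2⟩
          funext i
          refine Fin.addCases (fun i => congrFun h1 i) (fun i => congrFun h2 i) i
        · intro h
          exact ⟨funext fun i => congrFun h (Fin.castAdd m i),
            funext fun i => congrFun h (Fin.natAdd n i)⟩
      rw [hsplit]
      simp only [hpre]
      have := outputLaw_prefixAt_singleton c ch w (n + m) (prefixAt (n + m) ω₀) {v (Fin.last m)}
      rw [measureReal_def, this, ENNReal.toReal_mul, PMF.toMeasure_apply_singleton _ _
        (measurableSet_singleton _), ← hx ω₀ h₀.1 (Fin.last m)]
      rfl

theorem outputLaw_block_eq (c : VLFTCode 𝒳 𝒴 M) (ch : BroadcastChannel 𝒳 𝒴) (w : Fin M)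
    {n m : ℕ} (A : Set (Fin n → ∀ j, 𝒴 j)) (S : (Fin n → ∀ j, 𝒴 j) → Set (Fin m → ∀ j, 𝒴 j))
    (x : (Fin n → ∀ j, 𝒴 j) → Fin m → 𝒳)
    (hx : ∀ ω, prefixAt n ω ∈ A → ∀ i : Fin m,
      c.encoder (n + i) w (prefixAt (n + i) ω) = x (prefixAt n ω) i) :
    (c.outputLaw ch w).real {ω | prefixAt n ω ∈ A ∧ blockAt n m ω ∈ S (prefixAt n ω)} =
      ∑ z, A.indicator (fun z => (c.outputLaw ch w).real {ω | prefixAt n ω = z} *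
        ∑ v, (S z).indicator (ch.wordProb (x z)) v) z := by
  classical
  set μ := c.outputLaw ch w
  rw [measureReal_def, measure_eq_sum_fiber μ ((measurable_prefixAt n).prodMk (measurable_blockAt n m)),
    ENNReal.toReal_sum (fun _ _ => measure_ne_top _ _), Fintype.sum_prod_type]
  refine Finset.sum_congr rfl fun z _ => ?_
  by_cases hz : z ∈ A
  · rw [Set.indicator_of_mem hz, Finset.mul_sum]
    refine Finset.sum_congr rfl fun v _ => ?_
    by_cases hv : v ∈ S z
    · rw [Set.indicator_of_mem hv, ← outputLaw_blockAt_singleton c ch w z v (x z)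
        (fun ω h => by subst h; exact hx ω hz), measureReal_def]
      congr 2
      ext ω
      simp only [Set.mem_inter_iff, Set.mem_ofPred_eq, Set.mem_preimage, Set.mem_singleton_iff,
        Prod.mk.injEq]
      refine ⟨fun h => h.2, ?_⟩
      rintro ⟨rfl, rfl⟩
      exact ⟨⟨hz, hv⟩, rfl, rfl⟩
    · rw [Set.indicator_of_notMem hv, mul_zero]
      have : {ω | prefixAt n ω ∈ A ∧ blockAt n m ω ∈ S (prefixAt n ω)} ∩
          (fun ω => (prefixAt n ω, blockAt n m ω)) ⁻¹' {(z, v)} = ∅ := by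
        refine Set.eq_empty_of_forall_notMem fun ω hω => hv ?_
        obtain ⟨h1, h2⟩ := hω
        simp only [Set.mem_preimage, Set.mem_singleton_iff, Prod.mk.injEq] at h2
        rw [← h2.1, ← h2.2]; exact h1.2
      rw [this]; simp
  · rw [Set.indicator_of_notMem hz]
    refine Finset.sum_eq_zero fun v _ => ?_
    have : {ω | prefixAt n ω ∈ A ∧ blockAt n m ω ∈ S (prefixAt n ω)} ∩
        (fun ω => (prefixAt n ω, blockAt n m ω)) ⁻¹' {(z, v)} = ∅ := by
      refine Set.eq_empty_of_forall_notMem fun ω hω => hz ?_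
      obtain ⟨h1, h2⟩ := hω
      simp only [Set.mem_preimage, Set.mem_singleton_iff, Prod.mk.injEq] at h2
      rw [← h2.1]; exact h1.1
    rw [this]; simp

theorem outputLaw_prefix_eq (c : VLFTCode 𝒳 𝒴 M) (ch : BroadcastChannel 𝒳 𝒴) (w : Fin M)
    {n : ℕ} (A : Set (Fin n → ∀ j, 𝒴 j)) :
    (c.outputLaw ch w).real {ω | prefixAt n ω ∈ A} =
      ∑ z, A.indicator (fun z => (c.outputLaw ch w).real {ω | prefixAt n ω = z}) z := by
  have h := outputLaw_block_eq c ch w (m := 0) A (fun _ => Set.univ) (fun _ => Fin.elim0)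
    (fun _ _ i => i.elim0)
  simpa [BroadcastChannel.wordProb] using h

theorem outputLaw_block_le (c : VLFTCode 𝒳 𝒴 M) (ch : BroadcastChannel 𝒳 𝒴) (w : Fin M)
    {n m : ℕ} (A : Set (Fin n → ∀ j, 𝒴 j)) (S : (Fin n → ∀ j, 𝒴 j) → Set (Fin m → ∀ j, 𝒴 j))
    (x : (Fin n → ∀ j, 𝒴 j) → Fin m → 𝒳)
    (hx : ∀ ω, prefixAt n ω ∈ A → ∀ i : Fin m,
      c.encoder (n + i) w (prefixAt (n + i) ω) = x (prefixAt n ω) i) {q : ℝ}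
    (hq : ∀ z ∈ A, ∑ v, (S z).indicator (ch.wordProb (x z)) v ≤ q) :
    (c.outputLaw ch w).real {ω | prefixAt n ω ∈ A ∧ blockAt n m ω ∈ S (prefixAt n ω)} ≤
      q * (c.outputLaw ch w).real {ω | prefixAt n ω ∈ A} := by
  rw [outputLaw_block_eq c ch w A S x hx, outputLaw_prefix_eq, Finset.mul_sum]
  refine Finset.sum_le_sum fun z _ => ?_
  by_cases hz : z ∈ A
  · rw [Set.indicator_of_mem hz, Set.indicator_of_mem hz, mul_comm]
    exact mul_le_mul_of_nonneg_right (hq z hz) measureReal_nonneg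
  · simp [hz]

end VLFTCode

/-! ### Information inequalities for unnormalized posteriors. -/

/-- The log-sum inequality. -/
theorem sum_mul_log_sum_div_sum_le {ι : Type*} (s : Finset ι) {u v : ι → ℝ}
    (hu : ∀ i ∈ s, 0 ≤ u i) (hv : ∀ i ∈ s, 0 ≤ v i) (huv : ∀ i ∈ s, v i = 0 → u i = 0) :
    (∑ i ∈ s, u i) * Real.log ((∑ i ∈ s, u i) / ∑ i ∈ s, v i) ≤
      ∑ i ∈ s, u i * Real.log (u i / v i) := by
  rcases (Finset.sum_nonneg hu).eq_or_lt with hU | hU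
  · rw [← hU, zero_mul]
    rw [eq_comm, Finset.sum_eq_zero_iff_of_nonneg hu] at hU
    rw [Finset.sum_eq_zero fun i hi => by rw [hU i hi, zero_mul]]
  · set U := ∑ i ∈ s, u i with hUdef
    set W := ∑ i ∈ s, v i with hWdef
    have hW : 0 < W := by
      rcases (Finset.sum_nonneg hv).eq_or_lt with h | h
      · exfalso
        rw [eq_comm, Finset.sum_eq_zero_iff_of_nonneg hv] at h
        rw [hUdef, Finset.sum_eq_zero fun i hi => huv i hi (h i hi)] at hU
        exact lt_irrefl _ hU
      · exact h
    -- This is `log t ≤ t - 1` at `t = v i * (U / W) / u i`; the linear terms cancel on summation.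
    have key : ∀ i ∈ s, u i * Real.log (U / W) + u i - v i * (U / W) ≤
        u i * Real.log (u i / v i) := by
      intro i hi
      rcases (hu i hi).eq_or_lt with h | h
      · rw [← h]
        have := mul_nonneg (hv i hi) (div_nonneg hU.le hW.le)
        linarith
      · have hvi : 0 < v i := lt_of_le_of_ne (hv i hi) fun h0 => h.ne' (huv i hi h0.symm)
        have h1 : Real.log (v i * (U / W) / u i) ≤ v i * (U / W) / u i - 1 :=
          Real.log_le_sub_one_of_pos (by positivity)
        rw [Real.log_div (by positivity) h.ne', Real.log_mul hvi.ne' (by positivity)] at h1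
        rw [Real.log_div h.ne' hvi.ne']
        have h2 := mul_le_mul_of_nonneg_left h1 h.le
        have h3 : u i * (v i * (U / W) / u i - 1) = v i * (U / W) - u i := by
          field_simp
        rw [h3] at h2
        linarith
    have h := Finset.sum_le_sum key
    rw [Finset.sum_sub_distrib, Finset.sum_add_distrib, ← Finset.sum_mul, ← Finset.sum_mul,
      ← hUdef, ← hWdef, mul_div_cancel₀ _ hW.ne'] at h
    linarith

section Posterior

variable {W X Y : Type*} [Fintype W] [Fintype X] [Fintype Y]

/-- The negative entropy of an unnormalized distribution. -/
noncomputable def negEntropy (a : W → ℝ) : ℝ := ∑ w, a w * Real.log (a w / ∑ w', a w')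

/-- The mean log odds of the true message under an unnormalized posterior distribution. -/
noncomputable def meanLogOdds (a : W → ℝ) : ℝ :=
  ∑ w, a w * Real.log (a w / (∑ w', a w' - a w))

/-- A finite family of distributions with a common support. -/
structure IsFullChannel (V : X → Y → ℝ) : Prop where
  nonneg : ∀ x y, 0 ≤ V x y
  sum_eq_one : ∀ x, ∑ y, V x y = 1
  supp : ∀ x x' y, V x' y = 0 → V x y = 0

variable {V : X → Y → ℝ} 

theorem IsFullChannel.sum_sum_mul (hV : IsFullChannel V) (b : X → ℝ) :
    ∑ y, ∑ x, b x * V x y = ∑ x, b x := by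
  rw [Finset.sum_comm]
  simp [← Finset.mul_sum, hV.sum_eq_one]

/-- Joint convexity of relative entropy. With the product weights `b x * b' x'` both mixtures become
sums over pairs of inputs, and the log-sum inequality over pairs leaves only divergences between
single inputs. -/
theorem IsFullChannel.sum_mul_log_odds_le (hV : IsFullChannel V) {B : ℝ}
    (hB : ∀ x x', ∑ y, V x y * Real.log (V x y / V x' y) ≤ B) {b b' : X → ℝ}
    (hb : ∀ x, 0 ≤ b x) (hb' : ∀ x, 0 ≤ b' x) (hα : 0 < ∑ x, b x) (hβ : 0 < ∑ x, b' x) :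
    ∑ y, (∑ x, b x * V x y) * Real.log ((∑ x, b x * V x y) / ∑ x, b' x * V x y) ≤
      (∑ x, b x) * Real.log ((∑ x, b x) / ∑ x, b' x) + (∑ x, b x) * B := by
  set α := ∑ x, b x with hαd
  set β := ∑ x, b' x with hβd
  have key : ∀ y, β * ((∑ x, b x * V x y) * Real.log ((∑ x, b x * V x y) / ∑ x, b' x * V x y)) -
      β * (∑ x, b x * V x y) * Real.log (α / β) ≤
      ∑ i : X × X, b i.1 * b' i.2 * (V i.1 y * Real.log (V i.1 y / V i.2 y)) := by
    intro y
    have h := sum_mul_log_sum_div_sum_le (Finset.univ : Finset (X × X))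
      (u := fun i => b i.1 * b' i.2 * V i.1 y) (v := fun i => b i.1 * b' i.2 * V i.2 y)
      (fun i _ => mul_nonneg (mul_nonneg (hb _) (hb' _)) (hV.nonneg _ _))
      (fun i _ => mul_nonneg (mul_nonneg (hb _) (hb' _)) (hV.nonneg _ _))
      (fun i _ h => by
        rcases mul_eq_zero.1 h with h | h
        · rw [h, zero_mul]
        · rw [hV.supp i.1 i.2 y h, mul_zero])
    have hu : ∑ i : X × X, b i.1 * b' i.2 * V i.1 y = β * ∑ x, b x * V x y := by
      rw [Fintype.sum_prod_type, hβd, Finset.sum_mul_sum, Finset.sum_comm]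
      exact Finset.sum_congr rfl fun _ _ => Finset.sum_congr rfl fun _ _ => by ring
    have hv : ∑ i : X × X, b i.1 * b' i.2 * V i.2 y = α * ∑ x, b' x * V x y := by
      rw [Fintype.sum_prod_type, hαd, Finset.sum_mul_sum]
      exact Finset.sum_congr rfl fun _ _ => Finset.sum_congr rfl fun _ _ => by ring
    rw [hu, hv] at h
    have hr : ∀ i : X × X, b i.1 * b' i.2 * V i.1 y *
        Real.log (b i.1 * b' i.2 * V i.1 y / (b i.1 * b' i.2 * V i.2 y)) =
        b i.1 * b' i.2 * (V i.1 y * Real.log (V i.1 y / V i.2 y)) := by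
      intro i
      by_cases h0 : b i.1 * b' i.2 = 0
      · simp [h0]
      · rw [mul_div_mul_left _ _ h0, mul_assoc]
    simp only [hr] at h
    refine le_trans (le_of_eq ?_) h
    rcases (Finset.sum_nonneg fun x (_ : x ∈ Finset.univ) =>
      mul_nonneg (hb x) (hV.nonneg x y)).eq_or_lt with hn | hn
    · rw [← hn]; simp
    · have hd : 0 < ∑ x, b' x * V x y := by
        obtain ⟨x, _, hx⟩ := Finset.exists_ne_zero_of_sum_ne_zero hn.ne'
        obtain ⟨x', _, hx'⟩ := Finset.exists_ne_zero_of_sum_ne_zero hβ.ne'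
        refine Finset.sum_pos' (fun x _ => mul_nonneg (hb' x) (hV.nonneg x y)) ⟨x', Finset.mem_univ _, ?_⟩
        have h1 : V x' y ≠ 0 := fun h => (right_ne_zero_of_mul hx) (hV.supp _ _ _ h)
        exact mul_pos (lt_of_le_of_ne (hb' x') (Ne.symm hx')) (lt_of_le_of_ne (hV.nonneg _ _) (Ne.symm h1))
      rw [Real.log_div hn.ne' hd.ne', Real.log_div hα.ne' hβ.ne',
        Real.log_div (by positivity) (by positivity), Real.log_mul hβ.ne' hn.ne', Real.log_mul hα.ne' hd.ne']
      ring
  have hs := Finset.sum_le_sum fun y (_ : y ∈ Finset.univ) => key y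
  rw [Finset.sum_comm, Finset.sum_sub_distrib, ← Finset.mul_sum, ← Finset.sum_mul,
    ← Finset.mul_sum, hV.sum_sum_mul, ← hαd] at hs
  have hr : ∑ i : X × X, ∑ y, b i.1 * b' i.2 * (V i.1 y * Real.log (V i.1 y / V i.2 y)) ≤
      α * β * B := by
    rw [hαd, hβd, Finset.sum_mul_sum, Finset.sum_mul, Fintype.sum_prod_type]
    refine Finset.sum_le_sum fun x _ => ?_
    rw [Finset.sum_mul]
    refine Finset.sum_le_sum fun x' _ => ?_
    rw [← Finset.mul_sum]
    exact mul_le_mul_of_nonneg_left (hB x x') (mul_nonneg (hb _) (hb' _))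
  refine le_of_mul_le_mul_left ?_ hβ
  linarith

/-- The weight `b w x` stands for the joint mass of message `w` and next input `x`. For each `w`,
the hypothesis `w` and its negation are two input mixtures, to which `sum_mul_log_odds_le` applies.
-/
theorem IsFullChannel.sum_meanLogOdds_le (hV : IsFullChannel V) {B : ℝ}
    (hB : ∀ x x', ∑ y, V x y * Real.log (V x y / V x' y) ≤ B) {b : W → X → ℝ}
    (hb : ∀ w x, 0 ≤ b w x) (hα : ∀ w, 0 < ∑ x, b w x) [Nontrivial W] :
    ∑ y, meanLogOdds (fun w => ∑ x, b w x * V x y) ≤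
      meanLogOdds (fun w => ∑ x, b w x) + (∑ w, ∑ x, b w x) * B := by
  classical
  unfold meanLogOdds
  rw [Finset.sum_comm, Finset.sum_mul, ← Finset.sum_add_distrib]
  refine Finset.sum_le_sum fun w _ => ?_
  have hrest : ∀ f : W → ℝ, ∑ w', f w' - f w = ∑ w' ∈ Finset.univ.erase w, f w' := fun f => by
    rw [← Finset.add_sum_erase _ f (Finset.mem_univ w)]; ring
  have h1 : ∀ f : X → ℝ, ∑ w', ∑ x, b w' x * f x - ∑ x, b w x * f x =
      ∑ x, (∑ w' ∈ Finset.univ.erase w, b w' x) * f x := fun f => by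
    rw [hrest fun w' => ∑ x, b w' x * f x, Finset.sum_comm]
    simp only [Finset.sum_mul]
  have h2 := h1 fun _ => 1
  simp only [mul_one] at h2
  simp only [fun y => h1 fun x => V x y, h2]
  refine hV.sum_mul_log_odds_le hB (hb w) (fun x => Finset.sum_nonneg fun w' _ => hb w' x) (hα w) ?_
  rw [Finset.sum_comm]
  obtain ⟨w', hw'⟩ := exists_ne w
  exact Finset.sum_pos (fun w' _ => hα w') ⟨w', by simp [hw']⟩

/-- Data processing: the message acts on the letter only through the input, so the letter tells no
more about the message than about the input. The log-sum inequality over the inputs, for each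
message and letter, compares the two. -/
theorem IsFullChannel.sum_negEntropy_le (hV : IsFullChannel V) {C : ℝ}
    (hC : ∀ p : X → ℝ, (∀ x, 0 ≤ p x) → ∑ x, p x = 1 →
      ∑ x, ∑ y, p x * (V x y * Real.log (V x y / ∑ x', p x' * V x' y)) ≤ C)
    {b : W → X → ℝ} (hb : ∀ w x, 0 ≤ b w x) (hα : ∀ w, 0 < ∑ x, b w x) [Nonempty W] :
    ∑ y, negEntropy (fun w => ∑ x, b w x * V x y) ≤
      negEntropy (fun w => ∑ x, b w x) + (∑ w, ∑ x, b w x) * C := by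
  set s := ∑ w, ∑ x, b w x with hs
  have hs0 : 0 < s := Finset.sum_pos (fun w _ => hα w) Finset.univ_nonempty
  set p : X → ℝ := fun x => (∑ w, b w x) / s with hp
  have hp0 : ∀ x, 0 ≤ p x := fun x => div_nonneg (Finset.sum_nonneg fun w _ => hb w x) hs0.le
  have hp1 : ∑ x, p x = 1 := by
    rw [hp, ← Finset.sum_div, Finset.sum_comm, ← hs, div_self hs0.ne']
  set o : Y → ℝ := fun y => ∑ x, p x * V x y with ho
  have ho0 : ∀ y, 0 ≤ o y := fun y => Finset.sum_nonneg fun x _ => mul_nonneg (hp0 x) (hV.nonneg x y)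
  have hoV : ∀ y x, o y = 0 → V x y = 0 := by
    intro y x h
    rw [ho, Finset.sum_eq_zero_iff_of_nonneg fun x _ => mul_nonneg (hp0 x) (hV.nonneg x y)] at h
    have : ∃ x', p x' ≠ 0 := by
      by_contra! h0
      simp [h0] at hp1
    obtain ⟨x', hx'⟩ := this
    exact hV.supp _ x' y ((mul_eq_zero.1 (h x' (Finset.mem_univ _))).resolve_left hx')
  have htot : ∀ y, ∑ w, ∑ x, b w x * V x y = s * o y := by
    intro y
    rw [Finset.sum_comm, ho, Finset.mul_sum]
    refine Finset.sum_congr rfl fun x _ => ?_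
    rw [hp, ← Finset.sum_mul, ← mul_assoc, mul_div_cancel₀ _ hs0.ne']
  have key : ∀ w y, (∑ x, b w x * V x y) * Real.log ((∑ x, b w x * V x y) / (s * o y)) -
      (∑ x, b w x * V x y) * Real.log ((∑ x, b w x) / s) ≤
      ∑ x, b w x * (V x y * Real.log (V x y / o y)) := by
    intro w y
    have h := sum_mul_log_sum_div_sum_le (Finset.univ : Finset X)
      (u := fun x => b w x * V x y) (v := fun x => b w x * o y)
      (fun x _ => mul_nonneg (hb _ _) (hV.nonneg _ _))
      (fun x _ => mul_nonneg (hb _ _) (ho0 _))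
      (fun x _ h => by
        rcases mul_eq_zero.1 h with h | h
        · rw [h, zero_mul]
        · rw [hoV y x h, mul_zero])
    rw [← Finset.sum_mul] at h
    have hr : ∀ x, b w x * V x y * Real.log (b w x * V x y / (b w x * o y)) =
        b w x * (V x y * Real.log (V x y / o y)) := by
      intro x
      by_cases h0 : b w x = 0
      · simp [h0]
      · rw [mul_div_mul_left _ _ h0, mul_assoc]
    simp only [hr] at h
    refine le_trans (le_of_eq ?_) h
    rcases (Finset.sum_nonneg fun x (_ : x ∈ Finset.univ) =>
      mul_nonneg (hb w x) (hV.nonneg x y)).eq_or_lt with hn | hn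
    · rw [← hn]; simp
    · have hd : 0 < o y := lt_of_le_of_ne (ho0 y) fun h0 => by
        rw [Finset.sum_eq_zero fun x _ => by rw [hoV y x h0.symm, mul_zero]] at hn
        exact lt_irrefl _ hn
      rw [Real.log_div hn.ne' (by positivity), Real.log_div hn.ne' (mul_pos (hα w) hd).ne',
        Real.log_div (hα w).ne' hs0.ne', Real.log_mul hs0.ne' hd.ne', Real.log_mul (hα w).ne' hd.ne']
      ring
  unfold negEntropy
  simp only [htot, ← hs]
  have h1 := Finset.sum_le_sum fun w (_ : w ∈ Finset.univ) =>
    Finset.sum_le_sum fun y (_ : y ∈ Finset.univ) => key w y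
  simp only [Finset.sum_sub_distrib, ← Finset.sum_mul, hV.sum_sum_mul] at h1
  have h2 : ∑ w, ∑ y, ∑ x, b w x * (V x y * Real.log (V x y / o y)) ≤ s * C := by
    have : ∑ w, ∑ y, ∑ x, b w x * (V x y * Real.log (V x y / o y)) =
        s * ∑ x, ∑ y, p x * (V x y * Real.log (V x y / o y)) := by
      calc _ = ∑ y, ∑ w, ∑ x, b w x * (V x y * Real.log (V x y / o y)) := Finset.sum_comm
        _ = ∑ y, ∑ x, ∑ w, b w x * (V x y * Real.log (V x y / o y)) :=
          Finset.sum_congr rfl fun y _ => Finset.sum_comm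
        _ = ∑ x, ∑ y, ∑ w, b w x * (V x y * Real.log (V x y / o y)) := Finset.sum_comm
        _ = _ := by
          rw [Finset.mul_sum]
          refine Finset.sum_congr rfl fun x _ => ?_
          rw [Finset.mul_sum]
          refine Finset.sum_congr rfl fun y _ => ?_
          have hsp : s * p x = ∑ w, b w x := mul_div_cancel₀ _ hs0.ne'
          rw [← Finset.sum_mul, ← hsp, mul_assoc]
    rw [this]
    exact mul_le_mul_of_nonneg_left (hC p hp0 hp1) hs0.le
  rw [Finset.sum_comm]
  linarith

end Posterior

/-! ### Sequential decisions: mean duration against error probability. -/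

section Posterior

variable {W X Y : Type*} [Fintype W] [Fintype X] [Fintype Y] {V : X → Y → ℝ}

/-- Fano's inequality for an unnormalized distribution. -/
theorem neg_negEntropy_le {a : W → ℝ} (ha : ∀ w, 0 < a w) (w : W) :
    -negEntropy a ≤ (∑ w', a w') * Real.log 2 +
      (∑ w', a w' - a w) * Real.log (Fintype.card W) := by
  classical
  set s := ∑ w', a w' with hs
  have hs0 : 0 < s := Finset.sum_pos (fun w _ => ha w) ⟨w, Finset.mem_univ w⟩
  have hM : 0 < (Fintype.card W : ℝ) := by
    exact_mod_cast Fintype.card_pos_iff.2 ⟨w⟩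
  -- Compared with these weights, `w` costs nothing extra and every other message costs the
  -- logarithm of the number of messages; their total is at most `2 * s`, whence `log 2`.
  set v : W → ℝ := fun w' => if w' = w then s else s / Fintype.card W with hv
  have hv0 : ∀ w', 0 < v w' := by
    intro w'
    simp only [hv]
    split_ifs <;> positivity
  have h := sum_mul_log_sum_div_sum_le (Finset.univ : Finset W) (u := a) (v := v)
    (fun w' _ => (ha w').le) (fun w' _ => (hv0 w').le) (fun w' _ h => absurd h (hv0 w').ne')
  have hvs : ∑ w', v w' ≤ 2 * s := by
    have : ∀ w', v w' ≤ (if w' = w then s else 0) + s / Fintype.card W := by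
      intro w'
      simp only [hv]
      split_ifs
      · have : 0 < s / Fintype.card W := by positivity
        linarith
      · simp
    refine (Finset.sum_le_sum fun w' _ => this w').trans ?_
    rw [Finset.sum_add_distrib, Finset.sum_ite_eq' Finset.univ w]
    simp only [Finset.mem_univ, if_true, Finset.sum_const, Finset.card_univ, nsmul_eq_mul]
    rw [mul_div_cancel₀ _ hM.ne']
    linarith
  have hvp : 0 < ∑ w', v w' := Finset.sum_pos (fun w _ => hv0 w) ⟨w, Finset.mem_univ w⟩
  rw [← hs] at h
  have h1 : -(s * Real.log 2) ≤ s * Real.log (s / ∑ w', v w') := by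
    rw [← mul_neg]
    refine mul_le_mul_of_nonneg_left ?_ hs0.le
    rw [Real.log_div hs0.ne' hvp.ne']
    have := Real.log_le_log hvp hvs
    rw [Real.log_mul two_ne_zero hs0.ne'] at this
    linarith
  have h2 : ∑ w', a w' * Real.log (a w' / v w') =
      negEntropy a + (s - a w) * Real.log (Fintype.card W) := by
    have : ∀ w', a w' * Real.log (a w' / v w') = a w' * Real.log (a w' / s) +
        (a w' - if w' = w then a w' else 0) * Real.log (Fintype.card W) := by
      intro w'
      simp only [hv]
      split_ifs
      · simp
      · rw [Real.log_div (ha w').ne' (by positivity), Real.log_div hs0.ne' hM.ne',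
          Real.log_div (ha w').ne' hs0.ne']
        ring
    rw [Finset.sum_congr rfl fun w' _ => this w', Finset.sum_add_distrib, ← Finset.sum_mul,
      Finset.sum_sub_distrib, Finset.sum_ite_eq' Finset.univ w]
    simp [negEntropy, hs]
  linarith

/-- The guaranteed mean log odds of a decision with (unnormalized) error probability `e` on an event
of probability `s`. -/
noncomputable def decisionBound (M s e : ℝ) : ℝ :=
  s * Real.log (s / e) - s * (1 + Real.log 2) - e * Real.log M

theorem sub_pos_of_pos [Nontrivial W] {a : W → ℝ} (ha : ∀ w, 0 < a w) (w : W) :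
    0 < ∑ w', a w' - a w := by
  classical
  rw [← Finset.add_sum_erase _ a (Finset.mem_univ w), add_sub_cancel_left]
  obtain ⟨w', hw'⟩ := exists_ne w
  exact Finset.sum_pos (fun w' _ => ha w') ⟨w', by simp [hw']⟩

/-- The mean log odds are the negative entropy, bounded by Fano, plus non-negative terms `a w' * log
(s / (s - a w'))`. The decided message alone contributes `s * log (s / e)` up to `e * log (s / e) ≤
s`. -/
theorem decisionBound_le_meanLogOdds [Nontrivial W] {a : W → ℝ} (ha : ∀ w, 0 < a w) (w : W) :
    decisionBound (Fintype.card W) (∑ w', a w') (∑ w', a w' - a w) ≤ meanLogOdds a := by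
  have hF := neg_negEntropy_le ha w
  set s := ∑ w', a w' with hs
  have hs0 : 0 < s := Finset.sum_pos (fun w _ => ha w) ⟨w, Finset.mem_univ w⟩
  have he : ∀ w, 0 < s - a w := sub_pos_of_pos ha
  have h1 : meanLogOdds a = negEntropy a + ∑ w', a w' * Real.log (s / (s - a w')) := by
    rw [meanLogOdds, negEntropy, ← Finset.sum_add_distrib, ← hs]
    refine Finset.sum_congr rfl fun w' _ => ?_
    rw [Real.log_div (ha w').ne' (he w').ne', Real.log_div (ha w').ne' hs0.ne',
      Real.log_div hs0.ne' (he w').ne']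
    ring
  have h2 : a w * Real.log (s / (s - a w)) ≤ ∑ w', a w' * Real.log (s / (s - a w')) := by
    refine Finset.single_le_sum (f := fun w' => a w' * Real.log (s / (s - a w')))
      (fun w' _ => mul_nonneg (ha w').le (Real.log_nonneg ?_)) (Finset.mem_univ w)
    rw [one_le_div (he w')]
    linarith [ha w']
  have h3 : (s - a w) * Real.log (s / (s - a w)) ≤ s := by
    have := Real.log_le_sub_one_of_pos (div_pos hs0 (he w))
    have := mul_le_mul_of_nonneg_left this (he w).le
    rw [mul_sub, mul_div_cancel₀ _ (he w).ne'] at this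
    linarith [he w]
  rw [decisionBound, h1]
  linarith

theorem meanLogOdds_le [Nontrivial W] {a : W → ℝ} (ha : ∀ w, 0 < a w) {κ : ℝ} (hκ : 0 < κ)
    (h : ∀ w, κ * ∑ w', a w' ≤ ∑ w', a w' - a w) :
    meanLogOdds a ≤ (∑ w, a w) * -Real.log κ := by
  rw [meanLogOdds, Finset.sum_mul]
  refine Finset.sum_le_sum fun w _ => mul_le_mul_of_nonneg_left ?_ (ha w).le
  have he := sub_pos_of_pos ha w
  rw [← Real.log_inv]
  refine Real.log_le_log (div_pos (ha w) he) ?_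
  rw [div_le_iff₀ he, ← div_eq_inv_mul, le_div_iff₀ hκ]
  have := h w
  have h1 : a w ≤ ∑ w', a w' := Finset.single_le_sum (fun w _ => (ha w).le) (Finset.mem_univ w)
  nlinarith

/-- Only `s * log (s / e)` is nonlinear, and the log-sum inequality handles it. Thus the guarantees
at the leaves of a tree add up to that at the root. -/
theorem sum_decisionBound_ge {s e : Y → ℝ} {M : ℝ} (hs : ∀ y, 0 ≤ s y) (he : ∀ y, 0 ≤ e y)
    (hse : ∀ y, e y = 0 → s y = 0) :
    decisionBound M (∑ y, s y) (∑ y, e y) ≤ ∑ y, decisionBound M (s y) (e y) := by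
  unfold decisionBound
  rw [Finset.sum_sub_distrib, Finset.sum_sub_distrib, ← Finset.sum_mul, ← Finset.sum_mul]
  have := sum_mul_log_sum_div_sum_le (Finset.univ : Finset Y) (fun y _ => hs y) (fun y _ => he y)
    (fun y _ => hse y)
  linarith

/-- `BoundedTest V a c e`: from the unnormalized posterior distribution `a` of the message, some
bounded sequential decision over the channel `V` has (unnormalized) mean duration `c` and error
probability `e`. -/
inductive BoundedTest (V : X → Y → ℝ) : (W → ℝ) → ℝ → ℝ → Prop
  | halt (a : W → ℝ) (w : W) : BoundedTest V a 0 (∑ w', a w' - a w)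
  | step (b : W → X → ℝ) (hb : ∀ w x, 0 ≤ b w x) (c e : Y → ℝ)
      (h : ∀ y, BoundedTest V (fun w => ∑ x, b w x * V x y) (c y) (e y)) :
      BoundedTest V (fun w => ∑ x, b w x) (∑ w, ∑ x, b w x + ∑ y, c y) (∑ y, e y)

theorem BoundedTest.nonneg (hV : IsFullChannel V) {a : W → ℝ} {c e : ℝ} (h : BoundedTest V a c e)
    (ha : ∀ w, 0 ≤ a w) : 0 ≤ c ∧ 0 ≤ e := by
  induction h with
  | halt a w =>
    exact ⟨le_rfl, sub_nonneg.2 (Finset.single_le_sum (fun w _ => ha w) (Finset.mem_univ w))⟩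
  | step b hb c e h ih =>
    have ih' := fun y => ih y fun w => Finset.sum_nonneg fun x _ => mul_nonneg (hb w x) (hV.nonneg x y)
    exact ⟨add_nonneg (Finset.sum_nonneg fun w _ => ha w) (Finset.sum_nonneg fun y _ => (ih' y).1),
      Finset.sum_nonneg fun y _ => (ih' y).2⟩

/-- Because of the common support, a letter is impossible under all inputs or possible under all. A
branch of the tree is therefore void or keeps all messages alive; the inductions below treat the
void branches separately. -/
theorem IsFullChannel.eq_zero_or_pos (hV : IsFullChannel V) {b : W → X → ℝ}
    (hb : ∀ w x, 0 ≤ b w x) (hα : ∀ w, 0 < ∑ x, b w x) (y : Y) :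
    (∀ x, V x y = 0) ∨ ∀ w, 0 < ∑ x, b w x * V x y := by
  by_cases h : ∃ x, V x y = 0
  · obtain ⟨x, hx⟩ := h
    exact Or.inl fun x' => hV.supp x' x y hx
  · push Not at h
    refine Or.inr fun w => ?_
    obtain ⟨x, _, hx⟩ := Finset.exists_ne_zero_of_sum_ne_zero (hα w).ne'
    exact Finset.sum_pos' (fun x _ => mul_nonneg (hb w x) (hV.nonneg x y)) ⟨x, Finset.mem_univ _,
      mul_pos (lt_of_le_of_ne (hb w x) (Ne.symm hx)) (lt_of_le_of_ne (hV.nonneg _ _) (Ne.symm (h x)))⟩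

theorem BoundedTest.error_pos [Nontrivial W] (hV : IsFullChannel V) {a : W → ℝ} {c e : ℝ}
    (h : BoundedTest V a c e) (ha : ∀ w, 0 < a w) : 0 < e := by
  induction h with
  | halt a w => exact sub_pos_of_pos ha w
  | step b hb c e h ih =>
    have hn := fun y => ((h y).nonneg hV fun w =>
      Finset.sum_nonneg fun x _ => mul_nonneg (hb w x) (hV.nonneg x y)).2
    obtain ⟨w⟩ : Nonempty W := inferInstance
    obtain ⟨x, _, -⟩ := Finset.exists_ne_zero_of_sum_ne_zero (ha w).ne'
    obtain ⟨y, _, hy⟩ := Finset.exists_ne_zero_of_sum_ne_zero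
      (by rw [hV.sum_eq_one x]; exact one_ne_zero : ∑ y, V x y ≠ 0)
    exact Finset.sum_pos' (fun y _ => hn y) ⟨y, Finset.mem_univ _,
      ih y ((hV.eq_zero_or_pos hb ha y).resolve_left fun h => hy (h x))⟩

/-- Optional stopping by induction on the tree: the log odds minus `B` times the elapsed time form a
supermartingale, and at the leaves the log odds are at least `decisionBound`. -/
theorem BoundedTest.duration_ge_of_logOdds [Nontrivial W] (hV : IsFullChannel V) {B : ℝ}
    (hB0 : 0 ≤ B) (hB : ∀ x x', ∑ y, V x y * Real.log (V x y / V x' y) ≤ B) {a : W → ℝ} {c e : ℝ}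
    (h : BoundedTest V a c e) (ha : ∀ w, 0 < a w) :
    decisionBound (Fintype.card W) (∑ w, a w) e - meanLogOdds a ≤ B * c := by
  have hM : 0 ≤ Real.log (Fintype.card W) := Real.log_natCast_nonneg _
  induction h with
  | halt a w =>
    have := decisionBound_le_meanLogOdds ha w
    linarith
  | step b hb c e h ih =>
    have hn := fun y => (h y).nonneg hV fun w =>
      Finset.sum_nonneg fun x _ => mul_nonneg (hb w x) (hV.nonneg x y)
    have hy : ∀ y, decisionBound (Fintype.card W) (∑ w, ∑ x, b w x * V x y) (e y) -
        meanLogOdds (fun w => ∑ x, b w x * V x y) ≤ B * c y := by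
      intro y
      rcases hV.eq_zero_or_pos hb ha y with h0 | h0
      · have h1 := mul_nonneg hB0 (hn y).1
        have h2 := mul_nonneg (hn y).2 hM
        simp only [h0, meanLogOdds, decisionBound, mul_zero, zero_mul, Finset.sum_const_zero]
        linarith
      · exact ih y h0
    have h1 := Finset.sum_le_sum fun y (_ : y ∈ Finset.univ) => hy y
    rw [Finset.sum_sub_distrib, ← Finset.mul_sum] at h1
    have h2 := hV.sum_meanLogOdds_le hB hb ha
    have h3 : decisionBound (Fintype.card W) (∑ w, ∑ x, b w x) (∑ y, e y) ≤
        ∑ y, decisionBound (Fintype.card W) (∑ w, ∑ x, b w x * V x y) (e y) := by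
      have : ∑ y, ∑ w, ∑ x, b w x * V x y = ∑ w, ∑ x, b w x := by
        rw [Finset.sum_comm]
        simp only [hV.sum_sum_mul]
      rw [← this]
      refine sum_decisionBound_ge (fun y => Finset.sum_nonneg fun w _ => Finset.sum_nonneg fun x _ =>
        mul_nonneg (hb w x) (hV.nonneg x y)) (fun y => (hn y).2) fun y he => ?_
      rcases hV.eq_zero_or_pos hb ha y with h0 | h0
      · simp [h0]
      · exact absurd he ((h y).error_pos hV h0).ne'
    rw [mul_add]
    linarith

/-- The two phases. While every message has relative posterior error above `δ`, entropy is spent at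
speed `C`. At the first node where some message reaches error at most `δ`, Fano bounds the remaining
entropy and `duration_ge_of_logOdds` takes over. The invariant `haδ` caps the log odds there by
`-log (l * δ)`, since one letter shrinks a relative error at most by the factor `l`. The entropy is
weighted by `B` and the log odds by `C`, so both phases are charged to `C * B * c`. The term `B * (e
* log M)` pays, through Fano, for leaves reached before the change of phase. -/
theorem BoundedTest.duration_ge [Nontrivial W] (hV : IsFullChannel V) {B C δ l : ℝ}
    (hB0 : 0 ≤ B) (hB : ∀ x x', ∑ y, V x y * Real.log (V x y / V x' y) ≤ B)
    (hC0 : 0 ≤ C) (hC : ∀ p : X → ℝ, (∀ x, 0 ≤ p x) → ∑ x, p x = 1 →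
      ∑ x, ∑ y, p x * (V x y * Real.log (V x y / ∑ x', p x' * V x' y)) ≤ C)
    (hδ : 0 < δ) (hl : 0 < l) (hlV : ∀ x x' y, l * V x y ≤ V x' y)
    {a : W → ℝ} {c e : ℝ} (h : BoundedTest V a c e) (ha : ∀ w, 0 < a w)
    (haδ : ∀ w, l * δ * ∑ w', a w' ≤ ∑ w', a w' - a w) :
    -B * negEntropy a + C * decisionBound (Fintype.card W) (∑ w, a w) e -
      (∑ w, a w) * (C * -Real.log (l * δ) + B * (Real.log 2 + δ * Real.log (Fintype.card W))) -
      B * (e * Real.log (Fintype.card W)) ≤ C * B * c := by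
  have hM : 0 ≤ Real.log (Fintype.card W) := Real.log_natCast_nonneg _
  induction h with
  | halt a w =>
    have h1 := mul_le_mul_of_nonneg_left
      ((decisionBound_le_meanLogOdds ha w).trans (meanLogOdds_le ha (mul_pos hl hδ) haδ)) hC0
    have h2 := mul_le_mul_of_nonneg_left (neg_negEntropy_le ha w) hB0
    have h3 : 0 ≤ B * ((∑ w, a w) * (δ * Real.log (Fintype.card W))) :=
      mul_nonneg hB0 (mul_nonneg (Finset.sum_nonneg fun w _ => (ha w).le) (mul_nonneg hδ.le hM))
    linarith
  | step b hb c e h ih =>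
    have hn := fun y => (h y).nonneg hV fun w =>
      Finset.sum_nonneg fun x _ => mul_nonneg (hb w x) (hV.nonneg x y)
    by_cases hconf : ∃ w, ∑ w', ∑ x, b w' x - ∑ x, b w x ≤ δ * ∑ w', ∑ x, b w' x
    · obtain ⟨w, hw⟩ := hconf
      have hrun := BoundedTest.step b hb c e h
      have h1 := mul_le_mul_of_nonneg_left (hrun.duration_ge_of_logOdds hV hB0 hB ha) hC0
      have h2 := mul_le_mul_of_nonneg_left (meanLogOdds_le ha (mul_pos hl hδ) haδ) hC0
      have h3 := mul_le_mul_of_nonneg_left (neg_negEntropy_le ha w) hB0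
      have h4 := mul_le_mul_of_nonneg_left (mul_le_mul_of_nonneg_right hw hM) hB0
      have h5 := mul_nonneg hB0 (mul_nonneg (hrun.error_pos hV ha).le hM)
      linarith
    · push Not at hconf
      have hy : ∀ y, -B * negEntropy (fun w => ∑ x, b w x * V x y) +
          C * decisionBound (Fintype.card W) (∑ w, ∑ x, b w x * V x y) (e y) -
          (∑ w, ∑ x, b w x * V x y) * (C * -Real.log (l * δ) +
            B * (Real.log 2 + δ * Real.log (Fintype.card W))) -
          B * (e y * Real.log (Fintype.card W)) ≤ C * B * c y := by
        intro y
        rcases hV.eq_zero_or_pos hb ha y with h0 | h0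
        · have h1 := mul_nonneg (mul_nonneg hC0 hB0) (hn y).1
          have h2 := mul_nonneg hB0 (mul_nonneg (hn y).2 hM)
          have h3 := mul_nonneg hC0 (mul_nonneg (hn y).2 hM)
          simp only [h0, negEntropy, decisionBound, mul_zero, zero_mul, Finset.sum_const_zero]
          linarith
        · refine ih y h0 fun w => ?_
          obtain ⟨x₁, _, -⟩ := Finset.exists_ne_zero_of_sum_ne_zero (ha w).ne'
          have : Nonempty X := ⟨x₁⟩
          -- The invariant at the child: with `x₀` the likeliest input for `y`, the total mass is
          -- multiplied by at most `V x₀ y` and each error mass by at least `l * V x₀ y`; before the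
          -- letter the error exceeded the fraction `δ`.
          obtain ⟨x₀, hx₀⟩ := Finite.exists_max fun x => V x y
          have h1 : ∑ w', ∑ x, b w' x * V x y ≤ (∑ w', ∑ x, b w' x) * V x₀ y := by
            simp only [Finset.sum_mul]
            exact Finset.sum_le_sum fun w' _ => Finset.sum_le_sum fun x _ =>
              mul_le_mul_of_nonneg_left (hx₀ x) (hb w' x)
          have h2 : (∑ w', ∑ x, b w' x - ∑ x, b w x) * (l * V x₀ y) ≤
              ∑ w', ∑ x, b w' x * V x y - ∑ x, b w x * V x y := by
            classical
            rw [← Finset.add_sum_erase _ (fun w' => ∑ x, b w' x) (Finset.mem_univ w),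
              ← Finset.add_sum_erase _ (fun w' => ∑ x, b w' x * V x y) (Finset.mem_univ w),
              add_sub_cancel_left, add_sub_cancel_left]
            simp only [Finset.sum_mul]
            exact Finset.sum_le_sum fun w' _ => Finset.sum_le_sum fun x _ =>
              mul_le_mul_of_nonneg_left (hlV x₀ x y) (hb w' x)
          have h3 := mul_le_mul_of_nonneg_right (hconf w).le
            (mul_nonneg hl.le (hV.nonneg x₀ y))
          have h4 := mul_le_mul_of_nonneg_left h1 (mul_pos hl hδ).le
          calc l * δ * ∑ w', ∑ x, b w' x * V x y ≤ l * δ * ((∑ w', ∑ x, b w' x) * V x₀ y) := h4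
            _ = δ * (∑ w', ∑ x, b w' x) * (l * V x₀ y) := by ring
            _ ≤ _ := h3.trans h2
      have hs : ∑ y, ∑ w, ∑ x, b w x * V x y = ∑ w, ∑ x, b w x := by
        rw [Finset.sum_comm]
        simp only [hV.sum_sum_mul]
      have h1 := Finset.sum_le_sum fun y (_ : y ∈ Finset.univ) => hy y
      rw [Finset.sum_sub_distrib, Finset.sum_sub_distrib, Finset.sum_add_distrib, ← Finset.mul_sum,
        ← Finset.mul_sum, ← Finset.sum_mul, ← Finset.mul_sum, ← Finset.mul_sum, ← Finset.sum_mul,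
        hs] at h1
      have h2 := mul_le_mul_of_nonneg_left (hV.sum_negEntropy_le hC hb ha) hB0
      have h3 : decisionBound (Fintype.card W) (∑ w, ∑ x, b w x) (∑ y, e y) ≤
          ∑ y, decisionBound (Fintype.card W) (∑ w, ∑ x, b w x * V x y) (e y) := by
        rw [← hs]
        refine sum_decisionBound_ge (fun y => Finset.sum_nonneg fun w _ => Finset.sum_nonneg fun x _ =>
          mul_nonneg (hb w x) (hV.nonneg x y)) (fun y => (hn y).2) fun y he => ?_
        rcases hV.eq_zero_or_pos hb ha y with h0 | h0
        · simp [h0]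
        · exact absurd he ((h y).error_pos hV h0).ne'
      have h4 := mul_le_mul_of_nonneg_left h3 hC0
      rw [mul_add (C * B)]
      linarith

/-- The trade-off between mean duration and error probability of a bounded sequential decision
among at least two equiprobable messages. -/
theorem BoundedTest.tradeoff {M : ℕ} (hM : 2 ≤ M) (hV : IsFullChannel V) {B C δ l : ℝ}
    (hB0 : 0 ≤ B) (hB : ∀ x x', ∑ y, V x y * Real.log (V x y / V x' y) ≤ B)
    (hC0 : 0 ≤ C) (hC : ∀ p : X → ℝ, (∀ x, 0 ≤ p x) → ∑ x, p x = 1 →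
      ∑ x, ∑ y, p x * (V x y * Real.log (V x y / ∑ x', p x' * V x' y)) ≤ C)
    (hδ : 0 < δ) (hl : 0 < l) (hlδ : l * δ ≤ 1 / 2) (hlV : ∀ x x' y, l * V x y ≤ V x' y)
    {c e : ℝ} (h : BoundedTest V (fun _ : Fin M => (M : ℝ)⁻¹) c e) :
    0 < e ∧ B * (Real.log M * (1 - δ - e) - Real.log 2) +
      C * (-Real.log e - 1 - Real.log 2 - e * Real.log M + Real.log (l * δ)) ≤ C * B * c := by
  have : Nontrivial (Fin M) := Fin.nontrivial_iff_two_le.2 hM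
  have hM0 : (0 : ℝ) < M := by positivity
  have ha : ∀ w : Fin M, 0 < (M : ℝ)⁻¹ := fun _ => inv_pos.2 hM0
  have hs : ∑ _w : Fin M, (M : ℝ)⁻¹ = 1 := by
    simp [mul_inv_cancel₀ hM0.ne']
  have he := h.error_pos hV ha
  refine ⟨he, ?_⟩
  -- The uniform prior has relative error `1 - 1 / M ≥ 1 / 2 ≥ l * δ`, which starts the invariant.
  have key := h.duration_ge hV hB0 hB hC0 hC hδ hl hlV ha (fun w => by
    rw [hs]
    have : (M : ℝ)⁻¹ ≤ 2⁻¹ := inv_anti₀ two_pos (by exact_mod_cast hM)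
    linarith)
  rw [negEntropy, hs, decisionBound, Fintype.card_fin, ← Finset.sum_mul, hs, div_one, Real.log_inv,
    one_div, Real.log_inv] at key
  linarith

end Posterior

/-! ### A receiver of a feedback code as a bounded sequential decision. -/

namespace VLFTCode

open Outcome

variable {K : ℕ} {𝒳 : Type u} {𝒴 : Fin K → Type v} [∀ j, MeasurableSpace (𝒴 j)] {M : ℕ}
  [∀ j, Fintype (𝒴 j)] [∀ j, DiscreteMeasurableSpace (𝒴 j)]

theorem law_apply (c : VLFTCode 𝒳 𝒴 M) (ch : BroadcastChannel 𝒳 𝒴) {S : Set (Outcome 𝒴 M)}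
    (hS : MeasurableSet S) :
    c.law ch S = ∑ w, (M : ℝ≥0∞)⁻¹ * c.outputLaw ch w {ω | (w, ω) ∈ S} := by
  simp only [law, Measure.coe_finsetSum, Finset.sum_apply, Measure.smul_apply, smul_eq_mul]
  refine Finset.sum_congr rfl fun w _ => ?_
  rw [Measure.dirac_prod, Measure.map_apply (by fun_prop) hS]
  rfl

theorem isProbabilityMeasure_law (c : VLFTCode 𝒳 𝒴 M) (ch : BroadcastChannel 𝒳 𝒴) (hM : M ≠ 0) :
    IsProbabilityMeasure (c.law ch) := by
  refine ⟨?_⟩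
  rw [law_apply c ch MeasurableSet.univ]
  simp [ENNReal.mul_inv_cancel (Nat.cast_ne_zero.2 hM) (ENNReal.natCast_ne_top M)]

theorem law_real_message (c : VLFTCode 𝒳 𝒴 M) (ch : BroadcastChannel 𝒳 𝒴) (w : Fin M)
    {T : Set (ℕ → ∀ j, 𝒴 j)} (hT : MeasurableSet T) :
    (c.law ch).real {ω | ω.1 = w ∧ ω.2 ∈ T} = (M : ℝ)⁻¹ * (c.outputLaw ch w).real T := by
  have hS : MeasurableSet {ω : Outcome 𝒴 M | ω.1 = w ∧ ω.2 ∈ T} :=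
    (measurable_fst (measurableSet_singleton w)).inter (measurable_snd hT)
  rw [measureReal_def, law_apply c ch hS, Finset.sum_eq_single w]
  · simp [measureReal_def]
  · intro w' _ hw'
    simp [hw']
  · simp

theorem outputLaw_next (c : VLFTCode 𝒳 𝒴 M) (ch : BroadcastChannel 𝒳 𝒴) (w : Fin M) (j : Fin K)
    {n : ℕ} (A : Set (Fin n → ∀ j, 𝒴 j)) (x : 𝒳) (hA : ∀ z ∈ A, c.encoder n w z = x) (y : 𝒴 j) :
    (c.outputLaw ch w).real {ω | prefixAt n ω ∈ A ∧ ω n j = y} =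
      (c.outputLaw ch w).real {ω | prefixAt n ω ∈ A} * (ch.marginal j x y).toReal := by
  have hmarg : (ch x).toMeasure {t | t j = y} = ch.marginal j x y := by
    rw [← PMF.toMeasure_apply_singleton (ch.marginal j x) y (measurableSet_singleton y),
      BroadcastChannel.marginal, PMF.toMeasure_map_apply _ _ _ (measurable_pi_apply j)
        (measurableSet_singleton y)]
    rfl
  rw [measureReal_def, measureReal_def, ← ENNReal.toReal_mul,
    measure_eq_sum_fiber (c.outputLaw ch w) (measurable_prefixAt n),
    measure_eq_sum_fiber (c.outputLaw ch w) (measurable_prefixAt n) {ω | prefixAt n ω ∈ A},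
    Finset.sum_mul]
  congr 1
  refine Finset.sum_congr rfl fun z _ => ?_
  by_cases hz : z ∈ A
  · have h1 : {ω : ℕ → ∀ j, 𝒴 j | prefixAt n ω ∈ A ∧ ω n j = y} ∩ prefixAt n ⁻¹' {z} =
        {ω | prefixAt n ω = z ∧ ω n ∈ {t : ∀ j, 𝒴 j | t j = y}} := by
      ext ω
      constructor
      · rintro ⟨⟨_, h⟩, h'⟩; exact ⟨h', h⟩
      · rintro ⟨rfl, h⟩; exact ⟨⟨hz, h⟩, rfl⟩
    have h2 : {ω : ℕ → ∀ j, 𝒴 j | prefixAt n ω ∈ A} ∩ prefixAt n ⁻¹' {z} =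
        {ω | prefixAt n ω = z} := by
      ext ω
      constructor
      · rintro ⟨_, h'⟩; exact h'
      · rintro rfl; exact ⟨hz, rfl⟩
    rw [h1, h2, outputLaw_prefixAt_singleton, hA z hz, hmarg]
  · have h1 : {ω : ℕ → ∀ j, 𝒴 j | prefixAt n ω ∈ A ∧ ω n j = y} ∩ prefixAt n ⁻¹' {z} = ∅ := by
      refine Set.eq_empty_of_forall_notMem ?_
      rintro ω ⟨⟨h, _⟩, rfl⟩; exact hz h
    have h2 : {ω : ℕ → ∀ j, 𝒴 j | prefixAt n ω ∈ A} ∩ prefixAt n ⁻¹' {z} = ∅ := by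
      refine Set.eq_empty_of_forall_notMem ?_
      rintro ω ⟨h, rfl⟩; exact hz h
    rw [h1, h2]; simp

/-- The joint probability of the message and the first outputs at receiver `j`. -/
noncomputable def jointMass (c : VLFTCode 𝒳 𝒴 M) (ch : BroadcastChannel 𝒳 𝒴) (j : Fin K) {n : ℕ}
    (y : Fin n → 𝒴 j) (w : Fin M) : ℝ :=
  (c.law ch).real {ω | ω.1 = w ∧ pastAt j n ω = y}

theorem jointMass_eq (c : VLFTCode 𝒳 𝒴 M) (ch : BroadcastChannel 𝒳 𝒴) (j : Fin K) {n : ℕ}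
    (y : Fin n → 𝒴 j) (w : Fin M) :
    c.jointMass ch j y w =
      (M : ℝ)⁻¹ * (c.outputLaw ch w).real {ω | (fun i => prefixAt n ω i j) = y} :=
  law_real_message c ch w (T := {ω | (fun i => prefixAt n ω i j) = y})
    (measurableSet_eq_fun (by unfold prefixAt; fun_prop) measurable_const)

theorem measureReal_eq_sum_fiber {Ω β : Type*} [MeasurableSpace Ω] [MeasurableSpace β] [Fintype β]
    [MeasurableSingletonClass β] (μ : Measure Ω) [IsFiniteMeasure μ] {f : Ω → β} (hf : Measurable f)
    (s : Set Ω) : μ.real s = ∑ b, μ.real (s ∩ f ⁻¹' {b}) := by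
  simp only [measureReal_def]
  rw [← ENNReal.toReal_sum fun _ _ => measure_ne_top _ _, ← measure_eq_sum_fiber μ hf]

theorem pastAt_succ_eq_snoc {j : Fin K} {n : ℕ} {y : Fin n → 𝒴 j} {t : 𝒴 j} {ω : Outcome 𝒴 M} :
    pastAt j (n + 1) ω = Fin.snoc y t ↔ pastAt j n ω = y ∧ ω.2 n j = t := by
  constructor
  · intro h
    refine ⟨funext fun i => ?_, ?_⟩
    · have h1 := congrFun h i.castSucc
      rw [Fin.snoc_castSucc] at h1
      exact h1
    · have h1 := congrFun h (Fin.last n)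
      rw [Fin.snoc_last] at h1
      exact h1
  · rintro ⟨h1, h2⟩
    funext i
    refine Fin.lastCases ?_ (fun i => ?_) i
    · rw [Fin.snoc_last]; exact h2
    · rw [Fin.snoc_castSucc]; exact congrFun h1 i

/-- Take for `b w x` the joint mass of the message, the past of receiver `j` and the next input. The
input may depend on the outputs of all receivers, but given it the next letter at `j` follows the
marginal channel. This is the branching of `BoundedTest.step`. -/
theorem exists_jointMass_step [Fintype 𝒳] (c : VLFTCode 𝒳 𝒴 M) (ch : BroadcastChannel 𝒳 𝒴)
    (j : Fin K) {n : ℕ} (y : Fin n → 𝒴 j) :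
    ∃ b : Fin M → 𝒳 → ℝ, (∀ w x, 0 ≤ b w x) ∧ (c.jointMass ch j y = fun w => ∑ x, b w x) ∧
      ∀ t : 𝒴 j, c.jointMass ch j (Fin.snoc y t : Fin (n + 1) → 𝒴 j) =
        fun w => ∑ x, b w x * (ch.marginal j x t).toReal := by
  let _ : MeasurableSpace 𝒳 := ⊤
  let A : Fin M → 𝒳 → Set (Fin n → ∀ j, 𝒴 j) :=
    fun w x => {z | (fun i => z i j) = y ∧ c.encoder n w z = x}
  have hmeas : ∀ w, Measurable fun ω : ℕ → ∀ j, 𝒴 j => c.encoder n w (prefixAt n ω) := fun w =>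
    (measurable_of_countable (c.encoder n w)).comp (measurable_prefixAt n)
  refine ⟨fun w x => (M : ℝ)⁻¹ * (c.outputLaw ch w).real {ω | prefixAt n ω ∈ A w x},
    fun w x => by positivity, ?_, fun t => ?_⟩
  · funext w
    rw [jointMass_eq, ← Finset.mul_sum, measureReal_eq_sum_fiber (c.outputLaw ch w) (hmeas w)]
    rfl
  · funext w
    rw [jointMass_eq]
    simp only [mul_assoc]
    rw [← Finset.mul_sum, measureReal_eq_sum_fiber (c.outputLaw ch w) (hmeas w)]
    congr 1
    refine Finset.sum_congr rfl fun x _ => ?_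
    rw [← outputLaw_next c ch w j (A w x) x (fun z hz => hz.2) t]
    congr 1
    ext ω
    have h := pastAt_succ_eq_snoc (j := j) (y := y) (t := t) (ω := (w, ω))
    constructor
    · rintro ⟨h1, h2⟩
      exact ⟨⟨(h.1 h1).1, h2⟩, (h.1 h1).2⟩
    · rintro ⟨⟨h1, h2⟩, h3⟩
      exact ⟨h.2 ⟨h1, h3⟩, h2⟩

theorem measurableSet_lt_stopTime (c : VLFTCode 𝒳 𝒴 M) (j : Fin K) (n : ℕ) :
    MeasurableSet {ω | (n : ℕ∞) < c.stopTime j ω} := by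
  have h := (Outcome.filtrationAt 𝒴 M j).le n _ (c.isStoppingTime j n)
  convert h.compl using 1
  ext ω
  exact (not_le (a := c.stopTime j ω) (b := (n : ℕ∞))).symm

/-- Stopping by time `n` is measurable with respect to `Y_j^n`, hence the preimage of a set of
words. -/
theorem stopTime_le_congr (c : VLFTCode 𝒳 𝒴 M) (j : Fin K) {n : ℕ} {ω ω' : Outcome 𝒴 M}
    (h : pastAt j n ω = pastAt j n ω') (hω : c.stopTime j ω ≤ n) : c.stopTime j ω' ≤ n := by
  obtain ⟨S, -, hS⟩ := c.isStoppingTime j n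
  have h1 : ω ∈ pastAt j n ⁻¹' S := by rw [hS]; exact hω
  have h2 : ω' ∈ pastAt j n ⁻¹' S := by
    rw [Set.mem_preimage, ← h]; exact h1
  rw [hS] at h2
  exact h2

theorem sum_jointMass (c : VLFTCode 𝒳 𝒴 M) (ch : BroadcastChannel 𝒳 𝒴) (hM : M ≠ 0) (j : Fin K)
    {n : ℕ} (y : Fin n → 𝒴 j) :
    ∑ w, c.jointMass ch j y w = (c.law ch).real {ω | pastAt j n ω = y} := by
  have := isProbabilityMeasure_law c ch hM
  rw [measureReal_eq_sum_fiber (c.law ch) (f := fun ω => ω.1) (by fun_prop)]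
  refine Finset.sum_congr rfl fun w _ => ?_
  rw [jointMass]
  congr 1
  ext ω
  exact and_comm

/-- The error mass of a leaf lies in the error event of the truncated receiver. The alternative `T <
τ_j` covers leaves at the horizon, where a receiver forced to decide is charged with an error in any
case. -/
theorem sum_jointMass_sub_le (c : VLFTCode 𝒳 𝒴 M) (ch : BroadcastChannel 𝒳 𝒴) (hM : M ≠ 0)
    (j : Fin K) (T : ℕ) {n : ℕ} (y : Fin n → 𝒴 j)
    (hhalt : ∀ ω, pastAt j n ω = y → c.stopTime j ω = n ∨ T < c.stopTime j ω) :
    ∑ w, c.jointMass ch j y w - c.jointMass ch j y (c.decoder j n y) ≤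
      (c.law ch).real {ω | pastAt j n ω = y ∧
        ¬ ∃ m ≤ T, c.stopTime j ω = m ∧ c.decoder j m (ω.pastAt j m) = ω.1} := by
  have := isProbabilityMeasure_law c ch hM
  have hpm : Measurable fun ω : Outcome 𝒴 M => pastAt j n ω := by unfold pastAt; fun_prop
  rw [c.sum_jointMass ch hM, jointMass, ← measureReal_sdiff]
  · refine measureReal_mono ?_
    rintro ω ⟨h1, h2⟩
    refine ⟨h1, ?_⟩
    rintro ⟨m, hmT, hm, hd⟩
    have hmn : m = n := by
      rcases hhalt ω h1 with h | h
      · rw [h] at hm; exact_mod_cast hm.symm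
      · rw [hm] at h
        have : T < m := by exact_mod_cast h
        omega
    subst hmn
    rw [show pastAt j m ω = y from h1] at hd
    exact h2 ⟨hd.symm, h1⟩
  · exact fun ω h => h.2
  · exact (measurable_fst (measurableSet_singleton _)).inter (hpm (measurableSet_singleton y))

/-- A receiver that is stopped at a fixed horizon performs a bounded sequential decision. -/
theorem exists_boundedTest_of_past [Fintype 𝒳] (c : VLFTCode 𝒳 𝒴 M) (ch : BroadcastChannel 𝒳 𝒴)
    (hM : M ≠ 0) (j : Fin K) (T : ℕ) {n k : ℕ} (hn : n + k = T) (y : Fin n → 𝒴 j)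
    (hy : ∀ ω, pastAt j n ω = y → n ≤ c.stopTime j ω) :
    ∃ d e, BoundedTest (fun x t => (ch.marginal j x t).toReal) (c.jointMass ch j y) d e ∧
      d ≤ ∑ m ∈ Finset.Ico n T, (c.law ch).real {ω | pastAt j n ω = y ∧ m < c.stopTime j ω} ∧
      e ≤ (c.law ch).real {ω | pastAt j n ω = y ∧
        ¬ ∃ m ≤ T, c.stopTime j ω = m ∧ c.decoder j m (ω.pastAt j m) = ω.1} := by
  have := isProbabilityMeasure_law c ch hM
  induction k generalizing n with
  | zero =>
    refine ⟨0, _, BoundedTest.halt _ (c.decoder j n y),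
      Finset.sum_nonneg fun _ _ => measureReal_nonneg,
      c.sum_jointMass_sub_le ch hM j T y fun ω h => ?_⟩
    rcases (hy ω h).eq_or_lt with h | h
    · exact Or.inl h.symm
    · refine Or.inr ?_
      rwa [← hn]
  | succ k ih =>
    -- The outcomes with past `y` have either all stopped by time `n`, which gives a leaf, or none
    -- has.
    by_cases hs : ∃ ω, pastAt j n ω = y ∧ c.stopTime j ω ≤ n
    · obtain ⟨ω₀, h₀, hs₀⟩ := hs
      refine ⟨0, _, BoundedTest.halt _ (c.decoder j n y),
        Finset.sum_nonneg fun _ _ => measureReal_nonneg,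
        c.sum_jointMass_sub_le ch hM j T y fun ω h => Or.inl (le_antisymm ?_ (hy ω h))⟩
      exact c.stopTime_le_congr j (h₀.trans h.symm) hs₀
    · push Not at hs
      obtain ⟨b, hb, hb1, hb2⟩ := c.exists_jointMass_step ch j y
      have hpart : ∀ D : Set (Outcome 𝒴 M), ∑ t, (c.law ch).real
          {ω | pastAt j (n + 1) ω = Fin.snoc y t ∧ ω ∈ D} =
          (c.law ch).real {ω | pastAt j n ω = y ∧ ω ∈ D} := by
        intro D
        rw [measureReal_eq_sum_fiber (c.law ch) (f := fun ω => ω.2 n j) (by fun_prop)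
          {ω | pastAt j n ω = y ∧ ω ∈ D}]
        refine Finset.sum_congr rfl fun t _ => ?_
        congr 1
        ext ω
        simp only [pastAt_succ_eq_snoc, Set.mem_ofPred_eq, Set.mem_inter_iff, Set.mem_preimage,
          Set.mem_singleton_iff]
        tauto
      have hsub := fun t => ih (n := n + 1) (by omega) (Fin.snoc y t) (fun ω h => by
        have := hs ω (pastAt_succ_eq_snoc.1 h).1
        rw [Nat.cast_add, Nat.cast_one]
        exact Order.add_one_le_of_lt this)
      choose d e hde hd he using hsub
      have h1 : ∑ w, ∑ x, b w x = (c.law ch).real {ω | pastAt j n ω = y ∧ n < c.stopTime j ω} := by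
        have h2 := c.sum_jointMass ch hM j y
        rw [hb1] at h2
        rw [h2]
        congr 1
        ext ω
        exact ⟨fun h => ⟨h, hs ω h⟩, fun h => h.1⟩
      rw [hb1]
      refine ⟨_, _, BoundedTest.step b hb d e fun t => ?_, ?_, ?_⟩
      · rw [← hb2 t]; exact hde t
      -- The summand `m = n` is the mass of this node, the cost of one letter; the later ones are
      -- distributed over the subtrees.
      · rw [h1, Finset.sum_eq_sum_Ico_succ_bot (by omega)]
        gcongr
        refine (Finset.sum_le_sum fun t _ => hd t).trans (le_of_eq ?_)
        rw [Finset.sum_comm]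
        exact Finset.sum_congr rfl fun m _ => hpart {ω | m < c.stopTime j ω}
      · exact (Finset.sum_le_sum fun t _ => he t).trans (le_of_eq (hpart _))

/-- The tail formula for the expectation, truncated at `T`, together with `τ_j ≤ τ`. -/
theorem sum_measure_lt_stopTime_le (c : VLFTCode 𝒳 𝒴 M) (ch : BroadcastChannel 𝒳 𝒴) (j : Fin K)
    (T : ℕ) :
    ∑ m ∈ Finset.range T, c.law ch {ω | (m : ℕ∞) < c.stopTime j ω} ≤ c.expectedStop ch := by
  have h1 : ∀ m : ℕ, c.law ch {ω | (m : ℕ∞) < c.stopTime j ω} =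
      ∫⁻ ω, {ω | (m : ℕ∞) < c.stopTime j ω}.indicator 1 ω ∂(c.law ch) := fun m =>
    (lintegral_indicator_one (c.measurableSet_lt_stopTime j m)).symm
  simp only [h1]
  rw [← lintegral_finsetSum _ fun m _ =>
    measurable_one.indicator (c.measurableSet_lt_stopTime j m)]
  refine lintegral_mono fun ω => ?_
  have h2 : (c.stopTime j ω : ℝ≥0∞) ≤ c.stopMax ω := by
    exact_mod_cast le_iSup (fun j => c.stopTime j ω) j
  refine le_trans ?_ h2
  have h3 : ∀ m : ℕ, {ω | (m : ℕ∞) < c.stopTime j ω}.indicator (1 : Outcome 𝒴 M → ℝ≥0∞) ω =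
      if (m : ℕ∞) < c.stopTime j ω then 1 else 0 := fun m => by
    simp [Set.indicator_apply]
  simp only [h3]
  rw [Finset.sum_ite, Finset.sum_const_zero, add_zero, Finset.sum_const, nsmul_one]
  cases hτ : c.stopTime j ω with
  | top => simp
  | coe k =>
    have : (Finset.range T).filter (fun m : ℕ => (m : ℕ∞) < (k : ℕ∞)) ⊆ Finset.range k := by
      intro m hm
      have := (Finset.mem_filter.1 hm).2
      exact Finset.mem_range.2 (by exact_mod_cast this)
    have := Finset.card_le_card this
    rw [Finset.card_range] at this
    exact_mod_cast this

/-- Every receiver of a code yields bounded sequential decisions of at most the same mean duration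
and an arbitrarily little larger error probability. -/
theorem exists_boundedTest [Fintype 𝒳] (c : VLFTCode 𝒳 𝒴 M) (ch : BroadcastChannel 𝒳 𝒴)
    (hM : M ≠ 0) (j : Fin K) {N : ℝ} (hN0 : 0 ≤ N) (hN : c.expectedStop ch ≤ ENNReal.ofReal N)
    {ε : ℝ} (hε : 0 < ε) :
    ∃ d e, BoundedTest (fun x t => (ch.marginal j x t).toReal) (fun _ : Fin M => (M : ℝ)⁻¹) d e ∧
      d ≤ N ∧ e ≤ (c.errorProb ch).toReal + ε := by
  have := isProbabilityMeasure_law c ch hM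
  have hsumN : ∀ T, ∑ m ∈ Finset.range T, (c.law ch).real {ω | (m : ℕ∞) < c.stopTime j ω} ≤ N := by
    intro T
    have h := (c.sum_measure_lt_stopTime_le ch j T).trans hN
    have h2 := ENNReal.toReal_mono ENNReal.ofReal_ne_top h
    rwa [ENNReal.toReal_sum (fun _ _ => measure_ne_top _ _), ENNReal.toReal_ofReal hN0] at h2
  -- By Markov's inequality, `τ_j > T` has probability at most `N / T < ε`; this is the price of
  -- truncation.
  obtain ⟨T, hT⟩ := exists_nat_gt (N / ε)
  have hT0 : (0 : ℝ) < T := lt_of_le_of_lt (by positivity) hT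
  have htail : (c.law ch).real {ω | (T : ℕ∞) < c.stopTime j ω} ≤ ε := by
    have h1 : ∑ m ∈ Finset.range T, (c.law ch).real {ω | (T : ℕ∞) < c.stopTime j ω} ≤ N := by
      refine le_trans (Finset.sum_le_sum fun m hm => measureReal_mono fun ω hω => ?_) (hsumN T)
      have : (m : ℕ∞) < T := by exact_mod_cast Finset.mem_range.1 hm
      exact this.trans hω
    rw [Finset.sum_const, Finset.card_range, nsmul_eq_mul] at h1
    rw [div_lt_iff₀ hε] at hT
    nlinarith
  obtain ⟨d, e, h, hd, he⟩ := c.exists_boundedTest_of_past ch hM j T (zero_add T) Fin.elim0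
    (fun ω _ => by simp)
  have hall : ∀ ω : Outcome 𝒴 M, pastAt j 0 ω = Fin.elim0 := fun ω => Subsingleton.elim _ _
  have hroot : c.jointMass ch j (Fin.elim0 : Fin 0 → 𝒴 j) = fun _ => (M : ℝ)⁻¹ := by
    funext w
    rw [jointMass_eq]
    have : {ω : ℕ → ∀ j, 𝒴 j | (fun i : Fin 0 => prefixAt 0 ω i j) = Fin.elim0} = Set.univ :=
      Set.eq_univ_of_forall fun ω => Subsingleton.elim _ _
    rw [this]
    simp
  rw [hroot] at h
  simp only [hall, true_and] at hd he
  refine ⟨d, e, h, ?_, ?_⟩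
  · rw [← Finset.range_eq_Ico] at hd
    exact hd.trans (hsumN T)
  · refine he.trans ?_
    refine le_trans (measureReal_mono (s₂ := c.errorEvent ∪ {ω | (T : ℕ∞) < c.stopTime j ω}) ?_)
      ((measureReal_union_le _ _).trans (add_le_add le_rfl htail))
    intro ω hω
    by_cases hτ : (T : ℕ∞) < c.stopTime j ω
    · exact Or.inr hτ
    · refine Or.inl ⟨j, ?_⟩
      rintro ⟨m, hm, hd⟩
      refine hω ⟨m, ?_, hm, hd⟩
      rw [hm, not_lt] at hτ
      exact_mod_cast hτ

end VLFTCode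

/-! ### Divergences, mutual information and capacities as finite sums. -/

theorem klDiv_toMeasure_ne_top {α : Type*} [Fintype α] [MeasurableSpace α]
    [MeasurableSingletonClass α] {p q : PMF α}
    (h : InformationTheory.klDiv p.toMeasure q.toMeasure ≠ ∞) :
    (∀ a, (q a).toReal = 0 → (p a).toReal = 0) ∧
      (InformationTheory.klDiv p.toMeasure q.toMeasure).toReal =
        ∑ a, (p a).toReal * Real.log ((p a).toReal / (q a).toReal) := by
  have : IsProbabilityMeasure p.toMeasure := PMF.toMeasure.isProbabilityMeasure _
  have : IsProbabilityMeasure q.toMeasure := PMF.toMeasure.isProbabilityMeasure _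
  have hac := (InformationTheory.klDiv_ne_top_iff.1 h).1
  have hq : ∀ a, (q a).toReal = 0 → (p a).toReal = 0 := by
    intro a ha
    have h0 : q a = 0 := by
      rcases (ENNReal.toReal_eq_zero_iff _).1 ha with h0 | h0
      · exact h0
      · exact absurd h0 (q.apply_ne_top a)
    have h1 := @hac {a} (by rw [PMF.toMeasure_apply_singleton _ _ (measurableSet_singleton a), h0])
    rw [PMF.toMeasure_apply_singleton _ _ (measurableSet_singleton a)] at h1
    rw [h1]; rfl
  refine ⟨hq, ?_⟩
  rw [InformationTheory.toReal_klDiv_of_measure_eq hac (by rw [measure_univ, measure_univ]),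
    PMF.integral_eq_sum]
  refine Finset.sum_congr rfl fun a _ => ?_
  rw [smul_eq_mul]
  by_cases ha : (q a).toReal = 0
  · rw [hq a ha]; simp
  · congr 2
    have h1 := congrArg (fun μ => μ {a}) (Measure.withDensity_rnDeriv_eq _ _ hac)
    beta_reduce at h1
    rw [withDensity_apply _ (measurableSet_singleton a), lintegral_singleton,
      PMF.toMeasure_apply_singleton _ _ (measurableSet_singleton a),
      PMF.toMeasure_apply_singleton _ _ (measurableSet_singleton a)] at h1
    rw [llr, ← h1, ENNReal.toReal_mul, mul_div_cancel_right₀ _ ha]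

theorem PMF.sum_toReal {α : Type*} [Fintype α] (p : PMF α) : ∑ a, (p a).toReal = 1 := by
  rw [← ENNReal.toReal_sum fun a _ => p.apply_ne_top a, ← tsum_fintype (L := .unconditional _), p.tsum_coe]
  rfl

namespace BroadcastChannel

variable {K : ℕ} {𝒳 : Type u} {𝒴 : Fin K → Type v} [Fintype 𝒳] [∀ j, Fintype (𝒴 j)]

theorem outputPMF_toReal (ch : BroadcastChannel 𝒳 𝒴) (p : PMF 𝒳) (j : Fin K) (y : 𝒴 j) :
    (ch.outputPMF p j y).toReal = ∑ x, (p x).toReal * (ch.marginal j x y).toReal := by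
  rw [outputPMF, PMF.bind_apply, tsum_fintype, ENNReal.toReal_sum fun x _ =>
    ENNReal.mul_ne_top (p.apply_ne_top _) (PMF.apply_ne_top _ _)]
  simp only [ENNReal.toReal_mul]

theorem mutualInfo_eq (ch : BroadcastChannel 𝒳 𝒴) (p : PMF 𝒳) (j : Fin K) :
    ch.mutualInfo p j = ∑ x, ∑ y, (p x).toReal * ((ch.marginal j x y).toReal *
      Real.log ((ch.marginal j x y).toReal / (ch.outputPMF p j y).toReal)) := by
  refine Finset.sum_congr rfl fun x _ => Finset.sum_congr rfl fun y _ => ?_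
  rw [jointProb]
  by_cases hx : (p x).toReal = 0
  · simp [hx]
  · rw [mul_div_mul_left _ _ hx, mul_assoc]

variable [∀ j, MeasurableSpace (𝒴 j)] [∀ j, DiscreteMeasurableSpace (𝒴 j)]

theorem relEntropy_le_Buser (ch : BroadcastChannel 𝒳 𝒴) (j : Fin K) (x x' : 𝒳) :
    ch.relEntropy j x x' ≤ ch.Buser j :=
  le_iSup_of_le x (le_iSup_of_le x' le_rfl)

theorem Buser_ne_top {ch : BroadcastChannel 𝒳 𝒴} (hB : ch.Bmax < ∞) (j : Fin K) :
    ch.Buser j ≠ ∞ :=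
  ((le_iSup ch.Buser j).trans_lt hB).ne

theorem relEntropy_ne_top {ch : BroadcastChannel 𝒳 𝒴} (hB : ch.Bmax < ∞) (j : Fin K) (x x' : 𝒳) :
    ch.relEntropy j x x' ≠ ∞ :=
  ((ch.relEntropy_le_Buser j x x').trans_lt (Buser_ne_top hB j).lt_top).ne

theorem relEntropy_toReal {ch : BroadcastChannel 𝒳 𝒴} (hB : ch.Bmax < ∞) (j : Fin K) (x x' : 𝒳) :
    (ch.relEntropy j x x').toReal = ∑ y, (ch.marginal j x y).toReal *
      Real.log ((ch.marginal j x y).toReal / (ch.marginal j x' y).toReal) :=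
  (klDiv_toMeasure_ne_top (relEntropy_ne_top hB j x x')).2

theorem isFullChannel {ch : BroadcastChannel 𝒳 𝒴} (hB : ch.Bmax < ∞) (j : Fin K) :
    IsFullChannel fun (x : 𝒳) (y : 𝒴 j) => (ch.marginal j x y).toReal where
  nonneg _ _ := ENNReal.toReal_nonneg
  sum_eq_one _ := PMF.sum_toReal _
  supp x x' y h := (klDiv_toMeasure_ne_top (relEntropy_ne_top hB j x x')).1 y h

theorem sum_log_div_le_Buser {ch : BroadcastChannel 𝒳 𝒴} (hB : ch.Bmax < ∞) (j : Fin K) (x x' : 𝒳) :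
    ∑ y, (ch.marginal j x y).toReal *
      Real.log ((ch.marginal j x y).toReal / (ch.marginal j x' y).toReal) ≤
        (ch.Buser j).toReal := by
  rw [← relEntropy_toReal hB]
  exact ENNReal.toReal_mono (Buser_ne_top hB j) (ch.relEntropy_le_Buser j x x')

/-- Convexity again, for a point mass against the mixture `p`. The bound makes the real supremum
that defines `C_j` bounded above, so that it dominates each mutual information. -/
theorem mutualInfo_le_Buser {ch : BroadcastChannel 𝒳 𝒴} (hB : ch.Bmax < ∞) (p : PMF 𝒳)
    (j : Fin K) : ch.mutualInfo p j ≤ (ch.Buser j).toReal := by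
  classical
  rw [mutualInfo_eq]
  have key : ∀ x, ∑ y, (ch.marginal j x y).toReal *
      Real.log ((ch.marginal j x y).toReal / (ch.outputPMF p j y).toReal) ≤
      (ch.Buser j).toReal := by
    intro x
    have h := (isFullChannel hB j).sum_mul_log_odds_le (sum_log_div_le_Buser hB j)
      (b := fun x' => if x' = x then 1 else 0) (b' := fun x' => (p x').toReal)
      (fun x' => by split_ifs <;> norm_num) (fun _ => ENNReal.toReal_nonneg)
      (by simp) (by rw [PMF.sum_toReal]; exact one_pos)
    simpa [PMF.sum_toReal, ← outputPMF_toReal] using h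
  calc _ = ∑ x, (p x).toReal * ∑ y, (ch.marginal j x y).toReal *
      Real.log ((ch.marginal j x y).toReal / (ch.outputPMF p j y).toReal) := by
        simp only [Finset.mul_sum]
    _ ≤ ∑ x, (p x).toReal * (ch.Buser j).toReal :=
      Finset.sum_le_sum fun x _ => mul_le_mul_of_nonneg_left (key x) ENNReal.toReal_nonneg
    _ = (ch.Buser j).toReal := by rw [← Finset.sum_mul, PMF.sum_toReal, one_mul]

theorem mutualInfo_le_Cuser {ch : BroadcastChannel 𝒳 𝒴} (hB : ch.Bmax < ∞) (p : PMF 𝒳)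
    (j : Fin K) : ch.mutualInfo p j ≤ ch.Cuser j :=
  le_ciSup (f := fun p => ch.mutualInfo p j)
    ⟨(ch.Buser j).toReal, by rintro _ ⟨p, rfl⟩; exact mutualInfo_le_Buser hB p j⟩ p

theorem Cuser_le_Buser {ch : BroadcastChannel 𝒳 𝒴} (hB : ch.Bmax < ∞) (j : Fin K) :
    ch.Cuser j ≤ (ch.Buser j).toReal := by
  -- An empty real supremum is `0`.
  rcases isEmpty_or_nonempty (PMF 𝒳) with h | h
  · rw [Cuser, Real.iSup_of_isEmpty]; exact ENNReal.toReal_nonneg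
  · exact ciSup_le fun p => mutualInfo_le_Buser hB p j

theorem sum_mul_log_le_Cuser {ch : BroadcastChannel 𝒳 𝒴} (hB : ch.Bmax < ∞) (j : Fin K)
    (p : 𝒳 → ℝ) (hp : ∀ x, 0 ≤ p x) (hp1 : ∑ x, p x = 1) :
    ∑ x, ∑ y, p x * ((ch.marginal j x y).toReal * Real.log ((ch.marginal j x y).toReal /
      ∑ x', p x' * (ch.marginal j x' y).toReal)) ≤ ch.Cuser j := by
  let P : PMF 𝒳 := PMF.ofFintype (fun x => ENNReal.ofReal (p x)) (by
    rw [← ENNReal.ofReal_sum_of_nonneg fun x _ => hp x, hp1, ENNReal.ofReal_one])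
  have hP : ∀ x, (P x).toReal = p x := fun x => by
    simp [P, ENNReal.toReal_ofReal (hp x)]
  have h := mutualInfo_le_Cuser hB P j
  rw [mutualInfo_eq] at h
  simpa only [outputPMF_toReal, hP] using h

theorem exists_ratio_bound {ch : BroadcastChannel 𝒳 𝒴} (hB : ch.Bmax < ∞) (j : Fin K) :
    ∃ l : ℝ, 0 < l ∧ l ≤ 1 / 2 ∧ ∀ x x' y,
      l * (ch.marginal j x y).toReal ≤ (ch.marginal j x' y).toReal := by
  classical
  have hV := isFullChannel hB j
  -- The minimum of `f` is the least positive letter probability, capped at `1 / 2` by `none`. Zero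
  -- entries are replaced by `1` so that they do not count; the common support takes care of them.
  let f : Option (𝒳 × 𝒴 j) → ℝ := fun o => o.elim (1 / 2) fun i =>
    if (ch.marginal j i.1 i.2).toReal = 0 then 1 else (ch.marginal j i.1 i.2).toReal
  obtain ⟨o, ho⟩ := Finite.exists_min f
  refine ⟨f o, ?_, ho none, fun x x' y => ?_⟩
  · rcases o with _ | i
    · norm_num [f]
    · simp only [f, Option.elim]
      split_ifs with h
      · exact one_pos
      · exact lt_of_le_of_ne ENNReal.toReal_nonneg (Ne.symm h)
  · by_cases h : (ch.marginal j x' y).toReal = 0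
    · rw [hV.supp x x' y h, h, mul_zero]
    · have h1 := ho (some (x', y))
      simp only [f, Option.elim, h, if_false] at h1
      have h2 : (ch.marginal j x y).toReal ≤ 1 := by
        rw [← hV.sum_eq_one x]
        exact Finset.single_le_sum (f := fun y => (ch.marginal j x y).toReal)
          (fun y _ => hV.nonneg x y) (Finset.mem_univ y)
      have h3 : 0 < f o := by
        rcases o with _ | i
        · norm_num [f]
        · simp only [f, Option.elim]
          split_ifs with h
          · exact one_pos
          · exact lt_of_le_of_ne ENNReal.toReal_nonneg (Ne.symm h)
      calc f o * (ch.marginal j x y).toReal ≤ f o * 1 := mul_le_mul_of_nonneg_left h2 h3.le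
        _ ≤ _ := by rw [mul_one]; exact h1

end BroadcastChannel

/-! ### The upper bound on the reliability function. -/

theorem le_ofReal_exp_of_lt_neg_log_div {P : ℝ≥0∞} {E N : ℝ} (hN : 0 < N)
    (h : (E : EReal) < -ENNReal.log P / (N : EReal)) : P ≤ ENNReal.ofReal (Real.exp (-(E * N))) := by
  by_contra! hlt
  have h1 := ENNReal.log_monotone hlt.le
  rw [ENNReal.log_ofReal_of_pos (Real.exp_pos _), Real.log_exp] at h1
  rw [EReal.lt_div_iff (by exact_mod_cast hN) (EReal.coe_ne_top _)] at h
  have h2 : ((E * N : ℝ) : EReal) < -ENNReal.log P := by exact_mod_cast h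
  have h3 := EReal.neg_le_neg_iff.2 h1
  rw [EReal.coe_neg, neg_neg] at h3
  exact absurd (h2.trans_le h3) (lt_irrefl _)

theorem le_of_forall_large_mul_le {a b k : ℝ} (h : ∀ᶠ N : ℝ in atTop, a * N ≤ b * N + k) : a ≤ b := by
  by_contra! hlt
  obtain ⟨N, h1, h2⟩ := (h.and (eventually_gt_atTop (k / (a - b)))).exists
  rw [div_lt_iff₀ (by linarith)] at h2
  nlinarith

namespace BroadcastChannel

variable {K : ℕ} {𝒳 : Type u} {𝒴 : Fin K → Type v} [Fintype 𝒳] [∀ j, Fintype (𝒴 j)]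
  [∀ j, MeasurableSpace (𝒴 j)] [∀ j, DiscreteMeasurableSpace (𝒴 j)]

/-- `BoundedTest.tradeoff` at large `N`, where what is not proportional to `N` goes into a constant.
The loss `3 * δ` comes from the confidence level `δ` and from two terms with `e ≤ δ`, one of which
uses `C_j ≤ B_j`. -/
theorem IsAchievable.tradeoff {ch : BroadcastChannel 𝒳 𝒴} (hB : ch.Bmax < ∞) {R E : ℝ}
    (h : ch.IsAchievable R E) (j : Fin K) (hC : 0 < ch.Cuser j) {δ : ℝ} (hδ : 0 < δ)
    (hδ' : δ ≤ 1 / 3) :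
    (ch.Buser j).toReal * (1 - 3 * δ) * (R - δ) + ch.Cuser j * (E - δ) ≤
      ch.Cuser j * (ch.Buser j).toReal := by
  obtain ⟨-, -, M, c, hMc, hR, hP, hE⟩ := h
  obtain ⟨l, hl, hl2, hlV⟩ := exists_ratio_bound hB j
  set B := (ch.Buser j).toReal with hBd
  set C := ch.Cuser j with hCd
  have hCB : C ≤ B := Cuser_le_Buser hB j
  have hR' := eventually_lt_of_lt_liminf (lt_of_lt_of_le
    (by exact_mod_cast sub_lt_self R hδ : ((R - δ : ℝ) : EReal) < R) hR)
  have hE' := eventually_lt_of_lt_liminf (lt_of_lt_of_le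
    (by exact_mod_cast sub_lt_self E hδ : ((E - δ : ℝ) : EReal) < E) hE)
  have hP' := hP.eventually_lt_const
    (ENNReal.ofReal_pos.2 (half_pos hδ) : (0 : ℝ≥0∞) < ENNReal.ofReal (δ / 2))
  refine le_of_forall_large_mul_le
    (k := B * Real.log 2 + C * (1 + 2 * Real.log 2 - Real.log (l * δ))) ?_
  filter_upwards [hR', hE', hP', eventually_gt_atTop 0] with N h1 h2 h3 hN
  obtain ⟨hM2, hNc⟩ := hMc N hN
  have h2 := le_ofReal_exp_of_lt_neg_log_div hN h2
  -- This bounds the error probability and also serves as the truncation slack, so `e ≤ 2 * ε`. It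
  -- is positive even if the code makes no errors.
  set ε := min (δ / 2) (Real.exp (-((E - δ) * N))) with hε
  have hε0 : 0 < ε := lt_min (half_pos hδ) (Real.exp_pos _)
  have hPε : ((c N).errorProb ch).toReal ≤ ε :=
    le_min (ENNReal.toReal_le_of_le_ofReal (half_pos hδ).le h3.le)
      (ENNReal.toReal_le_of_le_ofReal (Real.exp_pos _).le h2)
  obtain ⟨d, e, hde, hd, he⟩ := (c N).exists_boundedTest ch (by omega) j hN.le hNc hε0
  obtain ⟨he0, key⟩ := hde.tradeoff hM2 (isFullChannel hB j) (hC.le.trans hCB)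
    (sum_log_div_le_Buser hB j) hC.le (sum_mul_log_le_Cuser hB j) hδ hl (by nlinarith) hlV
  have he2 : e ≤ 2 * ε := by linarith
  have heδ : e ≤ δ := by
    have := min_le_left (δ / 2) (Real.exp (-((E - δ) * N)))
    linarith
  have hlog : (E - δ) * N - Real.log 2 ≤ -Real.log e := by
    have h4 : e ≤ 2 * Real.exp (-((E - δ) * N)) :=
      he2.trans (mul_le_mul_of_nonneg_left (min_le_right _ _) two_pos.le)
    have h5 := Real.log_le_log he0 h4
    rw [Real.log_mul two_ne_zero (Real.exp_pos _).ne', Real.log_exp] at h5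
    linarith
  have hM0 : 0 ≤ Real.log (M N) := Real.log_natCast_nonneg _
  have hMR : (R - δ) * N ≤ Real.log (M N) := by
    have h6 : R - δ < Real.log (M N) / N := by exact_mod_cast h1
    rw [lt_div_iff₀ hN] at h6
    exact h6.le
  have hB0 : 0 < B := hC.trans_le hCB
  have h7 : B * (1 - 3 * δ) * Real.log (M N) ≤
      B * (Real.log (M N) * (1 - δ - e)) - C * (e * Real.log (M N)) := by
    have h8 : C * (e * Real.log (M N)) ≤ B * (e * Real.log (M N)) :=
      mul_le_mul_of_nonneg_right hCB (mul_nonneg he0.le hM0)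
    have h9 : B * Real.log (M N) * e ≤ B * Real.log (M N) * δ :=
      mul_le_mul_of_nonneg_left heδ (mul_nonneg hB0.le hM0)
    nlinarith
  have h10 : B * (1 - 3 * δ) * ((R - δ) * N) ≤ B * (1 - 3 * δ) * Real.log (M N) :=
    mul_le_mul_of_nonneg_left hMR (mul_nonneg hB0.le (by linarith))
  have h11 := mul_le_mul_of_nonneg_left hlog hC.le
  have h12 := mul_le_mul_of_nonneg_left hd (mul_pos hC hB0).le
  linarith

theorem IsAchievable.le {ch : BroadcastChannel 𝒳 𝒴} (hB : ch.Bmax < ∞) {R E : ℝ}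
    (h : ch.IsAchievable R E) (j : Fin K) (hC : 0 < ch.Cuser j) :
    E ≤ (ch.Buser j).toReal * (1 - R / ch.Cuser j) := by
  set B := (ch.Buser j).toReal
  set C := ch.Cuser j
  have hlim : Tendsto (fun δ : ℝ => B * (1 - 3 * δ) * (R - δ) + C * (E - δ)) (nhdsWithin 0 (Set.Ioi 0))
      (nhds (B * (1 - 3 * 0) * (R - 0) + C * (E - 0))) :=
    (Continuous.tendsto (by fun_prop) 0).mono_left nhdsWithin_le_nhds
  have h1 := le_of_tendsto hlim (b := C * B) (by
    filter_upwards [Ioc_mem_nhdsGT (by norm_num : (0 : ℝ) < 1 / 3)] with δ hδ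
    exact h.tradeoff hB j hC hδ.1 hδ.2)
  have h2 : C * (B * (1 - R / C)) = C * B - B * R := by field_simp
  refine le_of_mul_le_mul_left ?_ hC
  rw [h2]
  linarith

theorem reliability_le {ch : BroadcastChannel 𝒳 𝒴} (hB : ch.Bmax < ∞) {R : ℝ} (hR : 0 ≤ R)
    (hRC : R < ch.Cbar) :
    ch.reliability R ≤ ⨅ j, (((ch.Buser j).toReal * (1 - R / ch.Cuser j) : ℝ) : EReal) := by
  refine le_iInf fun j => sSup_le ?_
  rintro _ ⟨E, rfl, hE⟩
  have hC : ch.Cbar ≤ ch.Cuser j := ciInf_le (Set.finite_range _).bddBelow j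
  exact_mod_cast hE.le hB j (by linarith)

end BroadcastChannel

/-! ### Tail bounds for products of independent factors. -/

section ProductTail

variable {Ω : Type*} [Fintype Ω]

theorem sum_prod_eq_prod_sum {n : ℕ} (f : Fin n → Ω → ℝ) :
    ∑ v : Fin n → Ω, ∏ i, f i (v i) = ∏ i, ∑ ω, f i ω := by
  classical
  rw [Finset.prod_univ_sum, Fintype.piFinset_univ]

/-- Markov's inequality for a product of nonnegative functions of independent variables. -/
theorem sum_indicator_exp_le_prod {n : ℕ} {q f : Fin n → Ω → ℝ} (hq : ∀ i ω, 0 ≤ q i ω)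
    (hf : ∀ i ω, 0 ≤ f i ω) (hqf : ∀ i, ∑ ω, q i ω * f i ω ≤ 1) (γ : ℝ) :
    ∑ v, {v : Fin n → Ω | Real.exp (n * γ) ≤ ∏ i, f i (v i)}.indicator
      (fun v => ∏ i, q i (v i)) v ≤ Real.exp (-(n * γ)) := by
  have key : ∀ v : Fin n → Ω, {v : Fin n → Ω | Real.exp (n * γ) ≤ ∏ i, f i (v i)}.indicator
      (fun v => ∏ i, q i (v i)) v ≤ Real.exp (-(n * γ)) * ∏ i, (q i (v i) * f i (v i)) := by
    intro v
    have h0 : 0 ≤ ∏ i, q i (v i) := Finset.prod_nonneg fun i _ => hq i _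
    have h1 : 0 ≤ ∏ i, f i (v i) := Finset.prod_nonneg fun i _ => hf i _
    rw [Finset.prod_mul_distrib]
    by_cases hv : Real.exp (n * γ) ≤ ∏ i, f i (v i)
    · rw [Set.indicator_of_mem (by exact hv)]
      have h2 := mul_le_mul_of_nonneg_left hv (Real.exp_pos (-(n * γ))).le
      rw [← Real.exp_add, neg_add_cancel, Real.exp_zero] at h2
      nlinarith
    · rw [Set.indicator_of_notMem (by exact hv)]
      positivity
  refine (Finset.sum_le_sum fun v _ => key v).trans ?_
  rw [← Finset.mul_sum, sum_prod_eq_prod_sum fun i ω => q i ω * f i ω]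
  exact mul_le_of_le_one_right (Real.exp_pos _).le (Finset.prod_le_one
    (fun i _ => Finset.sum_nonneg fun ω _ => mul_nonneg (hq i ω) (hf i ω)) fun i _ => hqf i)

/-- Chernoff's bound for a product of positive functions of independent and identically distributed
variables. -/
theorem exists_sum_indicator_lt_exp_le {q f : Ω → ℝ} (hq : ∀ ω, 0 ≤ q ω) (hq1 : ∑ ω, q ω = 1)
    (hf : ∀ ω, q ω ≠ 0 → 0 < f ω) {γ : ℝ} (hγ : γ < ∑ ω, q ω * Real.log (f ω)) :
    ∃ ρ : ℝ, 0 ≤ ρ ∧ ρ < 1 ∧ ∀ n : ℕ,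
      ∑ v, {v : Fin n → Ω | ∏ i, f (v i) < Real.exp (n * γ)}.indicator
        (fun v => ∏ i, q (v i)) v ≤ ρ ^ n := by
  -- The moment generating function of `γ - log f`. Its value at `0` is `1` and its slope there is
  -- negative, so `ρ = φ s < 1` for some `s > 0`.
  set φ : ℝ → ℝ := fun s => ∑ ω, q ω * Real.exp (s * (γ - Real.log (f ω))) with hφ
  have hφ0 : φ 0 = 1 := by simp [hφ, hq1]
  have hder : HasDerivAt φ (∑ ω, q ω * (γ - Real.log (f ω))) 0 := by
    have h1 : ∀ ω ∈ (Finset.univ : Finset Ω), HasDerivAt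
        (fun s : ℝ => q ω * Real.exp (s * (γ - Real.log (f ω)))) (q ω * (γ - Real.log (f ω))) 0 := by
      intro ω _
      have := ((hasDerivAt_id (0 : ℝ)).mul_const (γ - Real.log (f ω))).exp.const_mul (q ω)
      simpa using this
    exact HasDerivAt.fun_sum h1
  have hneg : ∑ ω, q ω * (γ - Real.log (f ω)) < 0 := by
    simp only [mul_sub, Finset.sum_sub_distrib, ← Finset.sum_mul, hq1]
    linarith
  obtain ⟨s, hs, hs0⟩ := ((hder.tendsto_slope_zero_right.eventually_lt_const hneg).and
    self_mem_nhdsWithin).exists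
  have hs0 : 0 < s := hs0
  have hφs : φ s < 1 := by
    rw [zero_add, hφ0, smul_eq_mul] at hs
    by_contra! hc
    exact absurd hs (not_lt.2 (mul_nonneg (inv_pos.2 hs0).le (sub_nonneg.2 hc)))
  refine ⟨φ s, Finset.sum_nonneg fun ω _ => mul_nonneg (hq ω) (Real.exp_pos _).le, hφs, fun n => ?_⟩
  have key : ∀ v : Fin n → Ω, {v : Fin n → Ω | ∏ i, f (v i) < Real.exp (n * γ)}.indicator
      (fun v => ∏ i, q (v i)) v ≤
      ∏ i, (q (v i) * Real.exp (s * (γ - Real.log (f (v i))))) := by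
    intro v
    have hnn : 0 ≤ ∏ i, (q (v i) * Real.exp (s * (γ - Real.log (f (v i))))) :=
      Finset.prod_nonneg fun i _ => mul_nonneg (hq _) (Real.exp_pos _).le
    by_cases hv : ∏ i, f (v i) < Real.exp (n * γ)
    · rw [Set.indicator_of_mem (by exact hv)]
      by_cases h0 : ∃ i, q (v i) = 0
      · obtain ⟨i, hi⟩ := h0
        rw [Finset.prod_eq_zero (Finset.mem_univ i) hi]
        exact hnn
      · push Not at h0
        have hfp : ∀ i, 0 < f (v i) := fun i => hf _ (h0 i)
        rw [Finset.prod_mul_distrib, ← Real.exp_sum, ← Finset.mul_sum]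
        refine le_mul_of_one_le_right (Finset.prod_nonneg fun i _ => hq _) (Real.one_le_exp ?_)
        refine mul_nonneg hs0.le ?_
        rw [Finset.sum_sub_distrib, ← Real.log_prod fun i _ => (hfp i).ne']
        have h2 := Real.log_lt_log (Finset.prod_pos fun i _ => hfp i) hv
        rw [Real.log_exp] at h2
        simp only [Finset.sum_const, Finset.card_univ, Fintype.card_fin, nsmul_eq_mul]
        linarith
    · rw [Set.indicator_of_notMem (by exact hv)]
      exact hnn
  refine (Finset.sum_le_sum fun v _ => key v).trans ?_
  rw [sum_prod_eq_prod_sum fun _ ω => q ω * Real.exp (s * (γ - Real.log (f ω))), Finset.prod_const,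
    Finset.card_univ, Fintype.card_fin]

end ProductTail

/-! ### Block codes and confirmation tests. -/

namespace BroadcastChannel

variable {K : ℕ} {𝒳 : Type u} {𝒴 : Fin K → Type v} 

theorem wordProb_nonneg (ch : BroadcastChannel 𝒳 𝒴) {n : ℕ} (x : Fin n → 𝒳)
    (y : Fin n → ∀ j, 𝒴 j) : 0 ≤ ch.wordProb x y :=
  Finset.prod_nonneg fun _ _ => ENNReal.toReal_nonneg

variable [∀ j, Fintype (𝒴 j)]

/-- The probability that the output word lies in `S` when the input word is `x`. -/
noncomputable def blockProb (ch : BroadcastChannel 𝒳 𝒴) {n : ℕ} (x : Fin n → 𝒳)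
    (S : Set (Fin n → ∀ j, 𝒴 j)) : ℝ :=
  ∑ y, S.indicator (ch.wordProb x) y

theorem blockProb_mono (ch : BroadcastChannel 𝒳 𝒴) {n : ℕ} (x : Fin n → 𝒳)
    {S S' : Set (Fin n → ∀ j, 𝒴 j)} (h : S ⊆ S') : ch.blockProb x S ≤ ch.blockProb x S' :=
  Finset.sum_le_sum fun y _ => Set.indicator_le_indicator_of_subset h
    (fun y => ch.wordProb_nonneg x y) y

theorem blockProb_iUnion_le (ch : BroadcastChannel 𝒳 𝒴) {n : ℕ} (x : Fin n → 𝒳) {ι : Type*}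
    (s : Finset ι) (S : ι → Set (Fin n → ∀ j, 𝒴 j)) :
    ch.blockProb x (⋃ i ∈ s, S i) ≤ ∑ i ∈ s, ch.blockProb x (S i) := by
  unfold blockProb
  rw [Finset.sum_comm]
  refine Finset.sum_le_sum fun y _ => ?_
  have hnn : ∀ i ∈ s, 0 ≤ (S i).indicator (ch.wordProb x) y := fun i _ =>
    Set.indicator_nonneg (fun _ _ => ch.wordProb_nonneg x _) y
  by_cases hy : y ∈ ⋃ i ∈ s, S i
  · rw [Set.indicator_of_mem hy]
    simp only [Set.mem_iUnion] at hy
    obtain ⟨i, hi, hyi⟩ := hy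
    refine le_trans (le_of_eq ?_) (Finset.single_le_sum hnn hi)
    rw [Set.indicator_of_mem hyi]
  · rw [Set.indicator_of_notMem hy]
    exact Finset.sum_nonneg hnn

theorem blockProb_union_le (ch : BroadcastChannel 𝒳 𝒴) {n : ℕ} (x : Fin n → 𝒳)
    (S S' : Set (Fin n → ∀ j, 𝒴 j)) :
    ch.blockProb x (S ∪ S') ≤ ch.blockProb x S + ch.blockProb x S' := by
  have := ch.blockProb_iUnion_le x (Finset.univ : Finset Bool) (fun b => cond b S S')
  simpa [Set.union_eq_iUnion] using this

theorem sum_toReal_mul_comp (ch : BroadcastChannel 𝒳 𝒴) (j : Fin K) (x : 𝒳) (f : 𝒴 j → ℝ) :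
    ∑ t, (ch x t).toReal * f (t j) = ∑ y, (ch.marginal j x y).toReal * f y := by
  classical
  have h : ∀ y, (ch.marginal j x y).toReal = ∑ t, if y = t j then (ch x t).toReal else 0 := by
    intro y
    rw [marginal, PMF.map_apply, tsum_fintype, ENNReal.toReal_sum]
    · refine Finset.sum_congr rfl fun t _ => ?_
      split_ifs <;> simp
    · intro t _
      split_ifs
      · exact (ch x).apply_ne_top t
      · exact ENNReal.zero_ne_top
  simp only [h, Finset.sum_mul]
  rw [Finset.sum_comm]
  refine Finset.sum_congr rfl fun t _ => ?_
  simp [ite_mul]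

/-- The words at receiver `j` whose likelihood ratio `l`, given the input word `x`, exceeds the
threshold `γ` per letter. -/
def ratioTest {n : ℕ} {j : Fin K} (l : 𝒳 → 𝒴 j → ℝ) (γ : ℝ) (x : Fin n → 𝒳) : Set (Fin n → 𝒴 j) :=
  {y | Real.exp (n * γ) ≤ ∏ i, l (x i) (y i)}

/-- Greedy selection of codewords: if, on average over the inputs, the test of every receiver accepts
the transmitted word and rejects any given other one, then there is a codebook with the same
property. -/
theorem exists_codebook_of_average [Fintype 𝒳] (ch : BroadcastChannel 𝒳 𝒴) {n : ℕ}
    {P : (Fin n → 𝒳) → ℝ} (hP : ∀ x, 0 ≤ P x) (hP1 : ∑ x, P x = 1)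
    (T : (j : Fin K) → (Fin n → 𝒳) → Set (Fin n → 𝒴 j)) {α β : ℝ}
    (hα : ∀ j, ∑ x, P x * ch.blockProb x {y | (fun i => y i j) ∉ T j x} ≤ α)
    (hβ : ∀ j x', ∑ x, P x * ch.blockProb x {y | (fun i => y i j) ∈ T j x'} ≤ β)
    (hβ0 : 0 ≤ β) (M : ℕ) :
    ∃ cw : ℕ → Fin n → 𝒳, ∀ m < M, ch.blockProb (cw m)
      {y | ∃ j, (fun i => y i j) ∉ T j (cw m) ∨ ∃ m' < m, (fun i => y i j) ∈ T j (cw m')} ≤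
        K * (α + M * β) := by
  -- If every next codeword violated the bound, so would the average over `P`, against the union
  -- bound over receivers and earlier codewords.
  have hstep : ∀ (cw : ℕ → Fin n → 𝒳) (m : ℕ), m < M → ∃ x, ch.blockProb x
      {y | ∃ j, (fun i => y i j) ∉ T j x ∨ ∃ m' < m, (fun i => y i j) ∈ T j (cw m')} ≤
        K * (α + M * β) := by
    intro cw m hm
    by_contra! hcon
    have hbound : ∀ x, ch.blockProb x
        {y | ∃ j, (fun i => y i j) ∉ T j x ∨ ∃ m' < m, (fun i => y i j) ∈ T j (cw m')} ≤
        ∑ j, (ch.blockProb x {y | (fun i => y i j) ∉ T j x} +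
          ∑ m' ∈ Finset.range m, ch.blockProb x {y | (fun i => y i j) ∈ T j (cw m')}) := by
      intro x
      have hset : {y : Fin n → ∀ j, 𝒴 j | ∃ j, (fun i => y i j) ∉ T j x ∨
          ∃ m' < m, (fun i => y i j) ∈ T j (cw m')} =
          ⋃ j ∈ (Finset.univ : Finset (Fin K)), ({y | (fun i => y i j) ∉ T j x} ∪
            ⋃ m' ∈ Finset.range m, {y | (fun i => y i j) ∈ T j (cw m')}) := by
        ext y; simp
      rw [hset]
      refine (ch.blockProb_iUnion_le x _ _).trans (Finset.sum_le_sum fun j _ => ?_)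
      exact (ch.blockProb_union_le x _ _).trans
        (add_le_add le_rfl (ch.blockProb_iUnion_le x _ _))
    have havg : ∑ x, P x * ∑ j, (ch.blockProb x {y | (fun i => y i j) ∉ T j x} +
          ∑ m' ∈ Finset.range m, ch.blockProb x {y | (fun i => y i j) ∈ T j (cw m')}) ≤
        K * (α + M * β) := by
      simp only [Finset.mul_sum, mul_add]
      rw [Finset.sum_comm]
      calc _ ≤ ∑ _j : Fin K, (α + M * β) := by
            refine Finset.sum_le_sum fun j _ => ?_
            rw [Finset.sum_add_distrib]
            refine add_le_add (hα j) ?_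
            rw [Finset.sum_comm]
            calc _ ≤ ∑ _m' ∈ Finset.range m, β := Finset.sum_le_sum fun m' _ => hβ j (cw m')
              _ = m * β := by simp
              _ ≤ M * β := mul_le_mul_of_nonneg_right (by exact_mod_cast hm.le) hβ0
        _ = K * α + K * (M * β) := by simp
    have hlt : K * (α + M * β) < ∑ x, P x * ∑ j,
        (ch.blockProb x {y | (fun i => y i j) ∉ T j x} +
          ∑ m' ∈ Finset.range m, ch.blockProb x {y | (fun i => y i j) ∈ T j (cw m')}) := by
      calc K * (α + M * β) = ∑ x, P x * (K * (α + M * β)) := by rw [← Finset.sum_mul, hP1, one_mul]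
        _ < _ := by
          refine Finset.sum_lt_sum (fun x _ => mul_le_mul_of_nonneg_left
            ((hcon x).le.trans (hbound x)) (hP x)) ?_
          obtain ⟨x, _, hx⟩ := Finset.exists_ne_zero_of_sum_ne_zero (by rw [hP1]; exact one_ne_zero)
          exact ⟨x, Finset.mem_univ x, mul_lt_mul_of_pos_left ((hcon x).trans_le (hbound x))
            (lt_of_le_of_ne (hP x) (Ne.symm hx))⟩
    exact absurd (hlt.trans_le havg) (lt_irrefl _)
  have hind : ∀ k ≤ M, ∃ cw : ℕ → Fin n → 𝒳, ∀ m < k, ch.blockProb (cw m)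
      {y | ∃ j, (fun i => y i j) ∉ T j (cw m) ∨ ∃ m' < m, (fun i => y i j) ∈ T j (cw m')} ≤
        K * (α + M * β) := by
    intro k
    induction k with
    | zero =>
      intro _
      obtain ⟨x, _, -⟩ := Finset.exists_ne_zero_of_sum_ne_zero (by rw [hP1]; exact one_ne_zero)
      exact ⟨fun _ => x, fun m hm => absurd hm (Nat.not_lt_zero m)⟩
    | succ k ih =>
      intro hk
      obtain ⟨cw, hcw⟩ := ih (by omega)
      obtain ⟨x, hx⟩ := hstep cw k (by omega)
      refine ⟨Function.update cw k x, fun m hm => ?_⟩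
      have hprev : ∀ m' < m, Function.update cw k x m' = cw m' := fun m' hm' =>
        Function.update_of_ne (by omega) _ _
      have hset : ∀ z, {y : Fin n → ∀ j, 𝒴 j | ∃ j, (fun i => y i j) ∉ T j z ∨
          ∃ m' < m, (fun i => y i j) ∈ T j (Function.update cw k x m')} =
          {y | ∃ j, (fun i => y i j) ∉ T j z ∨ ∃ m' < m, (fun i => y i j) ∈ T j (cw m')} := by
        intro z
        ext y
        refine exists_congr fun j => or_congr Iff.rfl (exists_congr fun m' => and_congr_right fun h => ?_)
        rw [hprev m' h]
      rw [hset]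
      rcases Nat.lt_succ_iff_lt_or_eq.1 hm with h | rfl
      · rw [Function.update_of_ne (by omega)]
        exact hcw m h
      · rw [Function.update_self]
        exact hx
  exact hind M le_rfl

theorem sum_mul_wordProb [Fintype 𝒳] (ch : BroadcastChannel 𝒳 𝒴) (p : 𝒳 → ℝ) {n : ℕ}
    (y : Fin n → ∀ j, 𝒴 j) :
    ∑ x : Fin n → 𝒳, (∏ i, p (x i)) * ch.wordProb x y = ∏ i, ∑ x, p x * (ch x (y i)).toReal := by
  rw [← sum_prod_eq_prod_sum fun i x => p x * (ch x (y i)).toReal]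
  refine Finset.sum_congr rfl fun x _ => ?_
  rw [wordProb, Finset.prod_mul_distrib]

/-- Below the rate of every receiver, there are codebooks of small maximal error probability. -/
theorem exists_codebook [Fintype 𝒳] (ch : BroadcastChannel 𝒳 𝒴) (p : PMF 𝒳) {γ : ℝ}
    (hγ : ∀ j, γ < ch.mutualInfo p j) :
    ∃ ρ : ℝ, 0 ≤ ρ ∧ ρ < 1 ∧ ∀ (n M : ℕ), 0 < M →
      ∃ (cw : Fin M → Fin n → 𝒳) (dec : ∀ j, (Fin n → 𝒴 j) → Fin M), ∀ m,
        ch.blockProb (cw m) {y | ∃ j, dec j (fun i => y i j) ≠ m} ≤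
          K * (ρ ^ n + M * Real.exp (-(n * γ))) := by
  classical
  -- Under the joint law `log (l j)` has mean `I(X; Y_j) > γ`, so Chernoff bounds the missed
  -- codewords. For a fixed codeword and an independent output, `l j` has mean at most `1`, so
  -- Markov bounds the false acceptances.
  let l : (j : Fin K) → 𝒳 → 𝒴 j → ℝ := fun j x y =>
    (ch.marginal j x y).toReal / (ch.outputPMF p j y).toReal
  have hl0 : ∀ j x y, 0 ≤ l j x y := fun j x y => div_nonneg ENNReal.toReal_nonneg ENNReal.toReal_nonneg
  have hmiss : ∀ j, ∃ ρ : ℝ, 0 ≤ ρ ∧ ρ < 1 ∧ ∀ n : ℕ, ∑ x : Fin n → 𝒳, (∏ i, (p (x i)).toReal) *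
      ch.blockProb x {y | (fun i => y i j) ∉ ratioTest (l j) γ x} ≤ ρ ^ n := by
    intro j
    obtain ⟨ρ, h0, h1, h⟩ := exists_sum_indicator_lt_exp_le
      (q := fun ω : 𝒳 × (∀ j, 𝒴 j) => (p ω.1).toReal * (ch ω.1 ω.2).toReal)
      (f := fun ω => l j ω.1 (ω.2 j)) (γ := γ)
      (fun ω => mul_nonneg ENNReal.toReal_nonneg ENNReal.toReal_nonneg)
      (by
        rw [Fintype.sum_prod_type]
        simp only [← Finset.mul_sum, PMF.sum_toReal, mul_one])
      (by
        rintro ⟨x, t⟩ hω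
        have hp : 0 < (p x).toReal :=
          lt_of_le_of_ne ENNReal.toReal_nonneg (Ne.symm (left_ne_zero_of_mul hω))
        have hc : 0 < (ch x t).toReal :=
          lt_of_le_of_ne ENNReal.toReal_nonneg (Ne.symm (right_ne_zero_of_mul hω))
        have hm : 0 < (ch.marginal j x (t j)).toReal := by
          have := ch.sum_toReal_mul_comp j x (fun y => if y = t j then 1 else 0)
          simp only [mul_ite, mul_one, mul_zero, Finset.sum_ite_eq', Finset.mem_univ, if_true] at this
          rw [← this]
          refine Finset.sum_pos' (fun t' _ => ?_) ⟨t, Finset.mem_univ t, by simpa using hc⟩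
          split_ifs
          · exact ENNReal.toReal_nonneg
          · exact le_rfl
        refine div_pos hm ?_
        rw [outputPMF_toReal]
        exact Finset.sum_pos' (fun x' _ => mul_nonneg ENNReal.toReal_nonneg ENNReal.toReal_nonneg)
          ⟨x, Finset.mem_univ x, mul_pos hp hm⟩)
      (by
        rw [Fintype.sum_prod_type]
        refine (hγ j).trans_le (le_of_eq ?_)
        rw [mutualInfo_eq]
        refine Finset.sum_congr rfl fun x _ => ?_
        rw [← Finset.mul_sum, ← ch.sum_toReal_mul_comp j x (fun y => Real.log (l j x y)),
          Finset.mul_sum]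
        exact Finset.sum_congr rfl fun t _ => by ring)
    refine ⟨ρ, h0, h1, fun n => le_trans (le_of_eq ?_) (h n)⟩
    rw [← (Equiv.arrowProdEquivProdArrow (Fin n) (fun _ => 𝒳) (fun _ => ∀ j, 𝒴 j)).symm.sum_comp,
      Fintype.sum_prod_type]
    refine Finset.sum_congr rfl fun x _ => ?_
    rw [blockProb, Finset.mul_sum]
    refine Finset.sum_congr rfl fun y _ => ?_
    simp only [Set.indicator_apply, Set.mem_ofPred_eq, ratioTest, not_le,
      Equiv.arrowProdEquivProdArrow, Equiv.coe_fn_symm_mk, mul_ite, mul_zero,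
      Finset.prod_mul_distrib, wordProb]
  choose ρ hρ0 hρ1 hρ using hmiss
  obtain ⟨r, hr0, hr1, hr⟩ : ∃ r : ℝ, 0 ≤ r ∧ r < 1 ∧ ∀ j, ρ j ≤ r := by
    rcases isEmpty_or_nonempty (Fin K) with hK | hK
    · exact ⟨0, le_rfl, one_pos, fun j => (hK.false j).elim⟩
    · obtain ⟨j, hj⟩ := Finite.exists_max ρ
      exact ⟨ρ j, hρ0 j, hρ1 j, hj⟩
  refine ⟨r, hr0, hr1, fun n M hM => ?_⟩
  obtain ⟨cw, hcw⟩ := ch.exists_codebook_of_average (P := fun x : Fin n → 𝒳 => ∏ i, (p (x i)).toReal)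
    (fun x => Finset.prod_nonneg fun i _ => ENNReal.toReal_nonneg)
    (by rw [sum_prod_eq_prod_sum fun _ x => (p x).toReal]; simp [PMF.sum_toReal])
    (fun j x => ratioTest (l j) γ x) (α := r ^ n) (β := Real.exp (-(n * γ)))
    (fun j => (hρ j n).trans (pow_le_pow_left₀ (hρ0 j) (hr j) n))
    (fun j x' => by
      have h := sum_indicator_exp_le_prod (n := n)
        (q := fun _ (t : ∀ j, 𝒴 j) => ∑ x, (p x).toReal * (ch x t).toReal)
        (f := fun i t => l j (x' i) (t j))
        (fun i t => Finset.sum_nonneg fun x _ => mul_nonneg ENNReal.toReal_nonneg ENNReal.toReal_nonneg)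
        (fun i t => hl0 j _ _)
        (fun i => by
          simp only [Finset.sum_mul]
          rw [Finset.sum_comm]
          simp only [mul_assoc, ← Finset.mul_sum]
          simp only [ch.sum_toReal_mul_comp j _ (fun y => l j (x' i) y), Finset.mul_sum]
          rw [Finset.sum_comm]
          simp only [← mul_assoc, ← Finset.sum_mul, ← outputPMF_toReal]
          calc _ ≤ ∑ y, (ch.marginal j (x' i) y).toReal := by
                refine Finset.sum_le_sum fun y _ => ?_
                by_cases h0 : (ch.outputPMF p j y).toReal = 0
                · rw [h0, zero_mul]; exact ENNReal.toReal_nonneg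
                · rw [mul_div_cancel₀ _ h0]
            _ = 1 := PMF.sum_toReal _) γ
      refine le_trans (le_of_eq ?_) h
      simp only [blockProb, Finset.mul_sum]
      rw [Finset.sum_comm]
      refine Finset.sum_congr rfl fun y _ => ?_
      by_cases hy : Real.exp (n * γ) ≤ ∏ i, l j (x' i) (y i j)
      · rw [Set.indicator_of_mem (by exact hy), ← sum_mul_wordProb ch fun x => (p x).toReal]
        exact Finset.sum_congr rfl fun x _ => by rw [Set.indicator_of_mem (by exact hy)]
      · rw [Set.indicator_of_notMem (by exact hy)]
        exact Finset.sum_eq_zero fun x _ => by rw [Set.indicator_of_notMem (by exact hy), mul_zero])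
    (Real.exp_pos _).le M
  -- Decode to the first codeword whose test accepts: the greedy codebook controls acceptance by
  -- earlier codewords only.
  have hdec : ∀ (j : Fin K) (y : Fin n → 𝒴 j), ∃ m : Fin M, ∀ m' : Fin M,
      y ∈ ratioTest (l j) γ (cw m') → (∀ i < (m' : ℕ), y ∉ ratioTest (l j) γ (cw i)) → m = m' := by
    intro j y
    by_cases h : ∃ m : Fin M, y ∈ ratioTest (l j) γ (cw m) ∧
        ∀ i < (m : ℕ), y ∉ ratioTest (l j) γ (cw i)
    · obtain ⟨m, h1, h2⟩ := h
      refine ⟨m, fun m' h1' h2' => Fin.ext ?_⟩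
      rcases lt_trichotomy (m : ℕ) m' with h | h | h
      · exact absurd h1 (h2' m h)
      · exact h
      · exact absurd h1' (h2 m' h)
    · push Not at h
      refine ⟨⟨0, hM⟩, fun m' h1' h2' => ?_⟩
      obtain ⟨i, hi, hi'⟩ := h m' h1'
      exact absurd hi' (h2' i hi)
  choose dec hdec using hdec
  refine ⟨fun m => cw m, dec, fun m => (ch.blockProb_mono _ ?_).trans (hcw m m.2)⟩
  rintro y ⟨j, hj⟩
  refine ⟨j, ?_⟩
  by_contra! hcon
  exact hj (hdec j _ m hcon.1 hcon.2)

/-- Likelihood ratio tests between the repeated inputs `x` and `x'`. -/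
theorem exists_ackTest [Fintype 𝒳] [∀ j, MeasurableSpace (𝒴 j)]
    [∀ j, DiscreteMeasurableSpace (𝒴 j)] {ch : BroadcastChannel 𝒳 𝒴} (hB : ch.Bmax < ∞) (x x' : 𝒳)
    {γ : ℝ} (hγ : ∀ j, γ < (ch.relEntropy j x x').toReal) :
    ∃ ρ : ℝ, 0 ≤ ρ ∧ ρ < 1 ∧ ∀ n : ℕ, ∃ A : ∀ j, Set (Fin n → 𝒴 j), ∀ j,
      ch.blockProb (fun _ => x) {y | (fun i => y i j) ∉ A j} ≤ ρ ^ n ∧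
      ch.blockProb (fun _ => x') {y | (fun i => y i j) ∈ A j} ≤ Real.exp (-(n * γ)) := by
  classical
  -- The mean of `log (l j)` under `x` is the divergence, which exceeds `γ`; the mean of `l j` under
  -- `x'` is at most `1`.
  let l : (j : Fin K) → 𝒴 j → ℝ := fun j y =>
    (ch.marginal j x y).toReal / (ch.marginal j x' y).toReal
  have hmiss : ∀ j, ∃ ρ : ℝ, 0 ≤ ρ ∧ ρ < 1 ∧ ∀ n : ℕ,
      ch.blockProb (fun _ : Fin n => x)
        {y | (fun i => y i j) ∉ {z : Fin n → 𝒴 j | Real.exp (n * γ) ≤ ∏ i, l j (z i)}} ≤ ρ ^ n := by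
    intro j
    obtain ⟨ρ, h0, h1, h⟩ := exists_sum_indicator_lt_exp_le
      (q := fun t : ∀ j, 𝒴 j => (ch x t).toReal) (f := fun t => l j (t j)) (γ := γ)
      (fun t => ENNReal.toReal_nonneg) (PMF.sum_toReal _)
      (by
        intro t ht
        have hc : 0 < (ch x t).toReal := lt_of_le_of_ne ENNReal.toReal_nonneg (Ne.symm ht)
        have hm : 0 < (ch.marginal j x (t j)).toReal := by
          have := ch.sum_toReal_mul_comp j x (fun y => if y = t j then 1 else 0)
          simp only [mul_ite, mul_one, mul_zero, Finset.sum_ite_eq', Finset.mem_univ, if_true] at this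
          rw [← this]
          refine Finset.sum_pos' (fun t' _ => ?_) ⟨t, Finset.mem_univ t, by simpa using hc⟩
          split_ifs
          · exact ENNReal.toReal_nonneg
          · exact le_rfl
        refine div_pos hm (lt_of_le_of_ne ENNReal.toReal_nonneg fun h0 => hm.ne' ?_)
        exact (isFullChannel hB j).supp x x' (t j) h0.symm)
      (by
        rw [ch.sum_toReal_mul_comp j x (fun y => Real.log (l j y)), ← relEntropy_toReal hB]
        exact hγ j)
    refine ⟨ρ, h0, h1, fun n => le_trans (le_of_eq ?_) (h n)⟩
    rw [blockProb]
    refine Finset.sum_congr rfl fun y _ => ?_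
    simp only [Set.indicator_apply, Set.mem_ofPred_eq, not_le, wordProb]
  choose ρ hρ0 hρ1 hρ using hmiss
  obtain ⟨r, hr0, hr1, hr⟩ : ∃ r : ℝ, 0 ≤ r ∧ r < 1 ∧ ∀ j, ρ j ≤ r := by
    rcases isEmpty_or_nonempty (Fin K) with hK | hK
    · exact ⟨0, le_rfl, one_pos, fun j => (hK.false j).elim⟩
    · obtain ⟨j, hj⟩ := Finite.exists_max ρ
      exact ⟨ρ j, hρ0 j, hρ1 j, hj⟩
  refine ⟨r, hr0, hr1, fun n => ⟨fun j => {z | Real.exp (n * γ) ≤ ∏ i, l j (z i)}, fun j =>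
    ⟨(hρ j n).trans (pow_le_pow_left₀ (hρ0 j) (hr j) n), ?_⟩⟩⟩
  exact sum_indicator_exp_le_prod (n := n) (q := fun _ (t : ∀ j, 𝒴 j) => (ch x' t).toReal)
    (f := fun _ t => l j (t j)) (fun _ _ => ENNReal.toReal_nonneg)
    (fun _ _ => div_nonneg ENNReal.toReal_nonneg ENNReal.toReal_nonneg)
    (fun _ => by
      rw [ch.sum_toReal_mul_comp j x' (l j)]
      calc _ ≤ ∑ y, (ch.marginal j x y).toReal := by
            refine Finset.sum_le_sum fun y _ => ?_
            by_cases h0 : (ch.marginal j x' y).toReal = 0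
            · rw [h0, zero_mul]; exact ENNReal.toReal_nonneg
            · rw [mul_div_cancel₀ _ h0]
        _ = 1 := PMF.sum_toReal _) γ

end BroadcastChannel

/-! ### Events that depend on finitely many outputs. -/

/-- A word, continued arbitrarily to an infinite sequence. -/
noncomputable def extendWord {α : Type*} [Nonempty α] {n : ℕ} (y : Fin n → α) (k : ℕ) : α :=
  if h : k < n then y ⟨k, h⟩ else Classical.arbitrary α

theorem extendWord_of_lt {α : Type*} [Nonempty α] {n k : ℕ} (y : Fin n → α) (h : k < n) :
    extendWord y k = y ⟨k, h⟩ := dif_pos h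

namespace VLFTCode

open Outcome

variable {K : ℕ} {𝒳 : Type u} {𝒴 : Fin K → Type v} [∀ j, MeasurableSpace (𝒴 j)] {M : ℕ}
  [∀ j, Fintype (𝒴 j)] [∀ j, DiscreteMeasurableSpace (𝒴 j)]

/-- Membership can be tested on an arbitrary continuation of the prefix. Events of infinite
sequences with a finite horizon can thus be handled by the congruence `hU` alone. -/
theorem eq_preimage_prefixAt {n : ℕ} {U : Set (ℕ → ∀ j, 𝒴 j)} [Nonempty (∀ j, 𝒴 j)]
    (hU : ∀ ω ω', (∀ k < n, ω k = ω' k) → ω ∈ U → ω' ∈ U) :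
    U = {ω | prefixAt n ω ∈ {z | extendWord z ∈ U}} := by
  have h : ∀ ω : ℕ → ∀ j, 𝒴 j, ∀ k < n, extendWord (prefixAt n ω) k = ω k := fun ω k hk =>
    extendWord_of_lt _ hk
  ext ω
  exact ⟨hU _ _ fun k hk => (h ω k hk).symm, hU _ _ (h ω)⟩

theorem measurableSet_of_prefixAt {n : ℕ} {U : Set (ℕ → ∀ j, 𝒴 j)} [Nonempty (∀ j, 𝒴 j)]
    (hU : ∀ ω ω', (∀ k < n, ω k = ω' k) → ω ∈ U → ω' ∈ U) : MeasurableSet U := by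
  rw [eq_preimage_prefixAt hU]
  exact measurable_prefixAt n MeasurableSet.of_discrete

/-- Conditionally on an event of the first `n` outputs that determines the next inputs, the next
outputs have the law of the channel. -/
theorem outputLaw_inter_blockAt_le [Nonempty (∀ j, 𝒴 j)] (c : VLFTCode 𝒳 𝒴 M)
    (ch : BroadcastChannel 𝒳 𝒴) (w : Fin M) {n m : ℕ} {U : Set (ℕ → ∀ j, 𝒴 j)}
    (hU : ∀ ω ω', (∀ k < n, ω k = ω' k) → ω ∈ U → ω' ∈ U) (S : Set (Fin m → ∀ j, 𝒴 j))
    (x : Fin m → 𝒳)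
    (hx : ∀ ω ∈ U, ∀ i : Fin m, c.encoder (n + i) w (prefixAt (n + i) ω) = x i) {q : ℝ}
    (hq : ch.blockProb x S ≤ q) :
    (c.outputLaw ch w).real {ω | ω ∈ U ∧ blockAt n m ω ∈ S} ≤ q * (c.outputLaw ch w).real U := by
  have hUeq := eq_preimage_prefixAt hU
  have h := c.outputLaw_block_le ch w {z : Fin n → ∀ j, 𝒴 j | extendWord z ∈ U} (fun _ => S)
    (fun _ => x) (fun ω hω i => hx ω (by rw [hUeq]; exact hω) i) (fun _ _ => hq)
  rw [← hUeq] at h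
  refine le_trans (le_of_eq ?_) h
  congr 1
  ext ω
  exact and_congr_left fun _ => Set.ext_iff.1 hUeq ω

theorem law_le_of_outputLaw_le (c : VLFTCode 𝒳 𝒴 M) (ch : BroadcastChannel 𝒳 𝒴) (hM : M ≠ 0)
    {U : Fin M → Set (ℕ → ∀ j, 𝒴 j)} (hU : ∀ w, MeasurableSet (U w)) {q : ℝ} 
    (h : ∀ w, (c.outputLaw ch w).real (U w) ≤ q) :
    c.law ch {ω | ω.2 ∈ U ω.1} ≤ ENNReal.ofReal q := by
  have hm : MeasurableSet {ω : Outcome 𝒴 M | ω.2 ∈ U ω.1} := by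
    have : {ω : Outcome 𝒴 M | ω.2 ∈ U ω.1} = ⋃ w, {w} ×ˢ U w := by
      ext ω; simp
    rw [this]
    exact MeasurableSet.iUnion fun w => (measurableSet_singleton w).prod (hU w)
  rw [law_apply c ch hm]
  calc _ ≤ ∑ _w : Fin M, (M : ℝ≥0∞)⁻¹ * ENNReal.ofReal q := by
        refine Finset.sum_le_sum fun w _ => mul_le_mul_right ?_ _
        change c.outputLaw ch w (U w) ≤ _
        rw [← ENNReal.ofReal_toReal (measure_ne_top (c.outputLaw ch w) (U w))]
        exact ENNReal.ofReal_le_ofReal (h w)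
    _ = ENNReal.ofReal q := by
        rw [Finset.sum_const, Finset.card_univ, Fintype.card_fin, nsmul_eq_mul, ← mul_assoc,
          ENNReal.mul_inv_cancel (Nat.cast_ne_zero.2 hM) (ENNReal.natCast_ne_top M), one_mul]

end VLFTCode

/-! ### Repeated rounds with confirmation. -/

/-- One round of a repeated transmission: a block code, followed by the repetition of one of two
inputs that confirms or denies that all receivers decoded correctly, and the sets of words on which
the receivers accept. -/
structure RoundScheme {K : ℕ} (𝒳 : Type u) (𝒴 : Fin K → Type v) (M : ℕ) where
  /-- The length of the block code. -/
  messageLength : ℕ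
  /-- The length of the confirmation. -/
  confirmLength : ℕ
  messageLength_pos : 0 < messageLength
  /-- The codewords. -/
  codeword : Fin M → Fin messageLength → 𝒳
  /-- The decoders of the block code. -/
  decode : ∀ j, (Fin messageLength → 𝒴 j) → Fin M
  /-- The words on which a receiver accepts its estimate. -/
  accept : ∀ j, Set (Fin confirmLength → 𝒴 j)
  /-- The input that confirms. -/
  ack : 𝒳
  /-- The input that denies. -/
  nack : 𝒳

namespace RoundScheme

open Outcome Classical

variable {K : ℕ} {𝒳 : Type u} {𝒴 : Fin K → Type v} {M : ℕ} (s : RoundScheme 𝒳 𝒴 M)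

/-- The length of a round. -/
def length : ℕ := s.messageLength + s.confirmLength

theorem length_pos : 0 < s.length := Nat.add_pos_left s.messageLength_pos _

/-- The estimate of receiver `j` after the block code of round `r`. -/
def tentative (j : Fin K) (r : ℕ) (η : ℕ → 𝒴 j) : Fin M :=
  s.decode j fun i => η (s.length * r + i)

/-- Receiver `j` accepts its estimate in round `r`. -/
def Accepts (j : Fin K) (r : ℕ) (η : ℕ → 𝒴 j) : Prop :=
  (fun i : Fin s.confirmLength => η (s.length * r + s.messageLength + i)) ∈ s.accept j

/-- The input after `n` outputs. -/
noncomputable def input (w : Fin M) (ω : ℕ → ∀ j, 𝒴 j) (n : ℕ) : 𝒳 :=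
  if h : n % s.length < s.messageLength then s.codeword w ⟨n % s.length, h⟩
  else if ∀ j, s.tentative j (n / s.length) (fun k => ω k j) = w then s.ack else s.nack

theorem tentative_congr {j : Fin K} {r n : ℕ} {η η' : ℕ → 𝒴 j}
    (hn : s.length * r + s.messageLength ≤ n) (h : ∀ k < n, η k = η' k) :
    s.tentative j r η = s.tentative j r η' := by
  unfold tentative
  congr 1
  funext i
  exact h _ (by have := i.2; omega)

theorem accepts_congr {j : Fin K} {r n : ℕ} {η η' : ℕ → 𝒴 j}
    (hn : s.length * (r + 1) ≤ n) (h : ∀ k < n, η k = η' k) :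
    s.Accepts j r η ↔ s.Accepts j r η' := by
  unfold Accepts
  have : (fun i : Fin s.confirmLength => η (s.length * r + s.messageLength + i)) =
      fun i : Fin s.confirmLength => η' (s.length * r + s.messageLength + i) := by
    funext i
    refine h _ ?_
    have := i.2
    rw [mul_add, mul_one] at hn
    have : s.length = s.messageLength + s.confirmLength := rfl
    omega
  rw [this]

/-- Causality: a confirmation input depends only on the block code of the current round, which is
complete by then. -/
theorem input_congr {w : Fin M} {ω ω' : ℕ → ∀ j, 𝒴 j} {n : ℕ} (h : ∀ k < n, ω k = ω' k) :
    s.input w ω n = s.input w ω' n := by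
  unfold input
  by_cases h1 : n % s.length < s.messageLength
  · rw [dif_pos h1, dif_pos h1]
  · have hn : s.length * (n / s.length) + s.messageLength ≤ n := by
      have := Nat.div_add_mod n s.length
      omega
    have : ∀ j, s.tentative j (n / s.length) (fun k => ω k j) =
        s.tentative j (n / s.length) (fun k => ω' k j) := fun j =>
      s.tentative_congr hn fun k hk => congrFun (h k hk) j
    rw [dif_neg h1, dif_neg h1]
    simp only [this]

theorem input_message (w : Fin M) (ω : ℕ → ∀ j, 𝒴 j) (r : ℕ) (i : Fin s.messageLength) :
    s.input w ω (s.length * r + i) = s.codeword w i := by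
  have h : (s.length * r + i) % s.length = i := by
    have hlt : (i : ℕ) < s.length := lt_of_lt_of_le i.2 (Nat.le_add_right _ _)
    rw [Nat.mul_add_mod, Nat.mod_eq_of_lt hlt]
  unfold input
  simp only [h, i.2, dif_pos]

theorem input_confirm (w : Fin M) (ω : ℕ → ∀ j, 𝒴 j) (r : ℕ) (i : Fin s.confirmLength) :
    s.input w ω (s.length * r + s.messageLength + i) =
      if ∀ j, s.tentative j r (fun k => ω k j) = w then s.ack else s.nack := by
  have hlt : s.messageLength + i < s.length := Nat.add_lt_add_left i.2 _
  have h : (s.length * r + s.messageLength + i) % s.length = s.messageLength + i := by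
    rw [add_assoc, Nat.mul_add_mod, Nat.mod_eq_of_lt hlt]
  have h2 : (s.length * r + s.messageLength + i) / s.length = r := by
    rw [add_assoc, Nat.mul_add_div s.length_pos, Nat.div_eq_of_lt hlt, add_zero]
  unfold input
  simp only [h, h2]
  rw [dif_neg (by omega)]

/-- The first time at which receiver `j` has accepted its estimate. -/
noncomputable def haltTime (j : Fin K) (η : ℕ → 𝒴 j) : ℕ∞ :=
  if h : ∃ r, s.Accepts j r η then ((s.length * (Nat.find h + 1) : ℕ) : ℕ∞) else ⊤

theorem stop_le_iff {j : Fin K} {η : ℕ → 𝒴 j} {n : ℕ} :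
    s.haltTime j η ≤ n ↔ ∃ r, s.length * (r + 1) ≤ n ∧ s.Accepts j r η := by
  unfold haltTime
  split_ifs with h
  · rw [Nat.cast_le]
    constructor
    · exact fun hn => ⟨_, hn, Nat.find_spec h⟩
    · rintro ⟨r, hr, ha⟩
      exact (Nat.mul_le_mul_left _ (Nat.succ_le_succ (Nat.find_min' h ha))).trans hr
  · refine ⟨fun hn => absurd (top_le_iff.1 hn) (ENat.natCast_ne_top n), ?_⟩
    rintro ⟨r, -, ha⟩
    exact absurd ⟨r, ha⟩ h

/-- Receiver `j` has not accepted before round `r`. -/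
def pending (j : Fin K) (r : ℕ) : Set (ℕ → ∀ j, 𝒴 j) :=
  {ω | ∀ r' < r, ¬ s.Accepts j r' fun k => ω k j}

/-- Some receiver fails to decode the message `w` in round `r`. -/
def failed (w : Fin M) (r : ℕ) : Set (ℕ → ∀ j, 𝒴 j) :=
  {ω | ¬ ∀ j, s.tentative j r (fun k => ω k j) = w}

/-- Receiver `j` accepts first in round `r`, in which some receiver fails to decode `w`. -/
def wrong (j : Fin K) (r : ℕ) (w : Fin M) : Set (ℕ → ∀ j, 𝒴 j) :=
  {ω | (ω ∈ s.pending j r ∧ ω ∈ s.failed w r) ∧ s.Accepts j r fun k => ω k j}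

theorem pending_congr {j : Fin K} {r n : ℕ} (hn : s.length * r ≤ n) (ω ω' : ℕ → ∀ j, 𝒴 j)
    (h : ∀ k < n, ω k = ω' k) (hω : ω ∈ s.pending j r) : ω' ∈ s.pending j r := by
  intro r' hr' ha
  refine hω r' hr' ((s.accepts_congr (n := n) ?_ fun k hk => congrFun (h k hk) j).2 ha)
  exact (Nat.mul_le_mul_left _ hr').trans hn

theorem failed_congr {w : Fin M} {r n : ℕ} (hn : s.length * r + s.messageLength ≤ n)
    (ω ω' : ℕ → ∀ j, 𝒴 j) (h : ∀ k < n, ω k = ω' k) : ω ∈ s.failed w r ↔ ω' ∈ s.failed w r := by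
  refine not_congr (forall_congr' fun j => ?_)
  rw [s.tentative_congr hn fun k hk => congrFun (h k hk) j]

theorem wrong_congr {j : Fin K} {r : ℕ} {w : Fin M} (ω ω' : ℕ → ∀ j, 𝒴 j)
    (h : ∀ k < s.length * (r + 1), ω k = ω' k) (hω : ω ∈ s.wrong j r w) : ω' ∈ s.wrong j r w := by
  have hle : s.length * r + s.messageLength ≤ s.length * (r + 1) := by
    rw [mul_add, mul_one]
    exact Nat.add_le_add_left (Nat.le_add_right _ _) _
  exact ⟨⟨s.pending_congr (by omega) ω ω' h hω.1.1, (s.failed_congr hle ω ω' h).1 hω.1.2⟩,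
    (s.accepts_congr le_rfl fun k hk => congrFun (h k hk) j).1 hω.2⟩

variable [∀ j, MeasurableSpace (𝒴 j)] [∀ j, Fintype (𝒴 j)] [∀ j, DiscreteMeasurableSpace (𝒴 j)]
  [∀ j, Nonempty (𝒴 j)]

/-- The code that repeats rounds until all receivers have accepted. -/
noncomputable def code : VLFTCode 𝒳 𝒴 M where
  encoder n w y := s.input w (extendWord y) n
  -- A receiver stops only at the end of a round, so its last block code begins at `n - s.length`.
  decoder j n y := s.decode j fun i => extendWord y (n - s.length + i)
  stopTime j ω := s.haltTime j fun k => ω.2 k j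
  isStoppingTime j n := by
    refine ⟨{y | ∃ r, s.length * (r + 1) ≤ n ∧ s.Accepts j r (extendWord y)},
      MeasurableSet.of_discrete, ?_⟩
    ext ω
    refine Iff.trans ?_ s.stop_le_iff.symm
    refine exists_congr fun r => and_congr_right fun hr => s.accepts_congr hr fun k hk => ?_
    rw [extendWord_of_lt _ hk]
    rfl

theorem code_encoder (w : Fin M) (n : ℕ) (ω : ℕ → ∀ j, 𝒴 j) :
    s.code.encoder n w (prefixAt n ω) = s.input w ω n :=
  s.input_congr fun _ hk => extendWord_of_lt _ hk

theorem code_decoder (j : Fin K) (r : ℕ) (ω : Outcome 𝒴 M) :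
    s.code.decoder j (s.length * (r + 1)) (ω.pastAt j (s.length * (r + 1))) =
      s.tentative j r fun k => ω.2 k j := by
  change s.decode j _ = s.decode j _
  congr 1
  funext i
  have h : s.length * (r + 1) - s.length = s.length * r := by rw [mul_add, mul_one, Nat.add_sub_cancel]
  rw [h, extendWord_of_lt]
  · rfl
  · rw [mul_add, mul_one]
    exact Nat.add_lt_add_left (lt_of_lt_of_le i.2 (Nat.le_add_right _ _)) _

variable {s} {ch : BroadcastChannel 𝒳 𝒴} {q₁ q₂ ρ : ℝ}

/-- Codewords ignore the feedback, so the past rounds do not affect the error bound `q₁`. -/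
theorem outputLaw_pending_failed_le
    (h₁ : ∀ w, ch.blockProb (s.codeword w) {y | ∃ j, s.decode j (fun i => y i j) ≠ w} ≤ q₁)
    (w : Fin M) (j : Fin K) (r : ℕ) :
    (s.code.outputLaw ch w).real {ω | ω ∈ s.pending j r ∧ ω ∈ s.failed w r} ≤
      q₁ * (s.code.outputLaw ch w).real (s.pending j r) := by
  refine le_trans (le_of_eq ?_) (s.code.outputLaw_inter_blockAt_le ch w (n := s.length * r)
    (s.pending_congr le_rfl) {y | ∃ j, s.decode j (fun i => y i j) ≠ w} (s.codeword w)
    (fun ω _ i => ?_) (h₁ w))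
  · congr 1
    ext ω
    refine and_congr_right fun _ => ?_
    exact not_forall
  · rw [code_encoder, input_message]

/-- After a failure the confirmation phase repeats `nack`, whatever else happened, so the bound `q₂`
holds conditionally. -/
theorem outputLaw_wrong_le
    (h₂ : ∀ j, ch.blockProb (fun _ => s.nack) {y | (fun i => y i j) ∈ s.accept j} ≤ q₂)
    (w : Fin M) (j : Fin K) (r : ℕ) :
    (s.code.outputLaw ch w).real (s.wrong j r w) ≤
      q₂ * (s.code.outputLaw ch w).real {ω | ω ∈ s.pending j r ∧ ω ∈ s.failed w r} := by
  refine s.code.outputLaw_inter_blockAt_le ch w (n := s.length * r + s.messageLength)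
    (U := {ω | ω ∈ s.pending j r ∧ ω ∈ s.failed w r}) (fun ω ω' h hω =>
      ⟨s.pending_congr (Nat.le_add_right _ _) ω ω' h hω.1, (s.failed_congr le_rfl ω ω' h).1 hω.2⟩)
    {y | (fun i => y i j) ∈ s.accept j} (fun _ => s.nack) (fun ω hω i => ?_) (h₂ j)
  rw [code_encoder, input_confirm, if_neg hω.2]

/-- Receiver `j` survives a round only if some receiver fails to decode or `j` misses the
confirmation; given the past, this has probability at most `q₁ + ρ`. -/
theorem outputLaw_pending_le
    (h₁ : ∀ w, ch.blockProb (s.codeword w) {y | ∃ j, s.decode j (fun i => y i j) ≠ w} ≤ q₁)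
    (hρ : ∀ j, ch.blockProb (fun _ => s.ack) {y | (fun i => y i j) ∉ s.accept j} ≤ ρ)
    (hq₁ : 0 ≤ q₁) (hρ0 : 0 ≤ ρ) (w : Fin M) (j : Fin K) (r : ℕ) :
    (s.code.outputLaw ch w).real (s.pending j r) ≤ (q₁ + ρ) ^ r := by
  induction r with
  | zero => simp
  | succ r ih =>
    have h1 := outputLaw_pending_failed_le h₁ w j r
    have h2 := s.code.outputLaw_inter_blockAt_le ch w (n := s.length * r + s.messageLength)
      (U := {ω | ω ∈ s.pending j r ∧ ω ∉ s.failed w r}) (fun ω ω' h hω =>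
        ⟨s.pending_congr (Nat.le_add_right _ _) ω ω' h hω.1,
          fun h' => hω.2 ((s.failed_congr le_rfl ω ω' h).2 h')⟩)
      {y | (fun i => y i j) ∉ s.accept j} (fun _ => s.ack) (fun ω hω i => by
        rw [code_encoder, input_confirm, if_pos (not_not.1 hω.2)]) (hρ j)
    have h3 : (s.code.outputLaw ch w).real {ω | ω ∈ s.pending j r ∧ ω ∉ s.failed w r} ≤
        (s.code.outputLaw ch w).real (s.pending j r) := measureReal_mono fun ω h => h.1
    have h4 : s.pending j (r + 1) ⊆ {ω | ω ∈ s.pending j r ∧ ω ∈ s.failed w r} ∪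
        {ω | ω ∈ {ω | ω ∈ s.pending j r ∧ ω ∉ s.failed w r} ∧
          blockAt (s.length * r + s.messageLength) s.confirmLength ω ∈
            {y | (fun i => y i j) ∉ s.accept j}} := by
      intro ω hω
      have hp : ω ∈ s.pending j r := fun r' hr' => hω r' (by omega)
      by_cases hf : ω ∈ s.failed w r
      · exact Or.inl ⟨hp, hf⟩
      · exact Or.inr ⟨⟨hp, hf⟩, hω r (by omega)⟩
    calc _ ≤ _ := measureReal_mono h4
      _ ≤ _ := measureReal_union_le _ _
      _ ≤ q₁ * (s.code.outputLaw ch w).real (s.pending j r) +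
          ρ * (s.code.outputLaw ch w).real (s.pending j r) :=
        add_le_add h1 (h2.trans (mul_le_mul_of_nonneg_left h3 hρ0))
      _ = (q₁ + ρ) * (s.code.outputLaw ch w).real (s.pending j r) := by ring
      _ ≤ (q₁ + ρ) * (q₁ + ρ) ^ r := mul_le_mul_of_nonneg_left ih (by positivity)
      _ = (q₁ + ρ) ^ (r + 1) := by ring

theorem law_pending_le (hM : M ≠ 0)
    (h₁ : ∀ w, ch.blockProb (s.codeword w) {y | ∃ j, s.decode j (fun i => y i j) ≠ w} ≤ q₁)
    (hρ : ∀ j, ch.blockProb (fun _ => s.ack) {y | (fun i => y i j) ∉ s.accept j} ≤ ρ)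
    (hq₁ : 0 ≤ q₁) (hρ0 : 0 ≤ ρ) (j : Fin K) (r : ℕ) :
    s.code.law ch {ω | ω.2 ∈ s.pending j r} ≤ ENNReal.ofReal (q₁ + ρ) ^ r := by
  rw [← ENNReal.ofReal_pow (by positivity)]
  exact s.code.law_le_of_outputLaw_le ch hM (U := fun _ => s.pending j r)
    (fun _ => VLFTCode.measurableSet_of_prefixAt (s.pending_congr le_rfl))
    (fun w => outputLaw_pending_le h₁ hρ hq₁ hρ0 w j r)

/-- A receiver errs by never accepting, which has probability zero, or by first accepting in a round
where it decoded wrongly and `nack` was sent. Round `r` contributes at most `q₂ * q₁ * (q₁ + ρ) ^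
r`; the geometric series costs the factor `2` and the union over receivers the factor `K`. -/
theorem code_errorProb_le (hM : M ≠ 0)
    (h₁ : ∀ w, ch.blockProb (s.codeword w) {y | ∃ j, s.decode j (fun i => y i j) ≠ w} ≤ q₁)
    (h₂ : ∀ j, ch.blockProb (fun _ => s.nack) {y | (fun i => y i j) ∈ s.accept j} ≤ q₂)
    (hρ : ∀ j, ch.blockProb (fun _ => s.ack) {y | (fun i => y i j) ∉ s.accept j} ≤ ρ)
    (hq₁ : 0 ≤ q₁) (hq₂ : 0 ≤ q₂) (hρ0 : 0 ≤ ρ) (hη : q₁ + ρ ≤ 1 / 2) :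
    s.code.errorProb ch ≤ ENNReal.ofReal (2 * K * (q₂ * q₁)) := by
  have hη0 : 0 ≤ q₁ + ρ := by positivity
  have hsub : s.code.errorEvent ⊆ ⋃ j, ((⋂ r, {ω | ω.2 ∈ s.pending j r}) ∪
      ⋃ r, {ω : Outcome 𝒴 M | ω.2 ∈ s.wrong j r ω.1}) := by
    rintro ω ⟨j, hj⟩
    refine Set.mem_iUnion.2 ⟨j, ?_⟩
    by_cases h : ∃ r, s.Accepts j r fun k => ω.2 k j
    · refine Or.inr (Set.mem_iUnion.2 ⟨Nat.find h, ⟨⟨fun r' hr' => Nat.find_min h hr', fun hall => ?_⟩,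
        Nat.find_spec h⟩⟩)
      refine hj ⟨s.length * (Nat.find h + 1), dif_pos h, ?_⟩
      rw [code_decoder]
      exact hall j
    · push Not at h
      exact Or.inl (Set.mem_iInter.2 fun r r' _ => h r')
  have hnever : ∀ j, s.code.law ch (⋂ r, {ω | ω.2 ∈ s.pending j r}) = 0 := by
    intro j
    refine le_antisymm (ge_of_tendsto' (ENNReal.tendsto_pow_atTop_nhds_zero_of_lt_one
      (ENNReal.ofReal_lt_one.2 (by linarith : q₁ + ρ < 1))) fun r => ?_) zero_le
    exact (measure_mono (Set.iInter_subset _ r)).trans (law_pending_le hM h₁ hρ hq₁ hρ0 j r)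
  have hwrong : ∀ j r, s.code.law ch {ω : Outcome 𝒴 M | ω.2 ∈ s.wrong j r ω.1} ≤
      ENNReal.ofReal (q₂ * q₁ * (q₁ + ρ) ^ r) := by
    intro j r
    refine s.code.law_le_of_outputLaw_le ch hM (U := fun w => s.wrong j r w)
      (fun w => VLFTCode.measurableSet_of_prefixAt s.wrong_congr) (fun w => ?_)
    refine (outputLaw_wrong_le h₂ w j r).trans ?_
    rw [mul_assoc]
    refine mul_le_mul_of_nonneg_left ((outputLaw_pending_failed_le h₁ w j r).trans ?_) hq₂
    exact mul_le_mul_of_nonneg_left (outputLaw_pending_le h₁ hρ hq₁ hρ0 w j r) hq₁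
  calc s.code.errorProb ch ≤ s.code.law ch (⋃ j, ((⋂ r, {ω | ω.2 ∈ s.pending j r}) ∪
      ⋃ r, {ω : Outcome 𝒴 M | ω.2 ∈ s.wrong j r ω.1})) := measure_mono hsub
    _ ≤ ∑ j, s.code.law ch ((⋂ r, {ω | ω.2 ∈ s.pending j r}) ∪
      ⋃ r, {ω : Outcome 𝒴 M | ω.2 ∈ s.wrong j r ω.1}) := by
        rw [← tsum_fintype (L := .unconditional _)]; exact measure_iUnion_le _
    _ ≤ ∑ _j : Fin K, ENNReal.ofReal (2 * (q₂ * q₁)) := by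
        refine Finset.sum_le_sum fun j _ => ?_
        refine (measure_union_le _ _).trans ?_
        rw [hnever, zero_add]
        refine (measure_iUnion_le _).trans ((ENNReal.tsum_le_tsum fun r => hwrong j r).trans ?_)
        have hs : Summable fun r : ℕ => q₂ * q₁ * (q₁ + ρ) ^ r :=
          (summable_geometric_of_lt_one hη0 (by linarith)).mul_left _
        rw [← ENNReal.ofReal_tsum_of_nonneg (fun r => by positivity) hs, tsum_mul_left,
          tsum_geometric_of_lt_one hη0 (by linarith)]
        refine ENNReal.ofReal_le_ofReal ?_
        rw [mul_comm 2]
        refine mul_le_mul_of_nonneg_left ?_ (by positivity)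
        rw [inv_le_comm₀ (by linarith) two_pos]
        linarith
    _ = ENNReal.ofReal (2 * K * (q₂ * q₁)) := by
        rw [Finset.sum_const, Finset.card_univ, Fintype.card_fin, nsmul_eq_mul,
          ← ENNReal.ofReal_natCast, ← ENNReal.ofReal_mul (Nat.cast_nonneg K)]
        congr 1; ring

/-- The maximum over receivers is bounded by a sum only for the rounds after the first. The factor
`K` then multiplies rare events alone, and the mean duration stays asymptotic to one round. -/
theorem stopMax_code_le (ω : Outcome 𝒴 M) :
    (s.code.stopMax ω : ℝ≥0∞) ≤ s.length + ∑' r : ℕ, ∑ j,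
      {ω : Outcome 𝒴 M | ω.2 ∈ s.pending j (r + 1)}.indicator (fun _ => (s.length : ℝ≥0∞)) ω := by
  rw [VLFTCode.stopMax, ENat.toENNReal_iSup]
  refine iSup_le fun j => ?_
  have hj : ∑' r : ℕ, {ω : Outcome 𝒴 M | ω.2 ∈ s.pending j (r + 1)}.indicator
      (fun _ => (s.length : ℝ≥0∞)) ω ≤ ∑' r : ℕ, ∑ j, {ω : Outcome 𝒴 M | ω.2 ∈ s.pending j (r + 1)}.indicator
        (fun _ => (s.length : ℝ≥0∞)) ω :=
    ENNReal.tsum_le_tsum fun r => Finset.single_le_sum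
      (f := fun j => {ω : Outcome 𝒴 M | ω.2 ∈ s.pending j (r + 1)}.indicator
        (fun _ => (s.length : ℝ≥0∞)) ω) (fun _ _ => zero_le) (Finset.mem_univ j)
  refine le_trans ?_ (add_le_add_right hj _)
  by_cases h : ∃ r, s.Accepts j r fun k => ω.2 k j
  · have hτ : s.code.stopTime j ω = ((s.length * (Nat.find h + 1) : ℕ) : ℕ∞) := dif_pos h
    rw [hτ]
    have hsum := ENNReal.sum_le_tsum (f := fun r : ℕ =>
      {ω : Outcome 𝒴 M | ω.2 ∈ s.pending j (r + 1)}.indicator (fun _ => (s.length : ℝ≥0∞)) ω)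
      (Finset.range (Nat.find h))
    refine le_trans (le_of_eq ?_) (add_le_add_right hsum _)
    have hind : ∀ r ∈ Finset.range (Nat.find h), {ω : Outcome 𝒴 M | ω.2 ∈ s.pending j (r + 1)}.indicator
        (fun _ => (s.length : ℝ≥0∞)) ω = s.length := fun r hr => by
      refine Set.indicator_of_mem (s := {ω : Outcome 𝒴 M | ω.2 ∈ s.pending j (r + 1)})
        (fun r' hr' => ?_) _
      have := Finset.mem_range.1 hr
      exact Nat.find_min h (by omega)
    rw [Finset.sum_congr rfl hind, Finset.sum_const, Finset.card_range, nsmul_eq_mul]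
    push_cast
    ring
  · push Not at h
    have hpend : ∀ r, {ω : Outcome 𝒴 M | ω.2 ∈ s.pending j (r + 1)}.indicator
        (fun _ => (s.length : ℝ≥0∞)) ω = s.length := fun r =>
      Set.indicator_of_mem (s := {ω : Outcome 𝒴 M | ω.2 ∈ s.pending j (r + 1)})
        (fun r' _ => h r') _
    simp only [hpend]
    rw [ENNReal.tsum_const_eq_top_of_ne_zero (by exact_mod_cast s.length_pos.ne')]
    simp

theorem code_expectedStop_le (hM : M ≠ 0)
    (h₁ : ∀ w, ch.blockProb (s.codeword w) {y | ∃ j, s.decode j (fun i => y i j) ≠ w} ≤ q₁)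
    (hρ : ∀ j, ch.blockProb (fun _ => s.ack) {y | (fun i => y i j) ∉ s.accept j} ≤ ρ)
    (hq₁ : 0 ≤ q₁) (hρ0 : 0 ≤ ρ) (hη : q₁ + ρ ≤ 1 / 2) :
    s.code.expectedStop ch ≤ ENNReal.ofReal (s.length * (1 + 2 * K * (q₁ + ρ))) := by
  have hη0 : 0 ≤ q₁ + ρ := by positivity
  have := s.code.isProbabilityMeasure_law ch hM
  have hmeas : ∀ j r, MeasurableSet {ω : Outcome 𝒴 M | ω.2 ∈ s.pending j r} := fun j r =>
    measurable_snd (VLFTCode.measurableSet_of_prefixAt (s.pending_congr (j := j) (r := r) le_rfl))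
  have hmeas' : ∀ j r, Measurable ({ω : Outcome 𝒴 M | ω.2 ∈ s.pending j r}.indicator
      fun _ => (s.length : ℝ≥0∞)) := fun j r => measurable_const.indicator (hmeas j r)
  calc s.code.expectedStop ch ≤ ∫⁻ ω, (s.length + ∑' r : ℕ, ∑ j,
      {ω : Outcome 𝒴 M | ω.2 ∈ s.pending j (r + 1)}.indicator (fun _ => (s.length : ℝ≥0∞)) ω)
        ∂(s.code.law ch) := lintegral_mono fun ω => stopMax_code_le ω
    _ = s.length + ∑' r : ℕ, ∑ j, s.length * s.code.law ch {ω | ω.2 ∈ s.pending j (r + 1)} := by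
      rw [lintegral_add_left measurable_const, lintegral_const, measure_univ, mul_one,
        lintegral_tsum fun r => (Finset.measurable_fun_sum _ fun j _ => hmeas' j (r + 1)).aemeasurable]
      congr 1
      refine tsum_congr fun r => ?_
      rw [lintegral_finsetSum _ fun j _ => hmeas' j (r + 1)]
      exact Finset.sum_congr rfl fun j _ => lintegral_indicator_const (hmeas j (r + 1)) _
    _ ≤ s.length + ∑' r : ℕ, ENNReal.ofReal (s.length * K * (q₁ + ρ) * (q₁ + ρ) ^ r) := by
      gcongr with r
      calc _ ≤ ∑ _j : Fin K, (s.length : ℝ≥0∞) * ENNReal.ofReal (q₁ + ρ) ^ (r + 1) := by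
            gcongr with j
            exact law_pending_le hM h₁ hρ hq₁ hρ0 j (r + 1)
        _ = _ := by
          rw [Finset.sum_const, Finset.card_univ, Fintype.card_fin, nsmul_eq_mul,
            ← ENNReal.ofReal_pow hη0, ← ENNReal.ofReal_natCast, ← ENNReal.ofReal_natCast,
            ← ENNReal.ofReal_mul (by positivity), ← ENNReal.ofReal_mul (by positivity)]
          congr 1; ring
    _ ≤ ENNReal.ofReal (s.length * (1 + 2 * K * (q₁ + ρ))) := by
      have hs : Summable fun r : ℕ => s.length * K * (q₁ + ρ) * (q₁ + ρ) ^ r :=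
        (summable_geometric_of_lt_one hη0 (by linarith)).mul_left _
      rw [← ENNReal.ofReal_tsum_of_nonneg (fun r => by positivity) hs, tsum_mul_left,
        tsum_geometric_of_lt_one hη0 (by linarith), ← ENNReal.ofReal_natCast,
        ← ENNReal.ofReal_add (by positivity) (mul_nonneg (by positivity)
          (inv_nonneg.2 (by linarith)))]
      refine ENNReal.ofReal_le_ofReal ?_
      have h1 : (1 - (q₁ + ρ))⁻¹ ≤ 2 := by
        rw [inv_le_comm₀ (by linarith) two_pos]
        linarith
      have h2 := mul_le_mul_of_nonneg_left h1 (by positivity : 0 ≤ s.length * K * (q₁ + ρ))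
      linarith

end RoundScheme

/-! ### The lower bound on the reliability function. -/

theorem ofReal_exp_le_neg_log_div {P : ℝ≥0∞} {E N : ℝ} (hN : 0 < N)
    (h : P ≤ ENNReal.ofReal (Real.exp (-(E * N)))) :
    (E : EReal) ≤ -ENNReal.log P / (N : EReal) := by
  have h1 := ENNReal.log_monotone h
  rw [ENNReal.log_ofReal_of_pos (Real.exp_pos _), Real.log_exp] at h1
  rw [EReal.le_div_iff_mul_le (by exact_mod_cast hN) (EReal.coe_ne_top _)]
  have h2 := EReal.neg_le_neg_iff.2 h1
  rw [EReal.coe_neg, neg_neg] at h2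
  exact_mod_cast h2

namespace VLFTCode

variable {K : ℕ} {𝒳 : Type u} {𝒴 : Fin K → Type v} [∀ j, MeasurableSpace (𝒴 j)]

/-- The code that stops at once. -/
def trivialCode (x : 𝒳) : VLFTCode 𝒳 𝒴 2 where
  encoder _ _ _ := x
  decoder _ _ _ := 0
  stopTime _ _ := 0
  isStoppingTime _ n := by simp

variable [∀ j, Fintype (𝒴 j)] [∀ j, DiscreteMeasurableSpace (𝒴 j)]

theorem expectedStop_trivialCode (ch : BroadcastChannel 𝒳 𝒴) (x : 𝒳) :
    (trivialCode x : VLFTCode 𝒳 𝒴 2).expectedStop ch = 0 := by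
  simp [expectedStop, stopMax, trivialCode]

end VLFTCode

namespace BroadcastChannel

variable {K : ℕ} {𝒳 : Type u} {𝒴 : Fin K → Type v} [∀ j, Fintype (𝒴 j)]

theorem blockProb_le_one (ch : BroadcastChannel 𝒳 𝒴) {n : ℕ} (x : Fin n → 𝒳)
    (S : Set (Fin n → ∀ j, 𝒴 j)) : ch.blockProb x S ≤ 1 := by
  refine (ch.blockProb_mono x (Set.subset_univ S)).trans (le_of_eq ?_)
  simp only [blockProb, Set.indicator_univ, wordProb]
  rw [sum_prod_eq_prod_sum fun i t => (ch (x i) t).toReal]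
  simp [PMF.sum_toReal]

/-- The cap `1` keeps the false acceptance bound useful for negative `γ₂`, which is the case when
only the exponent `0` is wanted. -/
theorem exists_roundScheme [∀ j, MeasurableSpace (𝒴 j)] [∀ j, DiscreteMeasurableSpace (𝒴 j)]
    [Fintype 𝒳] {ch : BroadcastChannel 𝒳 𝒴} (hB : ch.Bmax < ∞) (p : PMF 𝒳)
    {γ₁ γ₂ : ℝ} (hγ₁ : ∀ j, γ₁ < ch.mutualInfo p j) (x x' : 𝒳)
    (hγ₂ : ∀ j, γ₂ < (ch.relEntropy j x x').toReal) :
    ∃ ρ₁ ρ₂ : ℝ, (0 ≤ ρ₁ ∧ ρ₁ < 1) ∧ (0 ≤ ρ₂ ∧ ρ₂ < 1) ∧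
      ∀ n₁ n₂ M : ℕ, 0 < n₁ → 0 < M → ∃ s : RoundScheme 𝒳 𝒴 M, s.length = n₁ + n₂ ∧
        (∀ w, ch.blockProb (s.codeword w) {y | ∃ j, s.decode j (fun i => y i j) ≠ w} ≤
          K * (ρ₁ ^ n₁ + M * Real.exp (-(n₁ * γ₁)))) ∧
        (∀ j, ch.blockProb (fun _ => s.nack) {y | (fun i => y i j) ∈ s.accept j} ≤
          min 1 (Real.exp (-(n₂ * γ₂)))) ∧
        ∀ j, ch.blockProb (fun _ => s.ack) {y | (fun i => y i j) ∉ s.accept j} ≤ ρ₂ ^ n₂ := by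
  obtain ⟨ρ₁, h10, h11, h1⟩ := ch.exists_codebook p hγ₁
  obtain ⟨ρ₂, h20, h21, h2⟩ := exists_ackTest hB x x' hγ₂
  refine ⟨ρ₁, ρ₂, ⟨h10, h11⟩, ⟨h20, h21⟩, fun n₁ n₂ M hn₁ hM => ?_⟩
  obtain ⟨cw, dec, hcw⟩ := h1 n₁ M hM
  obtain ⟨A, hA⟩ := h2 n₂
  exact ⟨⟨n₁, n₂, hn₁, cw, dec, A, x, x'⟩, rfl, hcw,
    fun j => le_min (ch.blockProb_le_one _ _) (hA j).2, fun j => (hA j).1⟩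

/-- The number of messages sent in time `N` at rate `R`. -/
noncomputable def messageCount (R N : ℝ) : ℕ := ⌈Real.exp (R * N)⌉₊ + 1

theorem exp_le_messageCount (R N : ℝ) : Real.exp (R * N) ≤ messageCount R N := by
  rw [messageCount, Nat.cast_add, Nat.cast_one]
  linarith [Nat.le_ceil (Real.exp (R * N))]

theorem tendsto_messageCount_mul_exp {R a γ : ℝ} (hR : 0 ≤ R) (hγ : 0 < γ) (h : R < a * γ) :
    Tendsto (fun N : ℝ => messageCount R N * Real.exp (-(⌈a * N⌉₊ * γ))) atTop (nhds 0) := by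
  have hlim : Tendsto (fun N : ℝ => 3 * Real.exp (-((a * γ - R) * N))) atTop (nhds (3 * 0)) :=
    (Real.tendsto_exp_neg_atTop_nhds_zero.comp
      (tendsto_id.const_mul_atTop (sub_pos.2 h))).const_mul 3
  rw [mul_zero] at hlim
  refine tendsto_of_tendsto_of_tendsto_of_le_of_le' tendsto_const_nhds hlim
    (Eventually.of_forall fun N => by positivity) ?_
  filter_upwards [eventually_ge_atTop 0] with N hN
  -- The count is at most `t + 2` for `t = exp (R * N) ≥ 1`.
  have h1 : (messageCount R N : ℝ) ≤ 3 * Real.exp (R * N) := by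
    have h2 := (Nat.ceil_lt_add_one (Real.exp_pos (R * N)).le).le
    have h3 := Real.one_le_exp (mul_nonneg hR hN)
    rw [messageCount, Nat.cast_add, Nat.cast_one]
    linarith
  have h4 : Real.exp (-(⌈a * N⌉₊ * γ)) ≤ Real.exp (-(a * N * γ)) := by
    refine Real.exp_le_exp.2 (neg_le_neg (mul_le_mul_of_nonneg_right (Nat.le_ceil _) hγ.le))
  calc _ ≤ 3 * Real.exp (R * N) * Real.exp (-(a * N * γ)) := mul_le_mul h1 h4 (Real.exp_pos _).le
        (by positivity)
    _ = 3 * Real.exp (-((a * γ - R) * N)) := by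
      rw [mul_assoc, ← Real.exp_add]
      congr 2
      ring

/-- The shares `a` and `b` of the time `N` go to the block code and to the confirmation. Since `a *
γ₁ > R`, the failure probability `q₁` vanishes, so repetitions cost nothing asymptotically; the
exponent comes from the confirmation alone. -/
theorem isAchievable_of_split [∀ j, MeasurableSpace (𝒴 j)] [∀ j, DiscreteMeasurableSpace (𝒴 j)]
    [Fintype 𝒳] {ch : BroadcastChannel 𝒳 𝒴} (hB : ch.Bmax < ∞) {p : PMF 𝒳} {R E γ₁ γ₂ a b : ℝ}
    (hR : 0 ≤ R) (hE : 0 ≤ E) (hγ₁0 : 0 < γ₁) (hγ₁ : ∀ j, γ₁ < ch.mutualInfo p j) {x x' : 𝒳}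
    (hγ₂ : ∀ j, γ₂ < (ch.relEntropy j x x').toReal) (ha : 0 < a) (hb : 0 < b) (hab : a + b < 1)
    (haR : R < a * γ₁) (hbE : E = 0 ∨ 0 ≤ γ₂ ∧ E ≤ b * γ₂) : ch.IsAchievable R E := by
  obtain ⟨ρ₁, ρ₂, ⟨h10, h11⟩, ⟨h20, h21⟩, hs⟩ := exists_roundScheme hB p hγ₁ x x' hγ₂
  have hne : ∀ j, Nonempty (𝒴 j) := fun j =>
    let ⟨t, _⟩ := (ch x).support_nonempty
    ⟨t j⟩
  let q₁ : ℝ → ℝ := fun N =>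
    K * (ρ₁ ^ ⌈a * N⌉₊ + messageCount R N * Real.exp (-(⌈a * N⌉₊ * γ₁)))
  let ρ : ℝ → ℝ := fun N => ρ₂ ^ ⌈b * N⌉₊
  have hceil : ∀ {t : ℝ}, 0 < t → Tendsto (fun N : ℝ => ⌈t * N⌉₊) atTop atTop := fun ht =>
    tendsto_nat_ceil_atTop.comp (tendsto_id.const_mul_atTop ht)
  have hq₁lim : Tendsto q₁ atTop (nhds 0) := by
    have := (((tendsto_pow_atTop_nhds_zero_of_lt_one h10 h11).comp (hceil ha)).add
      (tendsto_messageCount_mul_exp hR hγ₁0 haR)).const_mul (K : ℝ)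
    simpa using this
  have hρlim : Tendsto ρ atTop (nhds 0) :=
    (tendsto_pow_atTop_nhds_zero_of_lt_one h20 h21).comp (hceil hb)
  have hq₁0 : ∀ N, 0 ≤ q₁ N := fun N => by positivity
  have hρ0 : ∀ N, 0 ≤ ρ N := fun N => by positivity
  have hηlim : Tendsto (fun N => q₁ N + ρ N) atTop (nhds 0) := by
    simpa using hq₁lim.add hρlim
  -- Halfway between `a + b` and `1`: a round takes at most `θ * N`, which leaves the factor `θ⁻¹`
  -- for repetitions.
  set θ := (1 + (a + b)) / 2 with hθ
  have hθ0 : 0 < θ := by rw [hθ]; linarith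
  have hθ1 : θ < 1 := by rw [hθ]; linarith
  have hfac : ∀ᶠ N in atTop, 1 + 2 * K * (q₁ N + ρ N) < θ⁻¹ := by
    have : Tendsto (fun N => 1 + 2 * K * (q₁ N + ρ N)) atTop (nhds (1 + 2 * K * 0)) :=
      (hηlim.const_mul (2 * (K : ℝ))).const_add 1
    refine this.eventually_lt_const ?_
    rw [mul_zero, add_zero]
    exact (one_lt_inv₀ hθ0).2 hθ1
  have h2Kq : ∀ᶠ N in atTop, 2 * K * q₁ N < 1 := by
    have : Tendsto (fun N => 2 * K * q₁ N) atTop (nhds (2 * K * 0)) :=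
      hq₁lim.const_mul (2 * (K : ℝ))
    refine this.eventually_lt_const ?_
    rw [mul_zero]
    exact one_pos
  -- Beyond `4 / (1 - (a + b))`, the two ceilings, which add at most `2`, fit between `(a + b) * N`
  -- and `θ * N`.
  obtain ⟨N₀, hN₀⟩ := eventually_atTop.1 (hfac.and (h2Kq.and
    ((hηlim.eventually_lt_const (by norm_num : (0 : ℝ) < 1 / 2)).and
      ((eventually_gt_atTop 0).and (eventually_ge_atTop (4 / (1 - (a + b))))))))
  have hex : ∀ N : ℝ, ∃ (M : ℕ) (c : VLFTCode 𝒳 𝒴 M),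
      (0 < N → 2 ≤ M ∧ c.expectedStop ch ≤ ENNReal.ofReal N) ∧
      (N₀ ≤ N → M = messageCount R N ∧
        c.errorProb ch ≤ ENNReal.ofReal (2 * K * (Real.exp (-(E * N)) * q₁ N))) := by
    intro N
    by_cases hN : N₀ ≤ N
    · obtain ⟨h1, h2, h3, h4, h5⟩ := hN₀ N hN
      have hM : messageCount R N ≠ 0 := Nat.succ_ne_zero _
      obtain ⟨s, hlen, hs1, hs2, hs3⟩ := hs ⌈a * N⌉₊ ⌈b * N⌉₊ (messageCount R N)
        (Nat.ceil_pos.2 (mul_pos ha h4)) (Nat.pos_of_ne_zero hM)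
      refine ⟨messageCount R N, s.code, fun _ => ⟨?_, ?_⟩, fun _ => ⟨rfl, ?_⟩⟩
      -- The `+ 1` in `messageCount` secures two messages even at rate `0`.
      · exact Nat.succ_le_succ (Nat.ceil_pos.2 (Real.exp_pos _))
      · refine (RoundScheme.code_expectedStop_le hM hs1 hs3 (hq₁0 N) (hρ0 N) h3.le).trans
          (ENNReal.ofReal_le_ofReal ?_)
        have h6 : (s.length : ℝ) ≤ θ * N := by
          rw [hlen, Nat.cast_add]
          have h7 := (Nat.ceil_lt_add_one (mul_pos ha h4).le).le
          have h8 := (Nat.ceil_lt_add_one (mul_pos hb h4).le).le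
          rw [div_le_iff₀ (by linarith)] at h5
          rw [hθ]
          linarith
        calc (s.length : ℝ) * (1 + 2 * K * (q₁ N + ρ N)) ≤ θ * N * θ⁻¹ :=
              mul_le_mul h6 h1.le (by have := hq₁0 N; have := hρ0 N; positivity) (by positivity)
          _ = N := by field_simp
      · refine RoundScheme.code_errorProb_le hM hs1 (fun j => (hs2 j).trans ?_) hs3 (hq₁0 N)
          (Real.exp_pos _).le (hρ0 N) h3.le
        rcases hbE with rfl | ⟨hγ0, hbE⟩
        · simp
        · refine (min_le_right _ _).trans (Real.exp_le_exp.2 (neg_le_neg ?_))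
          calc E * N ≤ b * γ₂ * N := mul_le_mul_of_nonneg_right hbE h4.le
            _ = b * N * γ₂ := by ring
            _ ≤ ⌈b * N⌉₊ * γ₂ := mul_le_mul_of_nonneg_right (Nat.le_ceil _) hγ0
    -- Achievability asks for a code at every `N > 0`; below `N₀` any code with two messages and no
    -- delay will do.
    · exact ⟨2, VLFTCode.trivialCode x, fun _ => ⟨le_rfl, by
        rw [VLFTCode.expectedStop_trivialCode]; exact zero_le⟩, fun h => absurd h hN⟩
  choose M c hc1 hc2 using hex
  refine ⟨hR, hE, M, c, hc1, ?_, ?_, ?_⟩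
  · refine le_liminf_of_le (by isBoundedDefault) ?_
    filter_upwards [eventually_ge_atTop N₀] with N hN
    have hN0 := (hN₀ N hN).2.2.2.1
    rw [(hc2 N hN).1]
    refine EReal.coe_le_coe_iff.2 ?_
    rw [le_div_iff₀ hN0]
    have := Real.log_le_log (Real.exp_pos _) (exp_le_messageCount R N)
    rwa [Real.log_exp] at this
  · have hlim : Tendsto (fun N => ENNReal.ofReal (2 * K * q₁ N)) atTop (nhds 0) := by
      have : Tendsto (fun N => 2 * K * q₁ N) atTop (nhds (2 * K * 0)) :=
        hq₁lim.const_mul (2 * (K : ℝ))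
      rw [mul_zero] at this
      simpa using ENNReal.tendsto_ofReal this
    refine tendsto_of_tendsto_of_tendsto_of_le_of_le' tendsto_const_nhds hlim
      (Eventually.of_forall fun N => zero_le) ?_
    filter_upwards [eventually_ge_atTop N₀] with N hN
    refine (hc2 N hN).2.trans (ENNReal.ofReal_le_ofReal ?_)
    have hN0 := (hN₀ N hN).2.2.2.1
    refine mul_le_mul_of_nonneg_left (mul_le_of_le_one_left (hq₁0 N) ?_) (by positivity)
    exact Real.exp_le_one_iff.2 (neg_nonpos.2 (mul_nonneg hE hN0.le))
  · refine le_liminf_of_le (by isBoundedDefault) ?_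
    filter_upwards [eventually_ge_atTop N₀] with N hN
    obtain ⟨-, h2, -, h4, -⟩ := hN₀ N hN
    refine ofReal_exp_le_neg_log_div h4 ((hc2 N hN).2.trans (ENNReal.ofReal_le_ofReal ?_))
    calc 2 * K * (Real.exp (-(E * N)) * q₁ N) = Real.exp (-(E * N)) * (2 * K * q₁ N) := by ring
      _ ≤ Real.exp (-(E * N)) := mul_le_of_le_one_right (Real.exp_pos _).le h2.le

variable [∀ j, MeasurableSpace (𝒴 j)] [∀ j, DiscreteMeasurableSpace (𝒴 j)] [Fintype 𝒳]
  {ch : BroadcastChannel 𝒳 𝒴} {R : ℝ}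

theorem exists_lt_mutualInfo (hRC : 0 < ch.C) {γ : ℝ} (hγ : γ < ch.C) :
    ∃ p, ∀ j, γ < ch.mutualInfo p j := by
  have : Nonempty (PMF 𝒳) := by
    by_contra hempty
    rw [not_nonempty_iff] at hempty
    rw [C, Real.iSup_of_isEmpty] at hRC
    exact lt_irrefl _ hRC
  obtain ⟨p, hp⟩ := exists_lt_of_lt_ciSup hγ
  exact ⟨p, fun j => hp.trans_le (ciInf_le (Set.finite_range _).bddBelow j)⟩

theorem isAchievable_zero (hB : ch.Bmax < ∞) (hR : 0 ≤ R) (hRC : R < ch.C) :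
    ch.IsAchievable R 0 := by
  have hC := hR.trans_lt hRC
  obtain ⟨γ, hγR, hγC⟩ := exists_between hRC
  obtain ⟨p, hp⟩ := exists_lt_mutualInfo hC hγC
  obtain ⟨x, -⟩ := p.support_nonempty
  have hγ0 : 0 < γ := hR.trans_lt hγR
  obtain ⟨a, haR, ha1⟩ := exists_between ((div_lt_one hγ0).2 hγR)
  have ha0 : 0 < a := (div_nonneg hR hγ0.le).trans_lt haR
  -- For exponent `0` the confirmation may be void: equal inputs have divergence `0 > -1`. This also
  -- covers `B = 0`.
  refine isAchievable_of_split hB (x := x) (x' := x) (γ₂ := -1) (b := (1 - a) / 2) hR le_rfl hγ0 hp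
    (fun j => (by norm_num : (-1 : ℝ) < 0).trans_le ENNReal.toReal_nonneg) ha0 (by linarith)
    (by linarith) ((div_lt_iff₀ hγ0).1 haR) (Or.inl rfl)

/-- The assumption on `E` says that the shares satisfy `R / C + E / B < 1`. By strictness `C` and
`B` may be lowered by some `t > 0`, below which an input distribution and a pair of inputs serve all
receivers. -/
theorem isAchievable_of_lt (hB : ch.Bmax < ∞) (hR : 0 ≤ R) (hRC : R < ch.C) {E : ℝ} (hE : 0 ≤ E)
    (hEB : E < ch.B.toReal * (1 - R / ch.C)) : ch.IsAchievable R E := by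
  have hC := hR.trans_lt hRC
  have hB0 : 0 < ch.B.toReal := by
    rcases ENNReal.toReal_nonneg.eq_or_lt with h | h
    · rw [← h, zero_mul] at hEB
      linarith
    · exact h
  have hlt : R / ch.C + E / ch.B.toReal < 1 := by
    have : E / ch.B.toReal < 1 - R / ch.C := by rwa [div_lt_iff₀' hB0]
    linarith
  have hlim : Tendsto (fun t : ℝ => R / (ch.C - t) + E / (ch.B.toReal - t))
      (nhdsWithin 0 (Set.Ioi 0)) (nhds (R / (ch.C - 0) + E / (ch.B.toReal - 0))) := by
    refine Tendsto.mono_left (ContinuousAt.tendsto ?_) nhdsWithin_le_nhds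
    refine ContinuousAt.add (ContinuousAt.div continuousAt_const (by fun_prop) ?_)
      (ContinuousAt.div continuousAt_const (by fun_prop) ?_)
    · rw [sub_zero]; exact hC.ne'
    · rw [sub_zero]; exact hB0.ne'
  rw [sub_zero, sub_zero] at hlim
  obtain ⟨t, ht1, ht0, ht2⟩ := ((hlim.eventually_lt_const hlt).and
    (Ioo_mem_nhdsGT (lt_min hC hB0))).exists
  obtain ⟨htC, htB⟩ := lt_min_iff.1 ht2
  obtain ⟨p, hp⟩ := exists_lt_mutualInfo hC (sub_lt_self ch.C ht0)
  have hγ₂ : ENNReal.ofReal (ch.B.toReal - t) < ch.B :=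
    (ENNReal.ofReal_lt_iff_lt_toReal (by linarith) (ENNReal.toReal_pos_iff.1 hB0).2.ne).2
      (sub_lt_self _ ht0)
  rw [B, lt_iSup_iff] at hγ₂
  obtain ⟨x, hx⟩ := hγ₂
  obtain ⟨x', hx'⟩ := lt_iSup_iff.1 hx
  set γ₁ := ch.C - t
  set γ₂ := ch.B.toReal - t
  have hγ₁0 : 0 < γ₁ := sub_pos.2 htC
  have hγ₂0 : 0 < γ₂ := sub_pos.2 htB
  have hD : ∀ j, γ₂ < (ch.relEntropy j x x').toReal := fun j =>
    (ENNReal.ofReal_lt_iff_lt_toReal hγ₂0.le (relEntropy_ne_top hB j x x')).1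
      (hx'.trans_le (iInf_le _ j))
  have h1 : 0 ≤ R / γ₁ := by positivity
  have h2 : 0 ≤ E / γ₂ := by positivity
  -- Two thirds of the slack enlarge the shares; the last third keeps `a + b < 1`.
  set δ := (1 - (R / γ₁ + E / γ₂)) / 3 with hδ
  have hδ0 : 0 < δ := by rw [hδ]; linarith
  refine isAchievable_of_split hB (a := R / γ₁ + δ) (b := E / γ₂ + δ) hR hE hγ₁0 hp hD (by linarith)
    (by linarith) (by rw [hδ]; linarith) ?_ (Or.inr ⟨hγ₂0.le, ?_⟩)
  · rw [add_mul, div_mul_cancel₀ _ hγ₁0.ne']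
    linarith [mul_pos hδ0 hγ₁0]
  · rw [add_mul, div_mul_cancel₀ _ hγ₂0.ne']
    linarith [mul_pos hδ0 hγ₂0]

theorem le_reliability (hB : ch.Bmax < ∞) (hR : 0 ≤ R) (hRC : R < ch.C) :
    ((ch.B.toReal * (1 - R / ch.C) : ℝ) : EReal) ≤ ch.reliability R := by
  have hC := hR.trans_lt hRC
  have hnn : 0 ≤ ch.B.toReal * (1 - R / ch.C) :=
    mul_nonneg ENNReal.toReal_nonneg (sub_nonneg.2 ((div_le_one hC).2 hRC.le))
  -- If the bound is `0`, no admissible exponent lies strictly below it, and `(R, 0)` has to be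
  -- achieved directly.
  rcases hnn.eq_or_lt with h0 | h0
  · rw [← h0]
    exact le_sSup ⟨0, rfl, isAchievable_zero hB hR hRC⟩
  · refine le_of_forall_lt fun e he => ?_
    obtain ⟨r, her, hr⟩ := EReal.lt_iff_exists_real_btwn.1 he
    have hr' : r < ch.B.toReal * (1 - R / ch.C) := by exact_mod_cast hr
    refine her.trans_le (le_trans (b := ((max r 0 : ℝ) : EReal)) ?_ (le_sSup ⟨max r 0, rfl,
      isAchievable_of_lt hB hR hRC (le_max_right _ _) (max_lt hr' h0)⟩))
    exact EReal.coe_le_coe_iff.2 (le_max_left _ _)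

end BroadcastChannel

theorem theorem1 {K : ℕ} (hK : 1 ≤ K) {𝒳 : Type u} [Fintype 𝒳] {𝒴 : Fin K → Type v}
    [∀ j, Fintype (𝒴 j)] [∀ j, MeasurableSpace (𝒴 j)] [∀ j, DiscreteMeasurableSpace (𝒴 j)]
    (ch : BroadcastChannel 𝒳 𝒴) (hB : ch.Bmax < ∞) :
    (∀ R : ℝ, 0 ≤ R → R < ch.C →
      ((ch.B.toReal * (1 - R / ch.C) : ℝ) : EReal) ≤ ch.reliability R) ∧
    (∀ R : ℝ, 0 ≤ R → R < ch.Cbar →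
      ch.reliability R ≤ ⨅ j, (((ch.Buser j).toReal * (1 - R / ch.Cuser j) : ℝ) : EReal)) := by
  exact ⟨fun _ hR hRC => BroadcastChannel.le_reliability hB hR hRC,
    fun _ hR hRC => BroadcastChannel.reliability_le hB hR hRC⟩
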